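/- Let $G$ be a discrete group, $N$ a normal subgroup, $q:G\to G/N$ the quotient map, and $\alpha$ an action of $G$ on a $C^*$-algebra $B$. **Notation.** The semidirect product bundle $B\times G$ is the Fell bundle over $G$ with fibres $\{(b,s):b\in B\}$ and operations $(b,s)(c,t)=(b\alpha_s(c),st)$, $(b,s)^*=(\alpha_{s^{-1}}(b)^*,s^{-1})$; its full cross sectional algebra is the crossed product $B\times_\alpha G$, and the dual coaction $\widehat\alpha$ of $G$ on it is determined by $(b,s)\mapsto (b,s)\otimes s$. A (Green) twist for $\alpha$ over $N$ is a homomorphism $\tau:N\to UM(B)$ into the unitary multipliers of $B$ with $\alpha_s(\tau_n)=\tau_{sns^{-1}}$ and $\alpha_n(b)=\tau_n b\tau_{n^{-1}}$ for $s\in G$, $n\in N$, $b\in B$; then $(B,G,N,\alpha,\tau)$ is a twisted action, and $\alpha$ is called twisted over $N$ if such a $\tau$ exists. The twisted semidirect product bundle $B\times_N G$ is the Fell bundle over $G/N$ of orbits $[b,s]$ of $B\times G$ under the right action $(b,s)\cdot n=(b\tau_n,n^{-1}s)$ of $N$. The twisted crossed product $B\times_{\alpha,\tau}G$ is the quotient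 of $B\times_\alpha G$ determined by the covariant representations $(\pi,U)$ with $\pi(\tau_n)=U_n$ for $n\in N$; it carries the dual coaction of $G/N$ determined by $(b,s)\mapsto(b,s)\otimes sN$. For a Fell bundle $\mathcal D$ over $G/N$, the pull-back $q^*\mathcal D$ is the Fell bundle over $G$ with fibre $D_{sN}$ over $s$ and the operations of $\mathcal D$. For a coaction $\delta:D\to D\otimes C^*(G/N)$ (minimal tensor product, full group $C^*$-algebra) let $\mathcal D$ be its Fell bundle of spectral subspaces $D_{sN}=\{d\in D:\delta(d)=d\otimes sN\}$; a coaction of $G$ is induced from $\delta$ if it is isomorphic to the dual coaction $d_s\mapsto d_s\otimes s$ of $G$ on the full cross sectional algebra $C^*(q^*\mathcal D)$. **Theorem.** 1. If $(B,G,N,\alpha,\tau)$ is a twisted action, then the Fell bundle $B\times G$ is isomorphic to the pull-back $q^*(B\times_N G)$, and the dual coaction $\widehat\alpha$ of $G$ on $B\times_\alpha G$ is induced from the dual coaction of $G/N$ on the twisted crossed product $B\times_{\alpha,\tau}G$. 2. The bundle $B\times G$ is isomorphic to the pull-back $q^*\mathcal D$ of some Fell bundle $\mathcal D$ over $G/N$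 if and only if the dual coaction $\widehat\alpha$ is induced from some coaction of $G/N$. 3. If the equivalent conditions in 2 hold, then $\alpha$ is twisted over $N$. -/

import Mathlib

set_option linter.unusedSectionVars false

open scoped TensorProduct DirectSum Pointwise

universe u v w

noncomputable section

namespace FellCoaction

/-! ### C*-seminorms and the C*-algebras they generate -/

/-- A C*-seminorm on a complex `*`-algebra. -/
structure CStarSeminorm (R : Type u) [NonUnitalRing R] [StarRing R] [Module ℂ R]
    extends Seminorm ℂ R where
  mul_le' : ∀ x y, toFun (x * y) ≤ toFun x * toFun y
  star_mul_self' : ∀ x, toFun (star x * x) = toFun x ^ 2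

namespace CStarSeminorm

section
variable {R : Type u} [NonUnitalRing R] [StarRing R] [Module ℂ R]

instance : CoeFun (CStarSeminorm R) (fun _ => R → ℝ) := ⟨fun p => p.toSeminorm⟩

theorem mul_le (p : CStarSeminorm R) (x y : R) : p (x * y) ≤ p x * p y := p.mul_le' x y

theorem star_mul_self (p : CStarSeminorm R) (x : R) : p (star x * x) = p x ^ 2 :=
  p.star_mul_self' x

theorem nonneg (p : CStarSeminorm R) (x : R) : 0 ≤ p x := apply_nonneg p.toSeminorm x

theorem le_star (p : CStarSeminorm R) (x : R) : p x ≤ p (star x) := by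
  have h1 := p.mul_le (star x) x
  rw [p.star_mul_self] at h1
  rcases (p.nonneg x).eq_or_lt with h | h
  · rw [← h]; exact p.nonneg _
  · nlinarith

theorem star_eq (p : CStarSeminorm R) (x : R) : p (star x) = p x :=
  le_antisymm (by simpa using p.le_star (star x)) (p.le_star x)

/-- The pointwise supremum of a nonempty, pointwise bounded family of C*-seminorms. -/
def sup (S : Set (CStarSeminorm R)) (hne : S.Nonempty)
    (hb : ∀ x, ∃ M, ∀ p ∈ S, p x ≤ M) : CStarSeminorm R := by
  have hbdd : ∀ x, BddAbove ((fun p : CStarSeminorm R => p x) '' S) := fun x => by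
    obtain ⟨M, hM⟩ := hb x
    exact ⟨M, by rintro _ ⟨p, hp, rfl⟩; exact hM p hp⟩
  have hle : ∀ x, ∀ p ∈ S, p x ≤ sSup ((fun p : CStarSeminorm R => p x) '' S) :=
    fun x p hp => le_csSup (hbdd x) ⟨p, hp, rfl⟩
  have h0 : ∀ x, 0 ≤ sSup ((fun p : CStarSeminorm R => p x) '' S) := fun x =>
    (hne.some.nonneg x).trans (hle x _ hne.some_mem)
  have hsup : ∀ x M, (∀ p ∈ S, p x ≤ M) → sSup ((fun p : CStarSeminorm R => p x) '' S) ≤ M := by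
    intro x M h
    refine csSup_le (hne.image _) ?_
    rintro _ ⟨p, hp, rfl⟩
    exact h p hp
  refine
    { toSeminorm := Seminorm.of (fun x => sSup ((fun p : CStarSeminorm R => p x) '' S)) ?_ ?_
      mul_le' := ?_
      star_mul_self' := ?_ }
  · intro x y
    refine hsup _ _ fun p hp => (map_add_le_add p.toSeminorm x y).trans ?_
    exact add_le_add (hle x p hp) (hle y p hp)
  · intro a x
    have : (fun p : CStarSeminorm R => p (a • x)) '' S
        = ‖a‖ • ((fun p : CStarSeminorm R => p x) '' S) := by
      ext r
      simp only [Set.mem_image, Set.mem_smul_set, smul_eq_mul, exists_exists_and_eq_and,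
        map_smul_eq_mul]
    show sSup ((fun p : CStarSeminorm R => p (a • x)) '' S) = _
    rw [this, Real.sSup_smul_of_nonneg (norm_nonneg a), smul_eq_mul]
  · intro x y
    refine hsup _ _ fun p hp => (p.mul_le x y).trans ?_
    exact mul_le_mul (hle x p hp) (hle y p hp) (p.nonneg y) (h0 x)
  · intro x
    refine le_antisymm (hsup _ _ fun p hp => ?_) ?_
    · rw [p.star_mul_self]
      exact pow_le_pow_left₀ (p.nonneg x) (hle x p hp) 2
    · have : sSup ((fun p : CStarSeminorm R => p x) '' S)
          ≤ Real.sqrt (sSup ((fun p : CStarSeminorm R => p (star x * x)) '' S)) := by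
        refine hsup _ _ fun p hp => Real.le_sqrt_of_sq_le ?_
        rw [← p.star_mul_self]
        exact hle (star x * x) p hp
      calc _ ≤ (Real.sqrt (sSup ((fun p : CStarSeminorm R => p (star x * x)) '' S))) ^ 2 :=
            pow_le_pow_left₀ (h0 x) this 2
        _ = _ := Real.sq_sqrt (h0 (star x * x))

theorem sup_apply (S : Set (CStarSeminorm R)) (hne : S.Nonempty)
    (hb : ∀ x, ∃ M, ∀ p ∈ S, p x ≤ M) (x : R) :
    sup S hne hb x = sSup ((fun p : CStarSeminorm R => p x) '' S) := rfl

theorem le_sup {S : Set (CStarSeminorm R)} {hne : S.Nonempty}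
    {hb : ∀ x, ∃ M, ∀ p ∈ S, p x ≤ M} {p : CStarSeminorm R} (hp : p ∈ S) (x : R) :
    p x ≤ sup S hne hb x := by
  rw [sup_apply]
  obtain ⟨M, hM⟩ := hb x
  exact le_csSup ⟨M, by rintro _ ⟨p, hp, rfl⟩; exact hM p hp⟩ ⟨p, hp, rfl⟩

theorem sup_le {S : Set (CStarSeminorm R)} {hne : S.Nonempty}
    {hb : ∀ x, ∃ M, ∀ p ∈ S, p x ≤ M} {x : R} {M : ℝ} (h : ∀ p ∈ S, p x ≤ M) :
    sup S hne hb x ≤ M := by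
  rw [sup_apply]
  refine csSup_le (hne.image _) ?_
  rintro _ ⟨p, hp, rfl⟩
  exact h p hp

/-- The pull-back of the norm of a C*-algebra along a `*`-homomorphism. -/
def ofHom {E : Type w} [NonUnitalCStarAlgebra E] (f : R →⋆ₙₐ[ℂ] E) : CStarSeminorm R where
  toSeminorm := (normSeminorm ℂ E).comp (f : R →ₗ[ℂ] E)
  mul_le' x y := by
    show ‖f (x * y)‖ ≤ ‖f x‖ * ‖f y‖
    rw [map_mul]; exact norm_mul_le _ _
  star_mul_self' x := by
    show ‖f (star x * x)‖ = ‖f x‖ ^ 2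
    rw [map_mul, map_star, CStarRing.norm_star_mul_self, sq]

@[simp] theorem ofHom_apply {E : Type w} [NonUnitalCStarAlgebra E] (f : R →⋆ₙₐ[ℂ] E) (x : R) :
    ofHom f x = ‖f x‖ := rfl

end

section
variable {R : Type u} [NonUnitalRing R] [StarRing R] [Module ℂ R] [IsScalarTower ℂ R R]
  [SMulCommClass ℂ R R] [StarModule ℂ R]

/-- The algebra `R`, topologised by the seminorm `p`. -/
def Pre (_p : CStarSeminorm R) : Type u := R

variable (p : CStarSeminorm R)

instance : NonUnitalRing p.Pre := inferInstanceAs (NonUnitalRing R)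
instance : StarRing p.Pre := inferInstanceAs (StarRing R)
instance : Module ℂ p.Pre := inferInstanceAs (Module ℂ R)
instance : IsScalarTower ℂ p.Pre p.Pre := inferInstanceAs (IsScalarTower ℂ R R)
instance : SMulCommClass ℂ p.Pre p.Pre := inferInstanceAs (SMulCommClass ℂ R R)
instance : StarModule ℂ p.Pre := inferInstanceAs (StarModule ℂ R)

instance : NonUnitalSeminormedRing p.Pre where
  __ := (inferInstance : NonUnitalRing p.Pre)
  __ := AddGroupSeminorm.toSeminormedAddCommGroup
    (E := p.Pre) p.toSeminorm.toAddGroupSeminorm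
  norm_mul_le x y := p.mul_le x y

theorem Pre.norm_def (x : p.Pre) : ‖x‖ = p x := rfl

instance : NormedSpace ℂ p.Pre where
  norm_smul_le a x := (map_smul_eq_mul p.toSeminorm a x).le

instance : NormedStarGroup p.Pre where
  norm_star_le x := (p.star_eq x).le

/-- The Hausdorff completion of a `*`-algebra with respect to a C*-seminorm. -/
def Compl : Type u := UniformSpace.Completion p.Pre

instance : NormedAddCommGroup p.Compl :=
  inferInstanceAs (NormedAddCommGroup (UniformSpace.Completion p.Pre))
instance : NormedSpace ℂ p.Compl :=
  inferInstanceAs (NormedSpace ℂ (UniformSpace.Completion p.Pre))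
instance : CompleteSpace p.Compl :=
  inferInstanceAs (CompleteSpace (UniformSpace.Completion p.Pre))

/-- The canonical map of the `*`-algebra into its completion, as a continuous linear map. -/
def preι : p.Pre →L[ℂ] p.Compl := UniformSpace.Completion.toComplL

theorem preι_dense : DenseRange p.preι := UniformSpace.Completion.denseRange_coe

theorem norm_preι (x : p.Pre) : ‖p.preι x‖ = ‖x‖ := UniformSpace.Completion.norm_coe x

theorem preι_uniform : IsUniformInducing p.preι :=
  UniformSpace.Completion.isUniformInducing_coe p.Pre

/-- Left multiplication on the completion. -/
def mulL : p.Compl →L[ℂ] p.Compl →L[ℂ] p.Compl :=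
  (LinearMap.mkContinuous₂ (LinearMap.mk₂ ℂ
      (fun x y : p.Pre => p.preι (x * y))
      (by intros; simp [add_mul]) (by intros; simp [smul_mul_assoc])
      (by intros; simp [mul_add]) (by intros; simp [mul_smul_comm])) 1 (by
        intro x y
        simpa [norm_preι] using norm_mul_le x y)
    |>.flip.extend p.preι).flip.extend p.preι

theorem mulL_preι (x y : p.Pre) : p.mulL (p.preι x) (p.preι y) = p.preι (x * y) := by
  rw [mulL, ContinuousLinearMap.extend_eq _ p.preι_dense p.preι_uniform,
    ContinuousLinearMap.flip_apply, ContinuousLinearMap.extend_eq _ p.preι_dense p.preι_uniform]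
  simp

/-- The involution of the completion. -/
def starC : p.Compl → p.Compl := UniformSpace.Completion.map (star : p.Pre → p.Pre)

theorem continuous_starC : Continuous p.starC := UniformSpace.Completion.continuous_map

theorem starC_preι (x : p.Pre) : p.starC (p.preι x) = p.preι (star x) :=
  UniformSpace.Completion.map_coe
    (AddMonoidHomClass.isometry_of_norm (starAddEquiv (R := p.Pre))
      (fun x => norm_star x)).uniformContinuous x

theorem ind {P : p.Compl → Prop} (hP : IsClosed {x | P x}) (h : ∀ x, P (p.preι x)) :
    ∀ x, P x := fun x => p.preι_dense.induction_on x hP h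

theorem ind₂ {P : p.Compl → p.Compl → Prop} (hP : IsClosed {x : p.Compl × p.Compl | P x.1 x.2})
    (h : ∀ x y, P (p.preι x) (p.preι y)) : ∀ x y, P x y := fun x y =>
  p.ind (P := fun x => P x y) (hP.preimage (Continuous.prodMk_left y))
    (fun x => p.ind (hP.preimage (Continuous.prodMk_right (p.preι x))) (h x) y) x

instance : Mul p.Compl := ⟨fun x y => p.mulL x y⟩
instance : Star p.Compl := ⟨p.starC⟩

theorem compl_mul_def (x y : p.Compl) : x * y = p.mulL x y := rfl
theorem compl_star_def (x : p.Compl) : star x = p.starC x := rfl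

theorem compl_mul (x y : p.Pre) : p.preι x * p.preι y = p.preι (x * y) := p.mulL_preι x y
theorem compl_star (x : p.Pre) : star (p.preι x) = p.preι (star x) := p.starC_preι x

theorem compl_continuous_mul : Continuous fun x : p.Compl × p.Compl => x.1 * x.2 := by
  simp only [compl_mul_def]
  fun_prop

theorem compl_continuous_star : Continuous fun x : p.Compl => star x := p.continuous_starC

theorem compl_mul_assoc (x y z : p.Compl) : x * y * z = x * (y * z) := by
  revert x y
  refine p.ind₂ ?_ fun x y => ?_
  · refine isClosed_eq ?_ ?_ <;> simp only [compl_mul_def] <;> fun_prop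
  · revert z
    refine p.ind ?_ fun z => ?_
    · have hl : ∀ a : p.Compl, Continuous fun z => a * z := fun a =>
        p.compl_continuous_mul.comp (Continuous.prodMk_right a)
      exact isClosed_eq (hl _) ((hl _).comp (hl _))
    · simp only [compl_mul, mul_assoc]

instance : NonUnitalNormedRing p.Compl where
  __ := (inferInstance : NormedAddCommGroup p.Compl)
  mul := (· * ·)
  left_distrib x y z := by simp [compl_mul_def]
  right_distrib x y z := by simp [compl_mul_def]
  zero_mul x := by simp [compl_mul_def]
  mul_zero x := by simp [compl_mul_def]
  mul_assoc := p.compl_mul_assoc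
  norm_mul_le := by
    refine p.ind₂ ?_ fun x y => ?_
    · exact isClosed_le p.compl_continuous_mul.norm (by fun_prop)
    · rw [compl_mul, norm_preι, norm_preι, norm_preι]
      exact norm_mul_le x y

instance : StarRing p.Compl where
  star_involutive := by
    have hc := p.compl_continuous_star
    refine p.ind (isClosed_eq (hc.comp hc) continuous_id) fun x => ?_
    rw [compl_star, compl_star, star_star]
  star_mul := by
    have hc := p.compl_continuous_star
    refine p.ind₂ (isClosed_eq (hc.comp p.compl_continuous_mul) ?_) fun x y => ?_
    · exact p.compl_continuous_mul.comp
        ((hc.comp continuous_snd).prodMk (hc.comp continuous_fst))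
    · rw [compl_mul, compl_star, compl_star, compl_star, compl_mul, star_mul]
  star_add := by
    have hc := p.compl_continuous_star
    refine p.ind₂ (isClosed_eq (hc.comp continuous_add) ?_) fun x y => ?_
    · exact continuous_add.comp
        ((hc.comp continuous_fst).prodMk (hc.comp continuous_snd))
    · rw [← map_add, compl_star, compl_star, compl_star, star_add, map_add]

instance : CStarRing p.Compl where
  norm_mul_self_le := by
    have hc := p.compl_continuous_star
    refine p.ind (isClosed_le (by fun_prop) ?_) fun x => ?_
    · exact (p.compl_continuous_mul.comp (hc.prodMk continuous_id)).norm
    · rw [compl_star, compl_mul, norm_preι, norm_preι]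
      exact ((p.star_mul_self x).trans (sq _)).ge

instance : NonUnitalCStarAlgebra p.Compl where
  smul_assoc a x y := by simp [compl_mul_def, smul_eq_mul]
  smul_comm a x y := by simp [compl_mul_def, smul_eq_mul]
  star_smul a := by
    have hc := p.compl_continuous_star
    refine p.ind (isClosed_eq (hc.comp (continuous_const_smul a))
      ((continuous_const_smul (star a)).comp hc)) fun x => ?_
    rw [← map_smul, compl_star, compl_star, star_smul, map_smul]

/-- The canonical `*`-homomorphism into the completion. -/
def ι : R →⋆ₙₐ[ℂ] p.Compl where
  toFun x := p.preι x
  map_smul' a x := p.preι.map_smul a x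
  map_zero' := p.preι.map_zero
  map_add' x y := p.preι.map_add x y
  map_mul' x y := (p.compl_mul x y).symm
  map_star' x := (p.compl_star x).symm

theorem norm_ι (x : R) : ‖p.ι x‖ = p x := p.norm_preι x

theorem ι_dense : DenseRange p.ι := p.preι_dense

/-- A `*`-homomorphism into a C*-algebra that is dominated by `p` extends to the completion. -/
def lift {E : Type w} [NonUnitalCStarAlgebra E] (f : R →⋆ₙₐ[ℂ] E) (hf : ∀ x, ‖f x‖ ≤ p x) :
    p.Compl →⋆ₙₐ[ℂ] E :=
  let F : p.Pre →L[ℂ] E := LinearMap.mkContinuous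
    (⟨⟨fun x => f x, map_add f⟩, map_smul f⟩ : p.Pre →ₗ[ℂ] E) 1
    (fun x => by rw [one_mul]; exact hf x)
  have hF : ∀ x, F.extend p.preι (p.preι x) = f x := fun x =>
    ContinuousLinearMap.extend_eq _ p.preι_dense p.preι_uniform x
  { toFun := F.extend p.preι
    map_smul' := map_smul _
    map_zero' := map_zero _
    map_add' := map_add _
    map_mul' := by
      refine p.ind₂ (isClosed_eq ?_ ?_) fun x y => ?_
      · exact (F.extend p.preι).continuous.comp p.compl_continuous_mul
      · fun_prop
      · rw [compl_mul, hF, hF, hF]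
        exact map_mul f x y
    map_star' := by
      refine p.ind (isClosed_eq ?_ ?_) fun x => ?_
      · exact (F.extend p.preι).continuous.comp p.compl_continuous_star
      · fun_prop
      · rw [compl_star, hF, hF]
        exact map_star f x }

theorem lift_ι {E : Type w} [NonUnitalCStarAlgebra E] (f : R →⋆ₙₐ[ℂ] E) (hf : ∀ x, ‖f x‖ ≤ p x)
    (x : R) : p.lift f hf (p.ι x) = f x :=
  ContinuousLinearMap.extend_eq _ p.preι_dense p.preι_uniform x

end
end CStarSeminorm

/-! ### The spatial (minimal) tensor product -/

section Spatial

variable {A A' : Type u} {C C' : Type u} [NonUnitalCStarAlgebra A] [NonUnitalCStarAlgebra A']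
  [NonUnitalCStarAlgebra C] [NonUnitalCStarAlgebra C']

/-- For representations `π` of `A` on `H` and `ρ` of `C` on `K`, the operator `(π ⊗ ρ)(x)` on the
tensor product of the inner product spaces `H` and `K` (a dense subspace of the Hilbert space
tensor product, so that the operator norm is the same). -/
def repTensor {H K : Type u} [NormedAddCommGroup H] [InnerProductSpace ℂ H] [CompleteSpace H]
    [NormedAddCommGroup K] [InnerProductSpace ℂ K] [CompleteSpace K]
    (π : A →⋆ₙₐ[ℂ] (H →L[ℂ] H)) (ρ : C →⋆ₙₐ[ℂ] (K →L[ℂ] K)) :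
    A ⊗[ℂ] C →ₗ[ℂ] (H ⊗[ℂ] K →L[ℂ] H ⊗[ℂ] K) :=
  TensorProduct.lift (LinearMap.mk₂ ℂ (fun a c => TensorProduct.mapL (π a) (ρ c))
    (by intros; simp only [map_add, TensorProduct.mapL_add_left])
    (by intros; simp only [map_smul, TensorProduct.mapL_smul_left])
    (by intros; simp only [map_add, TensorProduct.mapL_add_right])
    (by intros; simp only [map_smul, TensorProduct.mapL_smul_right]))

section
variable {H K : Type u} [NormedAddCommGroup H] [InnerProductSpace ℂ H] [CompleteSpace H]
    [NormedAddCommGroup K] [InnerProductSpace ℂ K] [CompleteSpace K]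
    (π : A →⋆ₙₐ[ℂ] (H →L[ℂ] H)) (ρ : C →⋆ₙₐ[ℂ] (K →L[ℂ] K))

@[simp] theorem repTensor_tmul (a : A) (c : C) :
    repTensor π ρ (a ⊗ₜ c) = TensorProduct.mapL (π a) (ρ c) := rfl

theorem repTensor_mul (x y : A ⊗[ℂ] C) :
    repTensor π ρ (x * y) = repTensor π ρ x * repTensor π ρ y := by
  induction x with
  | zero => simp
  | add x x' hx hx' => simp only [add_mul, map_add, hx, hx']
  | tmul a c =>
    induction y with
    | zero => simp
    | add y y' hy hy' => simp only [mul_add, map_add, hy, hy']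
    | tmul b d =>
      simp only [Algebra.TensorProduct.tmul_mul_tmul, repTensor_tmul, map_mul,
        TensorProduct.mapL_mul]

theorem repTensor_star (x : A ⊗[ℂ] C) (ξ η : H ⊗[ℂ] K) :
    inner ℂ (repTensor π ρ (star x) ξ) η = inner ℂ ξ (repTensor π ρ x η) := by
  induction x with
  | zero => simp
  | add x x' hx hx' =>
    simp only [star_add, map_add, _root_.add_apply, inner_add_left, inner_add_right,
      hx, hx']
  | tmul a c =>
    induction ξ with
    | zero => simp
    | add ξ ξ' h h' => simp only [map_add, inner_add_left, h, h']
    | tmul ξ₁ ξ₂ =>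
      induction η with
      | zero => simp
      | add η η' h h' => simp only [map_add, inner_add_right, h, h']
      | tmul η₁ η₂ =>
        simp only [TensorProduct.star_tmul, repTensor_tmul, map_star, TensorProduct.mapL_tmul,
          TensorProduct.inner_tmul, ContinuousLinearMap.star_eq_adjoint,
          ContinuousLinearMap.adjoint_inner_left]

theorem norm_repTensor_nonneg (x : A ⊗[ℂ] C) : 0 ≤ ‖repTensor π ρ x‖ :=
  ContinuousLinearMap.opNorm_nonneg _

theorem norm_repTensor_mul_le (x y : A ⊗[ℂ] C) :
    ‖repTensor π ρ (x * y)‖ ≤ ‖repTensor π ρ x‖ * ‖repTensor π ρ y‖ := by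
  rw [repTensor_mul]
  exact ContinuousLinearMap.opNorm_comp_le _ _

theorem norm_repTensor_sq_le (x : A ⊗[ℂ] C) :
    ‖repTensor π ρ x‖ ^ 2 ≤ ‖repTensor π ρ (star x * x)‖ := by
  have h0 := norm_repTensor_nonneg π ρ (star x * x)
  have h : ‖repTensor π ρ x‖ ≤ Real.sqrt ‖repTensor π ρ (star x * x)‖ := by
    refine ContinuousLinearMap.opNorm_le_bound _ (Real.sqrt_nonneg _) fun ξ => ?_
    refine abs_le_of_sq_le_sq' ?_ (mul_nonneg (Real.sqrt_nonneg _) (norm_nonneg _)) |>.2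
    rw [mul_pow, Real.sq_sqrt h0, ← inner_self_eq_norm_sq (𝕜 := ℂ), ← repTensor_star]
    have h3 := norm_inner_le_norm (𝕜 := ℂ) (repTensor π ρ (star x) (repTensor π ρ x ξ)) ξ
    refine (Complex.re_le_norm _).trans (h3.trans ?_)
    rw [sq ‖ξ‖, ← mul_assoc]
    refine mul_le_mul_of_nonneg_right ?_ (norm_nonneg _)
    rw [repTensor_mul]
    exact ContinuousLinearMap.le_opNorm (repTensor π ρ (star x) * repTensor π ρ x) ξ
  calc ‖repTensor π ρ x‖ ^ 2 ≤ (Real.sqrt ‖repTensor π ρ (star x * x)‖) ^ 2 :=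
        pow_le_pow_left₀ (norm_repTensor_nonneg π ρ x) h 2
    _ = _ := Real.sq_sqrt h0

theorem norm_repTensor_star (x : A ⊗[ℂ] C) :
    ‖repTensor π ρ (star x)‖ = ‖repTensor π ρ x‖ := by
  have key : ∀ y : A ⊗[ℂ] C, ‖repTensor π ρ y‖ ≤ ‖repTensor π ρ (star y)‖ := fun y => by
    have h2 := (norm_repTensor_sq_le π ρ y).trans (norm_repTensor_mul_le π ρ _ _)
    rcases (norm_repTensor_nonneg π ρ y).eq_or_lt with h | h
    · rw [← h]; exact norm_repTensor_nonneg π ρ _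
    · nlinarith
  exact le_antisymm (by simpa using key (star x)) (key x)

/-- The C*-seminorm `x ↦ ‖(π ⊗ ρ)(x)‖` on the algebraic tensor product. -/
def repSeminorm : CStarSeminorm (A ⊗[ℂ] C) where
  toSeminorm := (normSeminorm ℂ (H ⊗[ℂ] K →L[ℂ] H ⊗[ℂ] K)).comp (repTensor π ρ)
  mul_le' x y := norm_repTensor_mul_le π ρ x y
  star_mul_self' x := by
    refine le_antisymm ?_ (norm_repTensor_sq_le π ρ x)
    refine (norm_repTensor_mul_le π ρ _ _).trans ?_
    rw [norm_repTensor_star, sq]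
    exact le_rfl

theorem repSeminorm_apply (x : A ⊗[ℂ] C) : repSeminorm π ρ x = ‖repTensor π ρ x‖ := rfl

end

/-- The C*-seminorms `x ↦ ‖(π ⊗ ρ)(x)‖`, for all Hilbert space representations `π` of `A` and
`ρ` of `C`. -/
def spatialSeminorms (A C : Type u) [NonUnitalCStarAlgebra A] [NonUnitalCStarAlgebra C] :
    Set (CStarSeminorm (A ⊗[ℂ] C)) :=
  {p | ∃ (H : Type u) (K : Type u) (_ : NormedAddCommGroup H) (_ : InnerProductSpace ℂ H)
    (_ : CompleteSpace H) (_ : NormedAddCommGroup K) (_ : InnerProductSpace ℂ K)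
    (_ : CompleteSpace K) (π : A →⋆ₙₐ[ℂ] (H →L[ℂ] H)) (ρ : C →⋆ₙₐ[ℂ] (K →L[ℂ] K)),
    p = repSeminorm π ρ}

theorem spatialSeminorms_nonempty : (spatialSeminorms A C).Nonempty :=
  ⟨_, PUnit, PUnit, inferInstance, inferInstance, inferInstance, inferInstance, inferInstance,
    inferInstance, 0, 0, rfl⟩

theorem spatialSeminorms_bdd (x : A ⊗[ℂ] C) : ∃ M, ∀ p ∈ spatialSeminorms A C, p x ≤ M := by
  induction x with
  | zero => exact ⟨0, fun p _ => (map_zero p.toSeminorm).le⟩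
  | add x y hx hy =>
    obtain ⟨M, hM⟩ := hx
    obtain ⟨M', hM'⟩ := hy
    exact ⟨M + M', fun p hp => (map_add_le_add p.toSeminorm x y).trans
      (add_le_add (hM p hp) (hM' p hp))⟩
  | tmul a c =>
    refine ⟨‖a‖ * ‖c‖, ?_⟩
    rintro p ⟨H, K, _, _, _, _, _, _, π, ρ, rfl⟩
    rw [repSeminorm_apply, repTensor_tmul]
    refine (TensorProduct.norm_mapL_le _ _).trans ?_
    gcongr
    · exact NonUnitalStarAlgHom.norm_apply_le π a
    · exact NonUnitalStarAlgHom.norm_apply_le ρ c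

/-- The spatial norm: `‖x‖ = sup ‖(π ⊗ ρ)(x)‖` over all representations `π` of `A` and
`ρ` of `C`. -/
def spatialNorm (A C : Type u) [NonUnitalCStarAlgebra A] [NonUnitalCStarAlgebra C] :
    CStarSeminorm (A ⊗[ℂ] C) :=
  CStarSeminorm.sup (spatialSeminorms A C) spatialSeminorms_nonempty spatialSeminorms_bdd

/-- The spatial (minimal) C*-tensor product of two C*-algebras. -/
abbrev SpatialTensor (A C : Type u) [NonUnitalCStarAlgebra A] [NonUnitalCStarAlgebra C] :
    Type u := (spatialNorm A C).Compl

/-- The elementary tensor `a ⊗ c` in the spatial tensor product. -/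
def SpatialTensor.tmul (a : A) (c : C) : SpatialTensor A C := (spatialNorm A C).ι (a ⊗ₜ c)

theorem SpatialTensor.tmul_mul (a b : A) (c d : C) :
    tmul a c * tmul b d = tmul (a * b) (c * d) := by
  rw [tmul, tmul, tmul, ← map_mul, Algebra.TensorProduct.tmul_mul_tmul]

theorem SpatialTensor.star_tmul (a : A) (c : C) :
    star (tmul a c) = tmul (star a) (star c) := by
  rw [tmul, tmul, ← map_star, TensorProduct.star_tmul]

/-- `a ↦ a ⊗ c` as a linear map. -/
def SpatialTensor.tmulRight (c : C) : A →ₗ[ℂ] SpatialTensor A C :=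
  ((spatialNorm A C).ι : A ⊗[ℂ] C →ₗ[ℂ] SpatialTensor A C) ∘ₗ
    (TensorProduct.mk ℂ A C).flip c

@[simp] theorem SpatialTensor.tmulRight_apply (a : A) (c : C) :
    tmulRight c a = tmul a c := rfl

theorem SpatialTensor.norm_tmul_le (a : A) (c : C) : ‖tmul a c‖ ≤ ‖a‖ * ‖c‖ := by
  rw [tmul, CStarSeminorm.norm_ι]
  refine CStarSeminorm.sup_le ?_
  rintro p ⟨H, K, _, _, _, _, _, _, π, ρ, rfl⟩
  rw [repSeminorm_apply, repTensor_tmul]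
  refine (TensorProduct.norm_mapL_le _ _).trans ?_
  gcongr
  · exact NonUnitalStarAlgHom.norm_apply_le π a
  · exact NonUnitalStarAlgHom.norm_apply_le ρ c

/-- The tensor product of two `*`-homomorphisms, on the algebraic tensor product. -/
def algTensorMap (φ : A →⋆ₙₐ[ℂ] A') (ψ : C →⋆ₙₐ[ℂ] C') : A ⊗[ℂ] C →⋆ₙₐ[ℂ] A' ⊗[ℂ] C' where
  toFun := TensorProduct.map (φ : A →ₗ[ℂ] A') (ψ : C →ₗ[ℂ] C')
  map_smul' := map_smul _
  map_zero' := map_zero _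
  map_add' := map_add _
  map_mul' x y := by
    induction x with
    | zero => simp
    | add x x' hx hx' => simp only [add_mul, map_add, hx, hx']
    | tmul a c =>
      induction y with
      | zero => simp
      | add y y' hy hy' => simp only [mul_add, map_add, hy, hy']
      | tmul b d => simp
  map_star' x := by
    induction x with
    | zero => simp
    | add x x' hx hx' =>
      rw [star_add, map_add, map_add, star_add]
      exact congrArg₂ (· + ·) hx hx'
    | tmul a c => simp [map_star]

theorem algTensorMap_tmul (φ : A →⋆ₙₐ[ℂ] A') (ψ : C →⋆ₙₐ[ℂ] C') (a : A) (c : C) :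
    algTensorMap φ ψ (a ⊗ₜ c) = φ a ⊗ₜ ψ c := rfl

theorem repTensor_algTensorMap {H K : Type u} [NormedAddCommGroup H] [InnerProductSpace ℂ H]
    [CompleteSpace H] [NormedAddCommGroup K] [InnerProductSpace ℂ K] [CompleteSpace K]
    (π : A' →⋆ₙₐ[ℂ] (H →L[ℂ] H)) (ρ : C' →⋆ₙₐ[ℂ] (K →L[ℂ] K))
    (φ : A →⋆ₙₐ[ℂ] A') (ψ : C →⋆ₙₐ[ℂ] C') (x : A ⊗[ℂ] C) :
    repTensor π ρ (algTensorMap φ ψ x) = repTensor (π.comp φ) (ρ.comp ψ) x := by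
  induction x with
  | zero => simp
  | add x y hx hy => simp only [map_add, hx, hy]
  | tmul a c => rfl

/-- The `*`-homomorphism `φ ⊗ ψ` of spatial tensor products. -/
def SpatialTensor.map (φ : A →⋆ₙₐ[ℂ] A') (ψ : C →⋆ₙₐ[ℂ] C') :
    SpatialTensor A C →⋆ₙₐ[ℂ] SpatialTensor A' C' :=
  (spatialNorm A C).lift ((spatialNorm A' C').ι.comp (algTensorMap φ ψ)) (by
    intro x
    rw [NonUnitalStarAlgHom.comp_apply, CStarSeminorm.norm_ι]
    refine CStarSeminorm.sup_le ?_
    rintro p ⟨H, K, _, _, _, _, _, _, π, ρ, rfl⟩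
    rw [repSeminorm_apply, repTensor_algTensorMap]
    have hp : repSeminorm (π.comp φ) (ρ.comp ψ) ∈ spatialSeminorms A C :=
      ⟨H, K, _, _, _, _, _, _, _, _, rfl⟩
    exact CStarSeminorm.le_sup hp x)

@[simp] theorem SpatialTensor.map_tmul (φ : A →⋆ₙₐ[ℂ] A') (ψ : C →⋆ₙₐ[ℂ] C') (a : A) (c : C) :
    SpatialTensor.map φ ψ (tmul a c) = tmul (φ a) (ψ c) :=
  CStarSeminorm.lift_ι _ _ _ _

/-- `x` and `y` correspond to each other under the canonical isomorphism
`(A ⊗ C) ⊗ C' ≅ A ⊗ (C ⊗ C')`: the graph of this isomorphism is the closed linear span of the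
pairs `((a ⊗ c) ⊗ d, a ⊗ (c ⊗ d))`. -/
def SpatialTensor.AssocEq (x : SpatialTensor (SpatialTensor A C) C')
    (y : SpatialTensor A (SpatialTensor C C')) : Prop :=
  (x, y) ∈ (Submodule.span ℂ {z : SpatialTensor (SpatialTensor A C) C' ×
      SpatialTensor A (SpatialTensor C C') |
    ∃ (a : A) (c : C) (d : C'), z = (tmul (tmul a c) d, tmul a (tmul c d))}).topologicalClosure

end Spatial

/-! ### Fell bundles over discrete groups -/

/-- A Fell bundle over a discrete group `G`.  The multiplication `A_r × A_s → A_{rs}` and the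
involution `A_s → A_{s⁻¹}` take the target fibre as an index together with a proof that it is the
right one. -/
structure FellBundle (G : Type u) [Group G] where
  fiber : G → Type v
  [instNormed : ∀ s, NormedAddCommGroup (fiber s)]
  [instSpace : ∀ s, NormedSpace ℂ (fiber s)]
  [instComplete : ∀ s, CompleteSpace (fiber s)]
  mul : ∀ {r s t : G}, r * s = t → fiber r → fiber s → fiber t
  adj : ∀ {s t : G}, s⁻¹ = t → fiber s → fiber t
  mul_add : ∀ {r s t : G} (h : r * s = t) (a : fiber r) (b b' : fiber s),
    mul h a (b + b') = mul h a b + mul h a b'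
  add_mul : ∀ {r s t : G} (h : r * s = t) (a a' : fiber r) (b : fiber s),
    mul h (a + a') b = mul h a b + mul h a' b
  mul_smul : ∀ {r s t : G} (h : r * s = t) (z : ℂ) (a : fiber r) (b : fiber s),
    mul h a (z • b) = z • mul h a b
  smul_mul : ∀ {r s t : G} (h : r * s = t) (z : ℂ) (a : fiber r) (b : fiber s),
    mul h (z • a) b = z • mul h a b
  mul_assoc : ∀ {r s t x y z : G} (h₁ : r * s = x) (h₂ : x * t = z) (h₃ : s * t = y)
    (h₄ : r * y = z) (a : fiber r) (b : fiber s) (c : fiber t),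
    mul h₂ (mul h₁ a b) c = mul h₄ a (mul h₃ b c)
  norm_mul_le : ∀ {r s t : G} (h : r * s = t) (a : fiber r) (b : fiber s),
    ‖mul h a b‖ ≤ ‖a‖ * ‖b‖
  adj_add : ∀ {s t : G} (h : s⁻¹ = t) (a b : fiber s), adj h (a + b) = adj h a + adj h b
  adj_smul : ∀ {s t : G} (h : s⁻¹ = t) (z : ℂ) (a : fiber s), adj h (z • a) = star z • adj h a
  adj_adj : ∀ {s t : G} (h : s⁻¹ = t) (h' : t⁻¹ = s) (a : fiber s), adj h' (adj h a) = a
  adj_mul : ∀ {r s t r' s' t' : G} (h : r * s = t) (hr : r⁻¹ = r') (hs : s⁻¹ = s')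
    (ht : t⁻¹ = t') (h' : s' * r' = t') (a : fiber r) (b : fiber s),
    adj ht (mul h a b) = mul h' (adj hs b) (adj hr a)
  norm_adj_mul_self : ∀ {s t : G} (h : s⁻¹ = t) (h' : t * s = 1) (a : fiber s),
    ‖mul h' (adj h a) a‖ = ‖a‖ ^ 2
  /-- `a* a` is positive in the unit fibre `A_e`, i.e. of the form `c* c` with `c ∈ A_e`. -/
  adj_mul_self_nonneg : ∀ {s t : G} (h : s⁻¹ = t) (h' : t * s = 1) (a : fiber s),
    ∃ c : fiber 1, mul h' (adj h a) a = mul (one_mul 1) (adj inv_one c) c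

namespace FellBundle

attribute [instance] instNormed instSpace instComplete

section
variable {G : Type u} [Group G]

/-- An isomorphism of Fell bundles over `G`. -/
structure Iso (𝒜 : FellBundle.{u, v} G) (ℬ : FellBundle.{u, w} G) where
  equiv : ∀ s, 𝒜.fiber s ≃ₗᵢ[ℂ] ℬ.fiber s
  map_mul : ∀ {r s t : G} (h : r * s = t) (a : 𝒜.fiber r) (b : 𝒜.fiber s),
    equiv t (𝒜.mul h a b) = ℬ.mul h (equiv r a) (equiv s b)
  map_adj : ∀ {s t : G} (h : s⁻¹ = t) (a : 𝒜.fiber s),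
    equiv t (𝒜.adj h a) = ℬ.adj h (equiv s a)

/-- The pull-back `q*𝒟` over `G` of a Fell bundle `𝒟` over `G/N` along the quotient map:
the fibre over `s` is `D_{sN}`, with the operations of `𝒟`. -/
def pullback (N : Subgroup G) [N.Normal] (𝒟 : FellBundle.{u, v} (G ⧸ N)) :
    FellBundle.{u, v} G where
  fiber s := 𝒟.fiber (s : G ⧸ N)
  mul h := 𝒟.mul (by rw [← h, QuotientGroup.mk_mul])
  adj h := 𝒟.adj (by rw [← h, QuotientGroup.mk_inv])
  mul_add _ := 𝒟.mul_add _
  add_mul _ := 𝒟.add_mul _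
  mul_smul _ := 𝒟.mul_smul _
  smul_mul _ := 𝒟.smul_mul _
  mul_assoc _ _ _ _ := 𝒟.mul_assoc _ _ _ _
  norm_mul_le _ := 𝒟.norm_mul_le _
  adj_add _ := 𝒟.adj_add _
  adj_smul _ := 𝒟.adj_smul _
  adj_adj _ _ := 𝒟.adj_adj _ _
  adj_mul _ _ _ _ _ := 𝒟.adj_mul _ _ _ _ _
  norm_adj_mul_self _ _ := 𝒟.norm_adj_mul_self _ _
  adj_mul_self_nonneg _ _ := 𝒟.adj_mul_self_nonneg _ _

variable (𝒜 : FellBundle.{u, v} G)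

theorem mul_zero {r s t : G} (h : r * s = t) (a : 𝒜.fiber r) :
    𝒜.mul h a (0 : 𝒜.fiber s) = 0 := by
  have := 𝒜.mul_smul h 0 a (0 : 𝒜.fiber s)
  simpa using this

theorem zero_mul {r s t : G} (h : r * s = t) (b : 𝒜.fiber s) :
    𝒜.mul h (0 : 𝒜.fiber r) b = 0 := by
  have := 𝒜.smul_mul h 0 (0 : 𝒜.fiber r) b
  simpa using this

theorem adj_zero {s t : G} (h : s⁻¹ = t) : 𝒜.adj h (0 : 𝒜.fiber s) = 0 := by
  have := 𝒜.adj_smul h 0 (0 : 𝒜.fiber s)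
  simpa using this

/-! #### The unit fibre -/

/-- The unit fibre of a Fell bundle, as a C*-algebra. -/
def UnitFiber : Type v := 𝒜.fiber 1

instance : NormedAddCommGroup 𝒜.UnitFiber := 𝒜.instNormed 1
instance : NormedSpace ℂ 𝒜.UnitFiber := 𝒜.instSpace 1
instance : CompleteSpace 𝒜.UnitFiber := 𝒜.instComplete 1

instance : NonUnitalNormedRing 𝒜.UnitFiber where
  __ := (inferInstance : NormedAddCommGroup 𝒜.UnitFiber)
  mul := 𝒜.mul (one_mul 1)
  left_distrib := 𝒜.mul_add _
  right_distrib := 𝒜.add_mul _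
  zero_mul := 𝒜.zero_mul _
  mul_zero := 𝒜.mul_zero _
  mul_assoc := 𝒜.mul_assoc _ _ _ _
  norm_mul_le := 𝒜.norm_mul_le _

instance : StarRing 𝒜.UnitFiber where
  star := 𝒜.adj inv_one
  star_involutive := 𝒜.adj_adj _ _
  star_mul := 𝒜.adj_mul _ _ _ _ _
  star_add := 𝒜.adj_add _

instance : CStarRing 𝒜.UnitFiber where
  norm_mul_self_le a := ((𝒜.norm_adj_mul_self inv_one (one_mul 1) a).trans (sq _)).ge

instance : NonUnitalCStarAlgebra 𝒜.UnitFiber where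
  smul_assoc := 𝒜.smul_mul _
  smul_comm z a b := (𝒜.mul_smul _ z a b).symm
  star_smul := 𝒜.adj_smul _

/-! #### Finitely supported sections -/

/-- The space `Γ_c(𝒜)` of finitely supported sections. -/
def Sec : Type (max u v) := ⨁ s, 𝒜.fiber s

instance : AddCommGroup 𝒜.Sec := inferInstanceAs (AddCommGroup (⨁ s, 𝒜.fiber s))
instance : Module ℂ 𝒜.Sec := inferInstanceAs (Module ℂ (⨁ s, 𝒜.fiber s))

/-- The section with value `a` at `s` and `0` elsewhere. -/
def single (s : G) : 𝒜.fiber s →ₗ[ℂ] 𝒜.Sec :=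
  letI := Classical.decEq G
  DirectSum.lof ℂ G 𝒜.fiber s

/-- Extension of a family of linear maps on the fibres to `Γ_c(𝒜)`. -/
def secLift {E : Type w} [AddCommGroup E] [Module ℂ E] (φ : ∀ s, 𝒜.fiber s →ₗ[ℂ] E) :
    𝒜.Sec →ₗ[ℂ] E :=
  letI := Classical.decEq G
  DirectSum.toModule ℂ G E φ

@[simp] theorem secLift_single {E : Type w} [AddCommGroup E] [Module ℂ E]
    (φ : ∀ s, 𝒜.fiber s →ₗ[ℂ] E) (s : G) (a : 𝒜.fiber s) :
    𝒜.secLift φ (𝒜.single s a) = φ s a :=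
  let _ := Classical.decEq G
  DirectSum.toModule_lof ℂ s a

theorem sec_induction {P : 𝒜.Sec → Prop} (h0 : P 0) (h1 : ∀ s a, P (𝒜.single s a))
    (h2 : ∀ x y, P x → P y → P (x + y)) (x : 𝒜.Sec) : P x :=
  let _ := Classical.decEq G
  DirectSum.induction_on x h0 h1 h2

/-- Multiplication of sections, `(f * g)(t) = ∑_{rs = t} f(r) g(s)`. -/
def secMul : 𝒜.Sec →ₗ[ℂ] 𝒜.Sec →ₗ[ℂ] 𝒜.Sec :=
  𝒜.secLift fun r => LinearMap.flip (𝒜.secLift fun s => LinearMap.flip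
    (LinearMap.mk₂ ℂ (fun (a : 𝒜.fiber r) (b : 𝒜.fiber s) => 𝒜.single (r * s) (𝒜.mul rfl a b))
      (by intros; rw [𝒜.add_mul, map_add]) (by intros; rw [𝒜.smul_mul, map_smul])
      (by intros; rw [𝒜.mul_add, map_add]) (by intros; rw [𝒜.mul_smul, map_smul])))

/-- The involution on sections, `f*(s) = f(s⁻¹)*`. -/
def secStar : 𝒜.Sec →+ 𝒜.Sec :=
  letI := Classical.decEq G
  DirectSum.toAddMonoid fun s =>
    { toFun := fun a => 𝒜.single s⁻¹ (𝒜.adj rfl a)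
      map_zero' := by rw [𝒜.adj_zero, map_zero]
      map_add' := fun a b => by rw [𝒜.adj_add, map_add] }

theorem secMul_single {r s t : G} (h : r * s = t) (a : 𝒜.fiber r) (b : 𝒜.fiber s) :
    𝒜.secMul (𝒜.single r a) (𝒜.single s b) = 𝒜.single t (𝒜.mul h a b) := by
  subst h
  simp [secMul]

theorem secStar_single {s t : G} (h : s⁻¹ = t) (a : 𝒜.fiber s) :
    𝒜.secStar (𝒜.single s a) = 𝒜.single t (𝒜.adj h a) := by
  subst h
  letI := Classical.decEq G
  exact DirectSum.toAddMonoid_of (β := 𝒜.fiber) _ s a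

instance : NonUnitalRing 𝒜.Sec where
  __ := (inferInstance : AddCommGroup 𝒜.Sec)
  mul x y := 𝒜.secMul x y
  left_distrib x y z := (𝒜.secMul x).map_add y z
  right_distrib x y z := by
    show 𝒜.secMul (x + y) z = 𝒜.secMul x z + 𝒜.secMul y z
    rw [map_add, LinearMap.add_apply]
  zero_mul x := by
    show 𝒜.secMul 0 x = 0
    rw [map_zero, LinearMap.zero_apply]
  mul_zero x := (𝒜.secMul x).map_zero
  mul_assoc x y z := by
    show 𝒜.secMul (𝒜.secMul x y) z = 𝒜.secMul x (𝒜.secMul y z)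
    induction x using 𝒜.sec_induction with
    | h0 => simp
    | h2 x x' h h' => simp only [map_add, LinearMap.add_apply, h, h']
    | h1 r a =>
      induction y using 𝒜.sec_induction with
      | h0 => simp
      | h2 x x' h h' => simp only [map_add, LinearMap.add_apply, h, h']
      | h1 s b =>
        induction z using 𝒜.sec_induction with
        | h0 => simp
        | h2 x x' h h' => simp only [map_add, h, h']
        | h1 t c =>
          rw [𝒜.secMul_single rfl, 𝒜.secMul_single rfl, 𝒜.secMul_single rfl,
            𝒜.secMul_single (_root_.mul_assoc r s t).symm, 𝒜.mul_assoc]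

theorem single_mul_single {r s t : G} (h : r * s = t) (a : 𝒜.fiber r) (b : 𝒜.fiber s) :
    𝒜.single r a * 𝒜.single s b = 𝒜.single t (𝒜.mul h a b) := 𝒜.secMul_single h a b

instance : StarRing 𝒜.Sec where
  star := 𝒜.secStar
  star_involutive x := by
    show 𝒜.secStar (𝒜.secStar x) = x
    induction x using 𝒜.sec_induction with
    | h0 => simp
    | h2 x x' h h' => rw [map_add, map_add, h, h']
    | h1 s a => rw [𝒜.secStar_single rfl, 𝒜.secStar_single (inv_inv s), 𝒜.adj_adj]
  star_mul x y := by
    show 𝒜.secStar (x * y) = 𝒜.secStar y * 𝒜.secStar x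
    induction x using 𝒜.sec_induction with
    | h0 => simp
    | h2 x x' h h' => simp only [map_add, _root_.add_mul, _root_.mul_add, h, h']
    | h1 r a =>
      induction y using 𝒜.sec_induction with
      | h0 => simp
      | h2 x x' h h' => simp only [map_add, _root_.add_mul, _root_.mul_add, h, h']
      | h1 s b =>
        rw [𝒜.single_mul_single rfl, 𝒜.secStar_single rfl, 𝒜.secStar_single rfl,
          𝒜.secStar_single rfl, 𝒜.single_mul_single (mul_inv_rev r s).symm, 𝒜.adj_mul]
  star_add := map_add 𝒜.secStar

theorem star_single {s t : G} (h : s⁻¹ = t) (a : 𝒜.fiber s) :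
    star (𝒜.single s a) = 𝒜.single t (𝒜.adj h a) := 𝒜.secStar_single h a

instance : IsScalarTower ℂ 𝒜.Sec 𝒜.Sec where
  smul_assoc z x y := by
    show 𝒜.secMul (z • x) y = z • 𝒜.secMul x y
    rw [map_smul, LinearMap.smul_apply]

instance : SMulCommClass ℂ 𝒜.Sec 𝒜.Sec where
  smul_comm z x y := ((𝒜.secMul x).map_smul z y).symm

instance : StarModule ℂ 𝒜.Sec where
  star_smul z x := by
    induction x using 𝒜.sec_induction with
    | h0 => simp
    | h2 x x' h h' => rw [smul_add, star_add, h, h', star_add, smul_add]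
    | h1 s a => rw [← map_smul, 𝒜.star_single rfl, 𝒜.star_single rfl, 𝒜.adj_smul, map_smul]

/-- Multiplicative and `*`-preserving families of linear maps on the fibres extend to
`*`-homomorphisms of `Γ_c(𝒜)`. -/
def secHom {E : Type w} [NonUnitalRing E] [StarRing E] [Module ℂ E]
    (φ : ∀ s, 𝒜.fiber s →ₗ[ℂ] E)
    (hmul : ∀ r s (a : 𝒜.fiber r) (b : 𝒜.fiber s), φ (r * s) (𝒜.mul rfl a b) = φ r a * φ s b)
    (hstar : ∀ s (a : 𝒜.fiber s), φ s⁻¹ (𝒜.adj rfl a) = star (φ s a)) : 𝒜.Sec →⋆ₙₐ[ℂ] E where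
  toFun := 𝒜.secLift φ
  map_smul' := map_smul _
  map_zero' := map_zero _
  map_add' := map_add _
  map_mul' x y := by
    induction x using 𝒜.sec_induction with
    | h0 => simp
    | h2 x x' h h' => simp only [map_add, _root_.add_mul, h, h']
    | h1 r a =>
      induction y using 𝒜.sec_induction with
      | h0 => simp
      | h2 x x' h h' => simp only [map_add, _root_.mul_add, h, h']
      | h1 s b =>
        rw [𝒜.single_mul_single rfl, secLift_single, secLift_single, secLift_single, hmul]
  map_star' x := by
    show 𝒜.secLift φ (star x) = star (𝒜.secLift φ x)
    induction x using 𝒜.sec_induction with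
    | h0 => simp
    | h2 x x' h h' => rw [star_add, map_add, h, h', map_add, star_add]
    | h1 s a => rw [𝒜.star_single rfl, secLift_single, secLift_single, hstar]

@[simp] theorem secHom_single {E : Type w} [NonUnitalRing E] [StarRing E] [Module ℂ E]
    (φ : ∀ s, 𝒜.fiber s →ₗ[ℂ] E) (hmul) (hstar) (s : G) (a : 𝒜.fiber s) :
    𝒜.secHom φ hmul hstar (𝒜.single s a) = φ s a := 𝒜.secLift_single φ s a

/-! #### Enveloping C*-algebras -/

theorem seminorm_unit_le (p : CStarSeminorm 𝒜.Sec) (a : 𝒜.fiber 1) :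
    p (𝒜.single 1 a) ≤ ‖a‖ := by
  let f : 𝒜.UnitFiber →⋆ₙₐ[ℂ] p.Compl :=
    { toFun := fun a => p.ι (𝒜.single 1 a)
      map_smul' := fun z a => by
        show p.ι (𝒜.single 1 (z • (show 𝒜.fiber 1 from a))) = _
        rw [map_smul, map_smul]; rfl
      map_zero' := by
        show p.ι (𝒜.single 1 (0 : 𝒜.fiber 1)) = 0
        rw [map_zero, map_zero]
      map_add' := fun a b => by
        show p.ι (𝒜.single 1 ((show 𝒜.fiber 1 from a) + (show 𝒜.fiber 1 from b))) = _
        rw [map_add, map_add]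
      map_mul' := fun a b =>
        (congrArg p.ι (𝒜.single_mul_single (one_mul 1) a b)).symm.trans (map_mul p.ι _ _)
      map_star' := fun a =>
        (congrArg p.ι (𝒜.star_single inv_one a)).symm.trans (map_star p.ι _) }
  have := NonUnitalStarAlgHom.norm_apply_le f (show 𝒜.UnitFiber from a)
  rw [← p.norm_ι]
  exact this

theorem seminorm_single_le (p : CStarSeminorm 𝒜.Sec) (s : G) (a : 𝒜.fiber s) :
    p (𝒜.single s a) ≤ ‖a‖ := by
  have h : p (𝒜.single s a) ^ 2 ≤ ‖a‖ ^ 2 := by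
    rw [← p.star_mul_self, 𝒜.star_single rfl, 𝒜.single_mul_single (inv_mul_cancel s),
      ← 𝒜.norm_adj_mul_self rfl (inv_mul_cancel s) a]
    exact 𝒜.seminorm_unit_le p _
  exact le_of_sq_le_sq h (norm_nonneg a)

/-- The C*-seminorms on `Γ_c(𝒜)` that vanish on `K`. -/
def envSeminorms (K : Set 𝒜.Sec) : Set (CStarSeminorm 𝒜.Sec) := {p | ∀ k ∈ K, p k = 0}

theorem envSeminorms_nonempty (K : Set 𝒜.Sec) : (𝒜.envSeminorms K).Nonempty :=
  ⟨CStarSeminorm.ofHom (0 : 𝒜.Sec →⋆ₙₐ[ℂ] ℂ), fun _ _ => by simp⟩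

theorem envSeminorms_bdd (K : Set 𝒜.Sec) (x : 𝒜.Sec) :
    ∃ M, ∀ p ∈ 𝒜.envSeminorms K, p x ≤ M := by
  induction x using 𝒜.sec_induction with
  | h0 => exact ⟨0, fun p _ => (map_zero p.toSeminorm).le⟩
  | h1 s a => exact ⟨‖a‖, fun p _ => 𝒜.seminorm_single_le p s a⟩
  | h2 x y hx hy =>
    obtain ⟨M, hM⟩ := hx
    obtain ⟨M', hM'⟩ := hy
    exact ⟨M + M', fun p hp => (map_add_le_add p.toSeminorm x y).trans
      (add_le_add (hM p hp) (hM' p hp))⟩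

/-- The largest C*-seminorm on `Γ_c(𝒜)` that vanishes on `K`. -/
def maxSeminorm (K : Set 𝒜.Sec) : CStarSeminorm 𝒜.Sec :=
  CStarSeminorm.sup (𝒜.envSeminorms K) (𝒜.envSeminorms_nonempty K) (𝒜.envSeminorms_bdd K)

theorem maxSeminorm_eq_zero {K : Set 𝒜.Sec} {k : 𝒜.Sec} (hk : k ∈ K) :
    𝒜.maxSeminorm K k = 0 :=
  le_antisymm (CStarSeminorm.sup_le fun p hp => (hp k hk).le) ((𝒜.maxSeminorm K).nonneg k)

/-- The enveloping C*-algebra of `Γ_c(𝒜)` subject to the relations `k = 0` for `k ∈ K`: the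
Hausdorff completion in the largest C*-seminorm that vanishes on `K`. -/
abbrev Env (K : Set 𝒜.Sec) : Type (max u v) := (𝒜.maxSeminorm K).Compl

/-- The full cross sectional C*-algebra `C*(𝒜)`, i.e. the enveloping C*-algebra of `Γ_c(𝒜)`. -/
abbrev FullCStar : Type (max u v) := 𝒜.Env ∅

/-- The canonical map of the fibre over `s` into the enveloping C*-algebra. -/
def env (K : Set 𝒜.Sec) (s : G) : 𝒜.fiber s →ₗ[ℂ] 𝒜.Env K :=
  ((𝒜.maxSeminorm K).ι : 𝒜.Sec →ₗ[ℂ] 𝒜.Env K) ∘ₗ 𝒜.single s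

theorem env_apply (K : Set 𝒜.Sec) (s : G) (a : 𝒜.fiber s) :
    𝒜.env K s a = (𝒜.maxSeminorm K).ι (𝒜.single s a) := rfl

theorem env_mul (K : Set 𝒜.Sec) {r s t : G} (h : r * s = t) (a : 𝒜.fiber r) (b : 𝒜.fiber s) :
    𝒜.env K t (𝒜.mul h a b) = 𝒜.env K r a * 𝒜.env K s b := by
  rw [env_apply, env_apply, env_apply, ← map_mul, 𝒜.single_mul_single h]

theorem env_adj (K : Set 𝒜.Sec) {s t : G} (h : s⁻¹ = t) (a : 𝒜.fiber s) :
    𝒜.env K t (𝒜.adj h a) = star (𝒜.env K s a) := by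
  rw [env_apply, env_apply, ← map_star, 𝒜.star_single h]

theorem ι_eq_zero {K : Set 𝒜.Sec} {k : 𝒜.Sec} (hk : k ∈ K) : (𝒜.maxSeminorm K).ι k = 0 := by
  rw [← norm_eq_zero, CStarSeminorm.norm_ι, 𝒜.maxSeminorm_eq_zero hk]

/-- Universal property: a `*`-homomorphism of `Γ_c(𝒜)` into a C*-algebra that vanishes on `K`
extends to the enveloping C*-algebra. -/
def envLift {K : Set 𝒜.Sec} {E : Type w} [NonUnitalCStarAlgebra E] (f : 𝒜.Sec →⋆ₙₐ[ℂ] E)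
    (hf : ∀ k ∈ K, f k = 0) : 𝒜.Env K →⋆ₙₐ[ℂ] E :=
  (𝒜.maxSeminorm K).lift f fun x => by
    have hp : CStarSeminorm.ofHom f ∈ 𝒜.envSeminorms K := fun k hk => by
      rw [CStarSeminorm.ofHom_apply, hf k hk, norm_zero]
    exact CStarSeminorm.le_sup hp x

theorem envLift_ι {K : Set 𝒜.Sec} {E : Type w} [NonUnitalCStarAlgebra E]
    (f : 𝒜.Sec →⋆ₙₐ[ℂ] E) (hf : ∀ k ∈ K, f k = 0) (x : 𝒜.Sec) :
    𝒜.envLift f hf ((𝒜.maxSeminorm K).ι x) = f x :=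
  CStarSeminorm.lift_ι _ _ _ _

end

/-- The trivial Fell bundle over `G` with fibres `ℂ`; its algebra of finitely supported sections
is the group algebra of `G`, with `s* = s⁻¹`. -/
def trivial (G : Type u) [Group G] : FellBundle.{u, 0} G where
  fiber _ := ℂ
  mul _ a b := a * b
  adj _ a := star a
  mul_add _ := _root_.mul_add
  add_mul _ := _root_.add_mul
  mul_smul _ z a b := mul_smul_comm z a b
  smul_mul _ z a b := smul_mul_assoc z a b
  mul_assoc _ _ _ _ := _root_.mul_assoc
  norm_mul_le _ := _root_.norm_mul_le
  adj_add _ := star_add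
  adj_smul _ := star_smul
  adj_adj _ _ := star_star
  adj_mul _ _ _ _ _ := star_mul
  norm_adj_mul_self _ _ a := by rw [CStarRing.norm_star_mul_self, sq]
  adj_mul_self_nonneg _ _ a := ⟨a, rfl⟩

end FellBundle

/-- The full group C*-algebra `C*(G)` of a discrete group. -/
abbrev GroupCStar (G : Type u) [Group G] : Type u := (FellBundle.trivial G).FullCStar

/-- The canonical unitary of `C*(G)` given by a group element. -/
def groupElt {G : Type u} [Group G] (s : G) : GroupCStar G :=
  (FellBundle.trivial G).env ∅ s (1 : ℂ)

theorem groupElt_mul {G : Type u} [Group G] (r s : G) :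
    groupElt r * groupElt s = groupElt (r * s) :=
  ((FellBundle.trivial G).env_mul ∅ rfl _ _).symm.trans
    (congrArg ((FellBundle.trivial G).env ∅ (r * s)) (mul_one (1 : ℂ)))

theorem star_groupElt {G : Type u} [Group G] (s : G) :
    star (groupElt s) = groupElt s⁻¹ :=
  ((FellBundle.trivial G).env_adj ∅ rfl _).symm.trans
    (congrArg ((FellBundle.trivial G).env ∅ s⁻¹) (star_one ℂ))

/-! ### Coactions of discrete groups -/

section Coactions

variable {G : Type u} [Group G] {Q : Type u} [Group Q]

/-- Given linear maps `j_s` of the fibres into a C*-algebra `E`, compatible with multiplication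
and involution, and a homomorphism `q : G → Q`, the `*`-homomorphism
`Γ_c(𝒜) → E ⊗ C*(Q)`, `a_s ↦ j_s(a_s) ⊗ q(s)`. -/
def gradedHom (𝒜 : FellBundle.{u, v} G) (q : G →* Q) {E : Type u} [NonUnitalCStarAlgebra E]
    (j : ∀ s, 𝒜.fiber s →ₗ[ℂ] E)
    (hmul : ∀ r s (a : 𝒜.fiber r) (b : 𝒜.fiber s), j (r * s) (𝒜.mul rfl a b) = j r a * j s b)
    (hstar : ∀ s (a : 𝒜.fiber s), j s⁻¹ (𝒜.adj rfl a) = star (j s a)) :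
    𝒜.Sec →⋆ₙₐ[ℂ] SpatialTensor E (GroupCStar Q) :=
  𝒜.secHom (fun s => SpatialTensor.tmulRight (groupElt (q s)) ∘ₗ j s)
    (fun r s a b => by
      simp only [LinearMap.comp_apply, SpatialTensor.tmulRight_apply, hmul,
        SpatialTensor.tmul_mul, groupElt_mul, map_mul])
    (fun s a => by
      simp only [LinearMap.comp_apply, SpatialTensor.tmulRight_apply, hstar,
        SpatialTensor.star_tmul, star_groupElt, map_inv])

theorem gradedHom_single (𝒜 : FellBundle.{u, v} G) (q : G →* Q) {E : Type u}
    [NonUnitalCStarAlgebra E] (j : ∀ s, 𝒜.fiber s →ₗ[ℂ] E) (hmul) (hstar) (s : G)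
    (a : 𝒜.fiber s) : gradedHom 𝒜 q j hmul hstar (𝒜.single s a)
      = SpatialTensor.tmul (j s a) (groupElt (q s)) :=
  𝒜.secHom_single _ _ _ s a

/-- The comultiplication `δ_G : C*(G) → C*(G) ⊗ C*(G)`, `s ↦ s ⊗ s`. -/
def comult (G : Type u) [Group G] :
    GroupCStar G →⋆ₙₐ[ℂ] SpatialTensor (GroupCStar G) (GroupCStar G) :=
  (FellBundle.trivial G).envLift
    (gradedHom (FellBundle.trivial G) (MonoidHom.id G) ((FellBundle.trivial G).env ∅)
      (fun _ _ => (FellBundle.trivial G).env_mul ∅ rfl)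
      (fun _ => (FellBundle.trivial G).env_adj ∅ rfl))
    (fun _ hk => hk.elim)

theorem comult_groupElt (s : G) :
    comult G (groupElt s) = SpatialTensor.tmul (groupElt s) (groupElt s) :=
  ((FellBundle.trivial G).envLift_ι _ _ _).trans (gradedHom_single _ _ _ _ _ _ _)

/-- A coaction of the discrete group `Q` on the C*-algebra `A`: an injective nondegenerate
`*`-homomorphism `δ : A → A ⊗ C*(Q)` with `(δ ⊗ id) ∘ δ = (id ⊗ δ_Q) ∘ δ`. -/
structure IsCoaction {A : Type u} [NonUnitalCStarAlgebra A]
    (δ : A →⋆ₙₐ[ℂ] SpatialTensor A (GroupCStar Q)) : Prop where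
  injective : Function.Injective δ
  nondegenerate : (Submodule.span ℂ {x : SpatialTensor A (GroupCStar Q) |
    ∃ (a : A) (y : SpatialTensor A (GroupCStar Q)), x = δ a * y}).topologicalClosure = ⊤
  coassoc : ∀ a, SpatialTensor.AssocEq
    (SpatialTensor.map δ (NonUnitalStarAlgHom.id ℂ (GroupCStar Q)) (δ a))
    (SpatialTensor.map (NonUnitalStarAlgHom.id ℂ A) (comult Q) (δ a))

/-- Isomorphism of coactions: `(A, δ)` and `(A', δ')` are isomorphic if there is an equivariant
`*`-isomorphism of `A` onto `A'`. -/
def CoactionsIsomorphic {A A' : Type u} [NonUnitalCStarAlgebra A] [NonUnitalCStarAlgebra A']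
    (δ : A →⋆ₙₐ[ℂ] SpatialTensor A (GroupCStar Q))
    (δ' : A' →⋆ₙₐ[ℂ] SpatialTensor A' (GroupCStar Q)) : Prop :=
  ∃ φ : A ≃⋆ₐ[ℂ] A', ∀ a, δ' (φ a) =
    SpatialTensor.map (φ : A →⋆ₙₐ[ℂ] A') (NonUnitalStarAlgHom.id ℂ (GroupCStar Q)) (δ a)

/-- The spectral subspace `A_s = {a | δ(a) = a ⊗ s}`. -/
def spectralSubspace {A : Type u} [NonUnitalCStarAlgebra A]
    (δ : A →⋆ₙₐ[ℂ] SpatialTensor A (GroupCStar Q)) (s : Q) : Submodule ℂ A where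
  carrier := {a | δ a = SpatialTensor.tmul a (groupElt s)}
  zero_mem' := by
    show δ 0 = SpatialTensor.tmulRight (groupElt s) 0
    rw [map_zero, map_zero]
  add_mem' {a b} ha hb := by
    show δ (a + b) = SpatialTensor.tmulRight (groupElt s) (a + b)
    rw [map_add, map_add]
    exact congrArg₂ (· + ·) ha hb
  smul_mem' z a ha := by
    show δ (z • a) = SpatialTensor.tmulRight (groupElt s) (z • a)
    rw [map_smul, map_smul]
    exact congrArg (z • ·) ha

section
variable {A : Type u} [NonUnitalCStarAlgebra A]
    (δ : A →⋆ₙₐ[ℂ] SpatialTensor A (GroupCStar Q))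

theorem mem_spectralSubspace {s : Q} {a : A} :
    a ∈ spectralSubspace δ s ↔ δ a = SpatialTensor.tmul a (groupElt s) := Iff.rfl

theorem isClosed_spectralSubspace (s : Q) : IsClosed (spectralSubspace δ s : Set A) := by
  refine isClosed_eq ?_ ?_
  · exact AddMonoidHomClass.continuous_of_bound δ 1 fun a => by
      rw [one_mul]; exact NonUnitalStarAlgHom.norm_apply_le δ a
  · exact AddMonoidHomClass.continuous_of_bound
      (SpatialTensor.tmulRight (A := A) (groupElt s)) ‖groupElt s‖ fun a => by
        rw [mul_comm]; exact SpatialTensor.norm_tmul_le a _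

theorem spectral_mul {r s t : Q} (h : r * s = t) {a b : A} (ha : a ∈ spectralSubspace δ r)
    (hb : b ∈ spectralSubspace δ s) : a * b ∈ spectralSubspace δ t := by
  rw [mem_spectralSubspace] at *
  rw [map_mul, ha, hb, SpatialTensor.tmul_mul, groupElt_mul, h]

theorem spectral_star {s t : Q} (h : s⁻¹ = t) {a : A} (ha : a ∈ spectralSubspace δ s) :
    star a ∈ spectralSubspace δ t := by
  rw [mem_spectralSubspace] at *
  rw [map_star, ha, SpatialTensor.star_tmul, star_groupElt, h]

theorem spectral_nonneg {a : A} (ha : star a * a ∈ spectralSubspace δ 1) :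
    ∃ c ∈ spectralSubspace δ 1, star a * a = star c * c := by
  let _ := CStarAlgebra.spectralOrder A
  let _ := CStarAlgebra.spectralOrderedRing A
  let _ := CStarAlgebra.spectralOrder (SpatialTensor A (GroupCStar Q))
  let _ := CStarAlgebra.spectralOrderedRing (SpatialTensor A (GroupCStar Q))
  set x := star a * a with hx
  have hx0 : 0 ≤ x := star_mul_self_nonneg a
  have hc0 : 0 ≤ CFC.sqrt x := CFC.sqrt_nonneg x
  have hcs : star (CFC.sqrt x) = CFC.sqrt x := (IsSelfAdjoint.of_nonneg hc0).star_eq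
  have hcc : CFC.sqrt x * CFC.sqrt x = x := CFC.sqrt_mul_sqrt_self x
  have hd0 : 0 ≤ CFC.sqrt (CFC.sqrt x) := CFC.sqrt_nonneg _
  have hds : star (CFC.sqrt (CFC.sqrt x)) = CFC.sqrt (CFC.sqrt x) :=
    (IsSelfAdjoint.of_nonneg hd0).star_eq
  have hdd : CFC.sqrt (CFC.sqrt x) * CFC.sqrt (CFC.sqrt x) = CFC.sqrt x :=
    CFC.sqrt_mul_sqrt_self _
  refine ⟨CFC.sqrt x, ?_, by rw [hcs, hcc]⟩
  rw [mem_spectralSubspace] at *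
  have h1 : 0 ≤ δ (CFC.sqrt x) := by
    rw [← hdd]
    nth_rewrite 1 [← hds]
    rw [map_mul, map_star]
    exact star_mul_self_nonneg _
  have h2 : 0 ≤ SpatialTensor.tmul (CFC.sqrt x) (groupElt (1 : Q)) := by
    have : SpatialTensor.tmul (CFC.sqrt x) (groupElt (1 : Q))
        = star (SpatialTensor.tmul (CFC.sqrt (CFC.sqrt x)) (groupElt (1 : Q)))
          * SpatialTensor.tmul (CFC.sqrt (CFC.sqrt x)) (groupElt (1 : Q)) := by
      rw [SpatialTensor.star_tmul, hds, star_groupElt, SpatialTensor.tmul_mul, hdd,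
        groupElt_mul, inv_mul_cancel]
    rw [this]
    exact star_mul_self_nonneg _
  rw [← CFC.sqrt_unique (b := δ (CFC.sqrt x)) (a := δ x) (by rw [← map_mul, hcc]) h1,
    ← CFC.sqrt_unique (b := SpatialTensor.tmul (CFC.sqrt x) (groupElt (1 : Q))) (a := δ x)
      (by rw [SpatialTensor.tmul_mul, hcc, groupElt_mul, mul_one, ha]) h2]

/-- The Fell bundle associated to a coaction `δ`: its fibres are the spectral subspaces. -/
def associatedBundle : FellBundle.{u, u} Q where
  fiber s := spectralSubspace δ s
  instComplete s := (isClosed_spectralSubspace δ s).completeSpace_coe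
  mul h a b := ⟨a.1 * b.1, spectral_mul δ h a.2 b.2⟩
  adj h a := ⟨star a.1, spectral_star δ h a.2⟩
  mul_add _ a b b' := Subtype.ext (mul_add a.1 b.1 b'.1)
  add_mul _ a a' b := Subtype.ext (add_mul a.1 a'.1 b.1)
  mul_smul _ z a b := Subtype.ext (mul_smul_comm z a.1 b.1)
  smul_mul _ z a b := Subtype.ext (smul_mul_assoc z a.1 b.1)
  mul_assoc _ _ _ _ a b c := Subtype.ext (mul_assoc a.1 b.1 c.1)
  norm_mul_le _ a b := norm_mul_le a.1 b.1
  adj_add _ a b := Subtype.ext (star_add a.1 b.1)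
  adj_smul _ z a := Subtype.ext (star_smul z a.1)
  adj_adj _ _ a := Subtype.ext (star_star a.1)
  adj_mul _ _ _ _ _ a b := Subtype.ext (star_mul a.1 b.1)
  norm_adj_mul_self _ _ a := by
    show ‖star a.1 * a.1‖ = ‖a.1‖ ^ 2
    rw [CStarRing.norm_star_mul_self, sq]
  adj_mul_self_nonneg h h' a := by
    obtain ⟨c, hc, e⟩ := spectral_nonneg δ (spectral_mul δ h' (spectral_star δ h a.2) a.2)
    exact ⟨⟨c, hc⟩, Subtype.ext e⟩

end

/-- The dual coaction `δ_𝒜 : C*(𝒜) → C*(𝒜) ⊗ C*(G)`, `a_s ↦ a_s ⊗ s`, of a Fell bundle. -/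
def dualCoaction (𝒜 : FellBundle.{u, u} G) :
    𝒜.FullCStar →⋆ₙₐ[ℂ] SpatialTensor 𝒜.FullCStar (GroupCStar G) :=
  𝒜.envLift (gradedHom 𝒜 (MonoidHom.id G) (𝒜.env ∅) (fun _ _ => 𝒜.env_mul ∅ rfl)
    (fun _ => 𝒜.env_adj ∅ rfl)) (fun _ hk => hk.elim)

theorem dualCoaction_env (𝒜 : FellBundle.{u, u} G) (s : G) (a : 𝒜.fiber s) :
    dualCoaction 𝒜 (𝒜.env ∅ s a) = SpatialTensor.tmul (𝒜.env ∅ s a) (groupElt s) :=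
  (𝒜.envLift_ι _ _ _).trans (gradedHom_single _ _ _ _ _ _ _)

/-- The C*-algebra `Ind D = C*(q*𝒟)` induced from a coaction `δ` of `G/N` on `D`, where `𝒟` is the
Fell bundle associated to `δ`. -/
abbrev IndAlgebra (N : Subgroup G) [N.Normal] {D : Type u} [NonUnitalCStarAlgebra D]
    (δ : D →⋆ₙₐ[ℂ] SpatialTensor D (GroupCStar (G ⧸ N))) : Type u :=
  (FellBundle.pullback N (associatedBundle δ)).FullCStar

/-- The coaction `Ind δ` of `G` on `Ind D`: the dual coaction on `C*(q*𝒟)`. -/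
def indCoaction (N : Subgroup G) [N.Normal] {D : Type u} [NonUnitalCStarAlgebra D]
    (δ : D →⋆ₙₐ[ℂ] SpatialTensor D (GroupCStar (G ⧸ N))) :
    IndAlgebra N δ →⋆ₙₐ[ℂ] SpatialTensor (IndAlgebra N δ) (GroupCStar G) :=
  dualCoaction (FellBundle.pullback N (associatedBundle δ))

/-- The coaction `γ` of `G` is induced from the coaction `δ` of `G/N`. -/
def IsInducedFrom (N : Subgroup G) [N.Normal] {A D : Type u} [NonUnitalCStarAlgebra A]
    [NonUnitalCStarAlgebra D] (γ : A →⋆ₙₐ[ℂ] SpatialTensor A (GroupCStar G))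
    (δ : D →⋆ₙₐ[ℂ] SpatialTensor D (GroupCStar (G ⧸ N))) : Prop :=
  IsCoaction γ ∧ IsCoaction δ ∧ CoactionsIsomorphic γ (indCoaction N δ)

end Coactions

/-! ### Actions, Green twists and crossed products -/

section Actions

open scoped MultiplierAlgebra

variable {G : Type u} [Group G] {B : Type v} [NonUnitalCStarAlgebra B]

theorem norm_starAlgEquiv (φ : B ≃⋆ₐ[ℂ] B) (b : B) : ‖φ b‖ = ‖b‖ := by
  refine le_antisymm (NonUnitalStarAlgHom.norm_apply_le φ b) ?_
  simpa using NonUnitalStarAlgHom.norm_apply_le φ.symm (φ b)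

/-- The semidirect product bundle `B × G` of an action `α` of `G` on `B`, with operations
`(b, s)(c, t) = (b α_s(c), st)` and `(b, s)* = (α_{s⁻¹}(b)*, s⁻¹)`. -/
def semidirect (α : G →* (B ≃⋆ₐ[ℂ] B)) : FellBundle.{u, v} G where
  fiber _ := B
  mul {r _ _} _ b c := b * α r c
  adj {s _} _ b := star (α s⁻¹ b)
  mul_add _ a b b' := by rw [map_add, mul_add]
  add_mul _ a a' b := add_mul _ _ _
  mul_smul _ z a b := by rw [map_smul, mul_smul_comm]
  smul_mul _ z a b := smul_mul_assoc _ _ _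
  mul_assoc {r s t x y z} h₁ h₂ h₃ h₄ a b c := by
    rw [← h₁, map_mul, map_mul, StarAlgEquiv.mul_apply, mul_assoc]
  norm_mul_le {r _ _} _ a b := by
    rw [← norm_starAlgEquiv (α r) b]
    exact norm_mul_le _ _
  adj_add _ a b := by rw [map_add, star_add]
  adj_smul _ z a := by rw [map_smul, star_smul]
  adj_adj {s t} h h' a := by
    rw [h', map_star, star_star, ← StarAlgEquiv.mul_apply, ← map_mul, mul_inv_cancel, map_one,
      StarAlgEquiv.one_apply]
  adj_mul {r s t r' s' t'} h hr hs ht h' a b := by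
    rw [← hs, map_star, ← StarAlgEquiv.mul_apply, ← map_mul, ← h, mul_inv_rev, map_mul, star_mul,
      ← StarAlgEquiv.mul_apply (α _) (α r), ← map_mul, inv_mul_cancel_right]
  norm_adj_mul_self {s t} h h' a := by
    rw [h, ← map_star, ← map_mul, norm_starAlgEquiv, CStarRing.norm_star_mul_self, sq]
  adj_mul_self_nonneg {s t} h h' a := ⟨α t a, by simp [h]⟩

/-- The full crossed product `B ×_α G`: the enveloping C*-algebra of the convolution `*`-algebra
of finitely supported functions `G → B`, which is `Γ_c(B × G)`. -/
abbrev CrossedProduct (α : G →* (B ≃⋆ₐ[ℂ] B)) : Type (max u v) := (semidirect α).FullCStar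

/-- The extension of a `*`-automorphism of `B` to the multiplier algebra `M(B)`. -/
def multiplierExt (φ : B ≃⋆ₐ[ℂ] B) (m : 𝓜(ℂ, B)) : 𝓜(ℂ, B) where
  fst := LinearMap.mkContinuous
    (⟨⟨fun b => φ (m.fst (φ.symm b)), by intros; simp only [map_add]⟩,
      by intros; simp only [map_smul, RingHom.id_apply]⟩ : B →ₗ[ℂ] B) ‖m.fst‖
    (fun b => by
      rw [← norm_starAlgEquiv φ.symm b]
      exact (norm_starAlgEquiv φ _).le.trans (m.fst.le_opNorm _))
  snd := LinearMap.mkContinuous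
    (⟨⟨fun b => φ (m.snd (φ.symm b)), by intros; simp only [map_add]⟩,
      by intros; simp only [map_smul, RingHom.id_apply]⟩ : B →ₗ[ℂ] B) ‖m.snd‖
    (fun b => by
      rw [← norm_starAlgEquiv φ.symm b]
      exact (norm_starAlgEquiv φ _).le.trans (m.snd.le_opNorm _))
  central x y := by
    show φ (m.snd (φ.symm x)) * y = x * φ (m.fst (φ.symm y))
    have := congrArg φ (m.central (φ.symm x) (φ.symm y))
    simpa only [map_mul, StarAlgEquiv.apply_symm_apply] using this

theorem multiplierExt_snd (φ : B ≃⋆ₐ[ℂ] B) (m : 𝓜(ℂ, B)) (b : B) :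
    (multiplierExt φ m).snd b = φ (m.snd (φ.symm b)) := rfl

/-- A twist over the normal subgroup `N`, in the sense of Green, for an action `α` of the discrete
group `G` on `B`: a homomorphism `τ : N → UM(B)` with `α_s(τ_n) = τ_{sns⁻¹}` and
`α_n(b) = τ_n b τ_{n⁻¹}`. -/
structure GreenTwist (α : G →* (B ≃⋆ₐ[ℂ] B)) (N : Subgroup G) [hN : N.Normal] where
  τ : N →* unitary 𝓜(ℂ, B)
  equivariant : ∀ (s : G) (n : N), multiplierExt (α s) (τ n : 𝓜(ℂ, B))
    = (τ ⟨s * n * s⁻¹, hN.conj_mem n n.2 s⟩ : 𝓜(ℂ, B))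
  implements : ∀ (n : N) (b : B), ((α (n : G) b : B) : 𝓜(ℂ, B))
    = (τ n : 𝓜(ℂ, B)) * (b : 𝓜(ℂ, B)) * (τ n⁻¹ : 𝓜(ℂ, B))

namespace GreenTwist

variable {α : G →* (B ≃⋆ₐ[ℂ] B)} {N : Subgroup G} [hN : N.Normal] (T : GreenTwist α N)

/-- Right multiplication `b τ_n`. -/
def rmul (b : B) (n : N) : B := (T.τ n : 𝓜(ℂ, B)).snd b

theorem coe_injective : Function.Injective (fun b : B => (b : 𝓜(ℂ, B))) := by
  intro b c h
  have h1 : (b : 𝓜(ℂ, B)).fst (star (b - c)) = (c : 𝓜(ℂ, B)).fst (star (b - c)) := by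
    have h' : (b : 𝓜(ℂ, B)) = (c : 𝓜(ℂ, B)) := h
    rw [h']
  rw [DoubleCentralizer.coe_fst, DoubleCentralizer.coe_fst, ContinuousLinearMap.mul_apply',
    ContinuousLinearMap.mul_apply', ← sub_eq_zero, ← sub_mul,
    CStarRing.mul_star_self_eq_zero_iff, sub_eq_zero] at h1
  exact h1

theorem coe_rmul (b : B) (n : N) :
    ((T.rmul b n : B) : 𝓜(ℂ, B)) = (b : 𝓜(ℂ, B)) * (T.τ n : 𝓜(ℂ, B)) := by
  refine DoubleCentralizer.ext ℂ B _ _ (Prod.ext ?_ ?_)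
  · ext x
    exact (T.τ n : 𝓜(ℂ, B)).central b x
  · ext x
    show x * T.rmul b n = (T.τ n : 𝓜(ℂ, B)).snd (x * b)
    refine sub_eq_zero.mp ?_
    set z := x * T.rmul b n - (T.τ n : 𝓜(ℂ, B)).snd (x * b) with hz
    rw [← CStarRing.mul_star_self_eq_zero_iff]
    generalize star z = w
    rw [hz, sub_mul, (T.τ n : 𝓜(ℂ, B)).central, mul_assoc, rmul, (T.τ n : 𝓜(ℂ, B)).central,
      mul_assoc, sub_self]

theorem coe_mul (b c : B) : ((b * c : B) : 𝓜(ℂ, B)) = (b : 𝓜(ℂ, B)) * (c : 𝓜(ℂ, B)) :=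
  map_mul (DoubleCentralizer.coeHom (𝕜 := ℂ) (A := B)) b c

theorem coe_star (b : B) : ((star b : B) : 𝓜(ℂ, B)) = star (b : 𝓜(ℂ, B)) :=
  map_star (DoubleCentralizer.coeHom (𝕜 := ℂ) (A := B)) b

theorem τ_mul (m n : N) : (T.τ (m * n) : 𝓜(ℂ, B)) = (T.τ m : 𝓜(ℂ, B)) * (T.τ n : 𝓜(ℂ, B)) := by
  rw [map_mul]; rfl

theorem τ_one : (T.τ 1 : 𝓜(ℂ, B)) = 1 := by
  rw [map_one]; rfl

theorem star_τ (n : N) : star (T.τ n : 𝓜(ℂ, B)) = (T.τ n⁻¹ : 𝓜(ℂ, B)) := by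
  rw [map_inv]; rfl

theorem rmul_one (b : B) : T.rmul b 1 = b := by
  rw [rmul, T.τ_one]; rfl

theorem rmul_rmul (b : B) (m n : N) : T.rmul (T.rmul b m) n = T.rmul b (m * n) := by
  rw [rmul, rmul, rmul, T.τ_mul]; rfl

theorem rmul_add (b c : B) (n : N) : T.rmul (b + c) n = T.rmul b n + T.rmul c n :=
  map_add (T.τ n : 𝓜(ℂ, B)).snd b c

theorem rmul_smul (z : ℂ) (b : B) (n : N) : T.rmul (z • b) n = z • T.rmul b n :=
  map_smul (T.τ n : 𝓜(ℂ, B)).snd z b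

theorem mul_rmul (b c : B) (n : N) : b * T.rmul c n = T.rmul (b * c) n := by
  apply coe_injective
  simp only [coe_mul, coe_rmul, mul_assoc]

theorem norm_rmul_le (b : B) (n : N) : ‖T.rmul b n‖ ≤ ‖b‖ := by
  refine ((T.τ n : 𝓜(ℂ, B)).snd.le_opNorm b).trans ?_
  rw [DoubleCentralizer.norm_snd]
  refine mul_le_of_le_one_left (norm_nonneg b) ?_
  have h : ‖(T.τ n : 𝓜(ℂ, B))‖ ^ 2 ≤ 1 := by
    rw [sq, ← CStarRing.norm_star_mul_self, Unitary.coe_star_mul_self]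
    rw [← DoubleCentralizer.norm_fst]
    exact ContinuousLinearMap.norm_id_le
  nlinarith [norm_nonneg (T.τ n : 𝓜(ℂ, B))]

theorem norm_rmul (b : B) (n : N) : ‖T.rmul b n‖ = ‖b‖ := by
  refine le_antisymm (T.norm_rmul_le b n) ?_
  have := T.norm_rmul_le (T.rmul b n) n⁻¹
  rwa [rmul_rmul, mul_inv_cancel, rmul_one] at this

theorem action_rmul (s : G) (b : B) (n : N) :
    α s (T.rmul b n) = T.rmul (α s b) ⟨s * n * s⁻¹, hN.conj_mem n n.2 s⟩ := by
  rw [rmul, rmul, ← T.equivariant s n, multiplierExt_snd, StarAlgEquiv.symm_apply_apply]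

theorem rmul_mul_action (b c : B) (n : N) :
    T.rmul b n * α (n : G)⁻¹ c = T.rmul (b * c) n := by
  apply coe_injective
  have := T.implements n⁻¹ c
  rw [inv_inv, Subgroup.coe_inv] at this
  simp only [coe_mul, coe_rmul, this]
  rw [mul_assoc, mul_assoc, ← mul_assoc (T.τ n : 𝓜(ℂ, B)), ← T.τ_mul, mul_inv_cancel, T.τ_one,
    one_mul, mul_assoc]

theorem star_action_rmul (b : B) (n : N) :
    star (α (n : G) (T.rmul b n)) = T.rmul (star b) n⁻¹ := by
  apply coe_injective
  simp only [coe_star, coe_rmul, T.implements, star_mul, star_τ, inv_inv]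
  rw [mul_assoc, ← mul_assoc (T.τ n : 𝓜(ℂ, B)), ← T.τ_mul, mul_inv_cancel, T.τ_one, one_mul]

/-! #### The twisted semidirect product bundle -/

/-- The orbit relation of the right action `(b, s) · n = (b τ_n, n⁻¹ s)` of `N` on the part of the
semidirect product bundle that lies over the coset `x ∈ G/N`. -/
def orbitRel (x : G ⧸ N) : Setoid (B × {s : G // (s : G ⧸ N) = x}) where
  r p p' := ∃ n : N, p'.1 = T.rmul p.1 n ∧ (p'.2 : G) = (n : G)⁻¹ * p.2
  iseqv :=
    { refl := fun p => ⟨1, (T.rmul_one _).symm, by simp⟩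
      symm := by
        rintro p p' ⟨n, h1, h2⟩
        exact ⟨n⁻¹, by rw [h1, rmul_rmul, mul_inv_cancel, rmul_one], by simp [h2]⟩
      trans := by
        rintro p p' p'' ⟨n, h1, h2⟩ ⟨m, h3, h4⟩
        exact ⟨n * m, by rw [h3, h1, rmul_rmul], by rw [h4, h2]; simp [mul_assoc]⟩ }

/-- The fibre of the twisted semidirect product bundle over `x ∈ G/N`: the set of `N`-orbits of
elements of `B × G` over `x`. -/
def Fiber (x : G ⧸ N) : Type (max u v) := Quotient (T.orbitRel x)

/-- The orbit `[b, s]`. -/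
def orbit {x : G ⧸ N} (b : B) (s : G) (h : (s : G ⧸ N) = x) : T.Fiber x :=
  Quotient.mk (T.orbitRel x) (b, ⟨s, h⟩)

theorem orbit_eq_orbit {x : G ⧸ N} {b c : B} {s t : G} {hs : (s : G ⧸ N) = x}
    {ht : (t : G ⧸ N) = x} : T.orbit b s hs = T.orbit c t ht ↔
      ∃ n : N, c = T.rmul b n ∧ t = (n : G)⁻¹ * s :=
  Quotient.eq (r := T.orbitRel x)

theorem mul_inv_mem {x : G ⧸ N} {s t : G} (hs : (s : G ⧸ N) = x) (ht : (t : G ⧸ N) = x) :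
    s * t⁻¹ ∈ N := by
  have h1 : t⁻¹ * s ∈ N := QuotientGroup.eq.mp (ht.trans hs.symm)
  have h2 := hN.conj_mem _ h1 t
  simpa [mul_assoc] using h2

/-- The bijection `b ↦ [b, s]` of `B` onto the fibre over `sN`. -/
def fiberEquiv {x : G ⧸ N} (s : G) (h : (s : G ⧸ N) = x) : B ≃ T.Fiber x where
  toFun b := T.orbit b s h
  invFun := Quotient.lift (fun p => T.rmul p.1 ⟨p.2 * s⁻¹, mul_inv_mem p.2.2 h⟩) (by
    rintro ⟨b, s', hs'⟩ ⟨c, t', ht'⟩ ⟨n, h1, h2⟩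
    dsimp only at h1 h2 ⊢
    rw [h1, rmul_rmul]
    congr 1
    ext
    simp [h2, mul_assoc])
  left_inv b := by
    show T.rmul b ⟨s * s⁻¹, _⟩ = b
    have : (⟨s * s⁻¹, mul_inv_mem h h⟩ : N) = 1 := Subtype.ext (mul_inv_cancel s)
    rw [this, rmul_one]
  right_inv a := by
    refine Quotient.inductionOn a ?_
    rintro ⟨b, s', hs'⟩
    refine Eq.symm (T.orbit_eq_orbit.mpr ⟨⟨s' * s⁻¹, mul_inv_mem hs' h⟩, rfl, ?_⟩)
    simp

/-- A chosen representative of a coset. -/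
def rep (x : G ⧸ N) : G := Quotient.out x

theorem rep_spec (x : G ⧸ N) : ((rep x : G) : G ⧸ N) = x := Quotient.out_eq' x

/-! The Banach space structure of the fibres is transported from `B` along any of the bijections
`b ↦ [b, s]`; `orbit_add`, `orbit_smul` and `norm_orbit` show that it does not depend on `s`. -/

instance (x : G ⧸ N) : AddCommGroup (T.Fiber x) :=
  (T.fiberEquiv (rep x) (rep_spec x)).symm.addCommGroup

instance (x : G ⧸ N) : Module ℂ (T.Fiber x) :=
  (T.fiberEquiv (rep x) (rep_spec x)).symm.module ℂ

/-- The linear bijection used to define the structure of the fibre. -/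
def repEquiv (x : G ⧸ N) : T.Fiber x ≃ₗ[ℂ] B :=
  (T.fiberEquiv (rep x) (rep_spec x)).symm.linearEquiv ℂ

theorem repEquiv_orbit {x : G ⧸ N} (b : B) (s : G) (h : (s : G ⧸ N) = x) :
    T.repEquiv x (T.orbit b s h) = T.rmul b ⟨s * (rep x)⁻¹, mul_inv_mem h (rep_spec x)⟩ := rfl

instance (x : G ⧸ N) : NormedAddCommGroup (T.Fiber x) :=
  NormedAddCommGroup.induced (T.Fiber x) B (T.repEquiv x) (T.repEquiv x).injective

theorem norm_repEquiv {x : G ⧸ N} (a : T.Fiber x) : ‖T.repEquiv x a‖ = ‖a‖ := rfl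

instance (x : G ⧸ N) : NormedSpace ℂ (T.Fiber x) where
  norm_smul_le z a := by
    rw [← norm_repEquiv, map_smul, norm_smul, norm_repEquiv]

instance (x : G ⧸ N) : CompleteSpace (T.Fiber x) := by
  have e : T.Fiber x ≃ₗᵢ[ℂ] B := ⟨T.repEquiv x, T.norm_repEquiv⟩
  exact e.isometry.isUniformInducing.completeSpace (by
    rw [e.surjective.range_eq]; exact isComplete_univ)

theorem orbit_add {x : G ⧸ N} (b c : B) (s : G) (h : (s : G ⧸ N) = x) :
    T.orbit (b + c) s h = T.orbit b s h + T.orbit c s h := by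
  apply (T.repEquiv x).injective
  rw [map_add, repEquiv_orbit, repEquiv_orbit, repEquiv_orbit, rmul_add]

theorem orbit_smul {x : G ⧸ N} (z : ℂ) (b : B) (s : G) (h : (s : G ⧸ N) = x) :
    T.orbit (z • b) s h = z • T.orbit b s h := by
  apply (T.repEquiv x).injective
  rw [map_smul, repEquiv_orbit, repEquiv_orbit, rmul_smul]

theorem norm_orbit {x : G ⧸ N} (b : B) (s : G) (h : (s : G ⧸ N) = x) :
    ‖T.orbit b s h‖ = ‖b‖ := by
  rw [← norm_repEquiv, repEquiv_orbit, norm_rmul]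

theorem exists_orbit {x : G ⧸ N} (a : T.Fiber x) (s : G) (h : (s : G ⧸ N) = x) :
    ∃ b, a = T.orbit b s h := ⟨_, ((T.fiberEquiv s h).apply_symm_apply a).symm⟩

/-- The multiplication `[b, s][c, t] = [b α_s(c), st]`. -/
def orbitMul {x y z : G ⧸ N} (h : x * y = z) : T.Fiber x → T.Fiber y → T.Fiber z :=
  Quotient.map₂ (fun p p' => (p.1 * α (p.2 : G) p'.1,
      ⟨p.2 * p'.2, by rw [QuotientGroup.mk_mul, p.2.2, p'.2.2, h]⟩)) (by
    rintro ⟨b, s, hs⟩ ⟨b', s', hs'⟩ ⟨n, h1, h2⟩ ⟨c, t, ht⟩ ⟨c', t', ht'⟩ ⟨m, h3, h4⟩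
    dsimp only at h1 h2 h3 h4
    subst h1 h2 h3 h4
    refine ⟨⟨s * m * s⁻¹, hN.conj_mem m m.2 s⟩ * n, ?_, ?_⟩
    · dsimp only
      rw [map_mul, StarAlgEquiv.mul_apply, map_inv, ← map_inv, rmul_mul_action, action_rmul,
        mul_rmul, rmul_rmul]
    · simp [mul_assoc])

/-- The involution `[b, s]* = [α_{s⁻¹}(b)*, s⁻¹]`. -/
def orbitAdj {x y : G ⧸ N} (h : x⁻¹ = y) : T.Fiber x → T.Fiber y :=
  Quotient.map (fun p => (star (α (p.2 : G)⁻¹ p.1),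
      ⟨(p.2 : G)⁻¹, by rw [QuotientGroup.mk_inv, p.2.2, h]⟩)) (by
    rintro ⟨b, s, hs⟩ ⟨b', s', hs'⟩ ⟨n, h1, h2⟩
    dsimp only at h1 h2
    subst h1 h2
    refine ⟨⟨s⁻¹ * (n⁻¹ : N) * s⁻¹⁻¹, hN.conj_mem _ (n⁻¹ : N).2 s⁻¹⟩, ?_, ?_⟩
    · dsimp only
      rw [mul_inv_rev, inv_inv, map_mul, StarAlgEquiv.mul_apply, ← map_star,
        star_action_rmul, action_rmul, map_star]
    · simp [mul_assoc])

theorem orbitMul_orbit {x y z : G ⧸ N} (h : x * y = z) (b c : B) (s t : G)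
    (hs : (s : G ⧸ N) = x) (ht : (t : G ⧸ N) = y) :
    T.orbitMul h (T.orbit b s hs) (T.orbit c t ht)
      = T.orbit (b * α s c) (s * t) (by rw [QuotientGroup.mk_mul, hs, ht, h]) := rfl

theorem orbitAdj_orbit {x y : G ⧸ N} (h : x⁻¹ = y) (b : B) (s : G) (hs : (s : G ⧸ N) = x) :
    T.orbitAdj h (T.orbit b s hs)
      = T.orbit (star (α s⁻¹ b)) s⁻¹ (by rw [QuotientGroup.mk_inv, hs, h]) := rfl

theorem orbit_congr {x : G ⧸ N} {b c : B} {s t : G} {hs : (s : G ⧸ N) = x}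
    {ht : (t : G ⧸ N) = x} (h1 : b = c) (h2 : s = t) : T.orbit b s hs = T.orbit c t ht := by
  subst h1 h2; rfl

/-- The twisted semidirect product bundle `B ×_N G` over `G/N`. -/
def bundle : FellBundle.{u, max u v} (G ⧸ N) where
  fiber := T.Fiber
  mul := T.orbitMul
  adj := T.orbitAdj
  mul_add {x y z} h a b b' := by
    obtain ⟨a, rfl⟩ := T.exists_orbit a _ (rep_spec x)
    obtain ⟨b, rfl⟩ := T.exists_orbit b _ (rep_spec y)
    obtain ⟨b', rfl⟩ := T.exists_orbit b' _ (rep_spec y)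
    rw [← orbit_add]
    simp only [orbitMul_orbit]
    rw [← orbit_add, map_add, mul_add]
  add_mul {x y z} h a a' b := by
    obtain ⟨a, rfl⟩ := T.exists_orbit a _ (rep_spec x)
    obtain ⟨a', rfl⟩ := T.exists_orbit a' _ (rep_spec x)
    obtain ⟨b, rfl⟩ := T.exists_orbit b _ (rep_spec y)
    rw [← orbit_add]
    simp only [orbitMul_orbit]
    rw [← orbit_add, add_mul]
  mul_smul {x y z} h w a b := by
    obtain ⟨a, rfl⟩ := T.exists_orbit a _ (rep_spec x)
    obtain ⟨b, rfl⟩ := T.exists_orbit b _ (rep_spec y)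
    rw [← orbit_smul]
    simp only [orbitMul_orbit]
    rw [← orbit_smul, map_smul, mul_smul_comm]
  smul_mul {x y z} h w a b := by
    obtain ⟨a, rfl⟩ := T.exists_orbit a _ (rep_spec x)
    obtain ⟨b, rfl⟩ := T.exists_orbit b _ (rep_spec y)
    rw [← orbit_smul]
    simp only [orbitMul_orbit]
    rw [← orbit_smul, smul_mul_assoc]
  mul_assoc {r s t x y z} h₁ h₂ h₃ h₄ a b c := by
    obtain ⟨a, rfl⟩ := T.exists_orbit a _ (rep_spec r)
    obtain ⟨b, rfl⟩ := T.exists_orbit b _ (rep_spec s)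
    obtain ⟨c, rfl⟩ := T.exists_orbit c _ (rep_spec t)
    simp only [orbitMul_orbit]
    refine T.orbit_congr ?_ (mul_assoc _ _ _)
    rw [map_mul, map_mul, StarAlgEquiv.mul_apply, mul_assoc]
  norm_mul_le {x y z} h a b := by
    obtain ⟨a, rfl⟩ := T.exists_orbit a _ (rep_spec x)
    obtain ⟨b, rfl⟩ := T.exists_orbit b _ (rep_spec y)
    rw [orbitMul_orbit, norm_orbit, norm_orbit, norm_orbit, ← norm_starAlgEquiv (α (rep x)) b]
    exact norm_mul_le _ _
  adj_add {x y} h a b := by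
    obtain ⟨a, rfl⟩ := T.exists_orbit a _ (rep_spec x)
    obtain ⟨b, rfl⟩ := T.exists_orbit b _ (rep_spec x)
    rw [← orbit_add]
    simp only [orbitAdj_orbit]
    rw [← orbit_add, map_add, star_add]
  adj_smul {x y} h w a := by
    obtain ⟨a, rfl⟩ := T.exists_orbit a _ (rep_spec x)
    rw [← orbit_smul]
    simp only [orbitAdj_orbit]
    rw [← orbit_smul, map_smul, star_smul]
  adj_adj {x y} h h' a := by
    obtain ⟨a, rfl⟩ := T.exists_orbit a _ (rep_spec x)
    simp only [orbitAdj_orbit]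
    refine T.orbit_congr ?_ (inv_inv _)
    rw [map_star, star_star, ← StarAlgEquiv.mul_apply, ← map_mul, inv_mul_cancel, map_one,
      StarAlgEquiv.one_apply]
  adj_mul {r s t r' s' t'} h hr hs ht h' a b := by
    obtain ⟨a, rfl⟩ := T.exists_orbit a _ (rep_spec r)
    obtain ⟨b, rfl⟩ := T.exists_orbit b _ (rep_spec s)
    simp only [orbitMul_orbit, orbitAdj_orbit]
    refine T.orbit_congr ?_ (mul_inv_rev _ _)
    rw [map_star, ← StarAlgEquiv.mul_apply, ← map_mul, mul_inv_rev, map_mul, star_mul,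
      ← StarAlgEquiv.mul_apply (α _) (α (rep r)), ← map_mul, inv_mul_cancel_right]
  norm_adj_mul_self {x y} h h' a := by
    obtain ⟨a, rfl⟩ := T.exists_orbit a _ (rep_spec x)
    rw [orbitAdj_orbit, orbitMul_orbit, norm_orbit, norm_orbit, ← map_star, ← map_mul,
      norm_starAlgEquiv, CStarRing.norm_star_mul_self, sq]
  adj_mul_self_nonneg {x y} h h' a := by
    obtain ⟨a, rfl⟩ := T.exists_orbit a _ (rep_spec x)
    refine ⟨T.orbit (α (rep x)⁻¹ a) 1 rfl, ?_⟩
    simp only [orbitMul_orbit, orbitAdj_orbit]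
    exact T.orbit_congr (by simp) (by simp)

/-! #### The twisted crossed product -/

/-- The relations `(b τ_n, s) = (b, ns)` in the convolution algebra of finitely supported
functions `G → B`.  A representation of this algebra given by a nondegenerate covariant representation `(π, U)`
satisfies them if and only if it preserves the twist, i.e. `π(τ_n) = U_n` for `n ∈ N`. -/
def relations : Set (semidirect α).Sec :=
  {k | ∃ (b : B) (s : G) (n : N),
    k = (semidirect α).single s (show (semidirect α).fiber s from T.rmul b n)
      - (semidirect α).single ((n : G) * s) (show (semidirect α).fiber _ from b)}

/-- Green's (full) twisted crossed product `B ×_{α,τ} G`: the quotient of `B ×_α G` through which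
factor exactly the representations that preserve the twist, i.e. the completion of the convolution
algebra in the largest C*-seminorm that respects the twist. -/
abbrev TwistedCrossedProduct : Type (max u v) := (semidirect α).Env T.relations

end GreenTwist

end Actions

section DualCoactions

variable {G : Type u} [Group G] {B : Type u} [NonUnitalCStarAlgebra B]

/-- The dual coaction `α̂` of `G` on `B ×_α G`, determined by `(b, s) ↦ (b, s) ⊗ s`. -/
def dualCoactionOfAction (α : G →* (B ≃⋆ₐ[ℂ] B)) :
    CrossedProduct α →⋆ₙₐ[ℂ] SpatialTensor (CrossedProduct α) (GroupCStar G) :=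
  dualCoaction (semidirect α)

/-- The dual coaction of `G/N` on the twisted crossed product `B ×_{α,τ} G`, determined by
`(b, s) ↦ (b, s) ⊗ sN`. -/
def GreenTwist.dualCoaction {α : G →* (B ≃⋆ₐ[ℂ] B)} {N : Subgroup G} [N.Normal]
    (T : GreenTwist α N) : T.TwistedCrossedProduct →⋆ₙₐ[ℂ]
      SpatialTensor T.TwistedCrossedProduct (GroupCStar (G ⧸ N)) :=
  (semidirect α).envLift
    (gradedHom (semidirect α) (QuotientGroup.mk' N) ((semidirect α).env T.relations)
      (fun _ _ => (semidirect α).env_mul _ rfl) (fun _ => (semidirect α).env_adj _ rfl)) (by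
    intro k hk
    have h0 := (semidirect α).ι_eq_zero hk
    obtain ⟨b, s, n, rfl⟩ := hk
    have hq : QuotientGroup.mk' N ((n : G) * s) = QuotientGroup.mk' N s := by
      rw [map_mul]
      have : QuotientGroup.mk' N (n : G) = 1 := (QuotientGroup.eq_one_iff _).mpr n.2
      rw [this, one_mul]
    rw [map_sub] at h0 ⊢
    rw [gradedHom_single, gradedHom_single, hq, ← SpatialTensor.tmulRight_apply,
      ← SpatialTensor.tmulRight_apply, ← map_sub]
    exact (congrArg _ h0).trans (map_zero _))

end DualCoactions

end FellCoaction

end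

open FellCoaction

noncomputable section

namespace FellCoaction

open scoped ComplexOrder

/-! ### Representations of C*-algebras -/

section Representations

variable {A : Type u} [NonUnitalCStarAlgebra A]

/-! The fibres of `q*𝒟` over `s` and `ns` are the same Banach space whenever `n ∈ N`. If `B × G` is
such a pull-back, the fibres over `n` and over `1` are two copies of `B` inside one space, and
comparing them gives an isometry `b ↦ b τ_n` of `B`. Each axiom of a Green twist then comes from
applying a bundle operation to one element written in two ways, once over `n` and once over `1`
(`rightTwist_mul`, `rightTwist_mul_action`, `star_rightTwist_action`, `action_rightTwist`, collected
in `greenTwist`). Conversely, a twist makes `b ↦ [b, s]` an isomorphism onto the pull-back of the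
orbit bundle (`isoPullback`).

To pass between bundles and coactions, a Fell bundle over a discrete group is recovered from its
dual coaction as the bundle of spectral subspaces (`isoSpectral`). This has two ingredients. The
fibres embed isometrically in the full C*-algebra (`norm_env`): by the C*-identity it suffices to
treat the unit fibre, whose positive functionals extend by zero to positive functionals on sections,
so that their GNS representations detect it. And the spectral subspaces contain nothing beyond the
fibres (`spectralSubspace_eq`): slicing the second leg of `A ⊗ C*(Q)` by the regular representation
gives Fourier coefficients, which project onto the homogeneous components. These slices are bounded
for the minimal norm by `norm_algSlice_le`.

For a twist, the relations of the twisted crossed product hold in `C*(B ×_N G)`, where the fibres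
are isometric copies of `B`. So the elements `(b, s)` keep their norm in the quotient
(`norm_crossedElt`), and `B ×_N G` is the spectral bundle of the dual coaction of `G/N`
(`isoAssociated`). Together with `isoPullback` this shows that the dual coaction of `G` is induced.
The equivalence follows: a pull-back yields a twist and hence an induced coaction, while an
equivariant isomorphism with an induced coaction carries spectral subspaces to spectral subspaces
and so identifies `B × G` with a pull-back. -/

theorem eq_zero_of_forall_mul_eq_zero {a : A} (h : ∀ b, a * b = 0) : a = 0 :=
  (CStarRing.mul_star_self_eq_zero_iff a).mp (h (star a))

theorem eq_of_forall_mul_right_eq {a a' : A} (h : ∀ b, a * b = a' * b) : a = a' :=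
  sub_eq_zero.mp (eq_zero_of_forall_mul_eq_zero fun b => by rw [sub_mul, h, sub_self])

theorem eq_of_forall_mul_left_eq {a a' : A} (h : ∀ b, b * a = b * a') : a = a' := by
  refine star_injective (eq_of_forall_mul_right_eq fun b => star_injective ?_)
  simpa using h (star b)

section
variable [PartialOrder A] [StarOrderedRing A]

/-- A nonzero positive element is detected by a positive functional. -/
theorem exists_positive_functional {y : A} (hy : 0 ≤ y) (h0 : y ≠ 0) :
    ∃ f : A →ₚ[ℂ] ℂ, f y ≠ 0 := by
  -- The positive cone is closed and omits `-y`, so Hahn–Banach separation gives a real functional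
  -- that is nonnegative on the cone and positive at `y`.
  let C : ProperCone ℝ A :=
    { carrier := {a : A | 0 ≤ a}
      add_mem' := fun ha hb => add_nonneg ha hb
      zero_mem' := le_refl (0 : A)
      smul_mem' := fun c _ ha => smul_nonneg c.2 ha
      isClosed' := CStarAlgebra.isClosed_nonneg }
  have hC : -y ∉ C := fun h : 0 ≤ -y => h0 (le_antisymm (neg_nonneg.mp h) hy)
  obtain ⟨g, hg, hgy⟩ := C.hyperplane_separation_point hC
  have hg' : ∀ x : A, 0 ≤ x → 0 ≤ g x := hg
  have hgy' : 0 < g y := by simpa using hgy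
  -- The real functional is complexified through real and imaginary parts, which leaves its values
  -- on positive elements unchanged.
  let F : A →ₗ[ℂ] ℂ :=
    { toFun := fun a => ((g (realPart a : A) : ℝ) : ℂ)
        + ((g (imaginaryPart a : A) : ℝ) : ℂ) * Complex.I
      map_add' := fun a b => by
        simp only [map_add, AddSubgroup.coe_add, Complex.ofReal_add]
        ring
      map_smul' := fun z a => by
        simp only [realPart_smul, imaginaryPart_smul, AddSubgroupClass.coe_sub,
          selfAdjoint.val_smul, map_sub, map_smul, map_add, AddSubgroup.coe_add,
          smul_eq_mul, RingHom.id_apply, Complex.ofReal_sub, Complex.ofReal_add,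
          Complex.ofReal_mul]
        apply Complex.ext <;> simp }
  have hF : ∀ x : A, 0 ≤ x → F x = ((g x : ℝ) : ℂ) := fun x hx => by
    have hs : IsSelfAdjoint x := IsSelfAdjoint.of_nonneg hx
    show ((g (realPart x : A) : ℝ) : ℂ) + ((g (imaginaryPart x : A) : ℝ) : ℂ) * Complex.I = _
    rw [hs.coe_realPart, hs.imaginaryPart]
    simp
  refine ⟨PositiveLinearMap.mk₀ F fun x hx => ?_, ?_⟩
  · rw [hF x hx]
    exact_mod_cast hg' x hx
  · show F y ≠ 0
    rw [hF y hy]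
    exact_mod_cast hgy'.ne'

end

/-- The representations of a C*-algebra on Hilbert spaces separate its points. -/
theorem eq_zero_of_forall_rep {a : A} (h : ∀ (H : Type u) (_ : NormedAddCommGroup H)
    (_ : InnerProductSpace ℂ H) (_ : CompleteSpace H) (π : A →⋆ₙₐ[ℂ] (H →L[ℂ] H)), π a = 0) :
    a = 0 := by
  let _ := CStarAlgebra.spectralOrder A
  let _ := CStarAlgebra.spectralOrderedRing A
  -- Without a unit there need be no cyclic vector at hand, so `a` is tested on the GNS vector of an
  -- arbitrary `b`: the image has squared norm `f((ab)*(ab))`.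
  refine eq_zero_of_forall_mul_eq_zero fun b => ?_
  by_contra hne
  obtain ⟨f, hf⟩ := exists_positive_functional (star_mul_self_nonneg (a * b))
    (fun h => hne ((CStarRing.star_mul_self_eq_zero_iff _).mp h))
  apply hf
  have h1 := h f.GNS inferInstance inferInstance inferInstance f.gnsNonUnitalStarAlgHom
  have h2 := congrArg (fun T => T ((f.toPreGNS b : f.PreGNS) : f.GNS)) h1
  simp only [PositiveLinearMap.gnsNonUnitalStarAlgHom_apply_coe,
    PositiveLinearMap.leftMulMapPreGNS_apply, zero_apply] at h2
  have h3 : ‖f.toPreGNS (a * b)‖ = 0 := by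
    rw [← UniformSpace.Completion.norm_coe]
    exact norm_eq_zero.mpr (by simpa using h2)
  have h4 := f.preGNS_norm_sq (f.toPreGNS (a * b))
  rw [h3] at h4
  simpa using h4.symm

/-- The norm of a C*-algebra is the supremum over its representations on Hilbert spaces. -/
theorem norm_le_of_forall_rep {a : A} {M : ℝ} (h : ∀ (H : Type u) (_ : NormedAddCommGroup H)
    (_ : InnerProductSpace ℂ H) (_ : CompleteSpace H) (π : A →⋆ₙₐ[ℂ] (H →L[ℂ] H)),
    ‖π a‖ ≤ M) : ‖a‖ ≤ M := by
  let S : Set (CStarSeminorm A) := {p | ∃ (H : Type u) (_ : NormedAddCommGroup H)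
    (_ : InnerProductSpace ℂ H) (_ : CompleteSpace H) (π : A →⋆ₙₐ[ℂ] (H →L[ℂ] H)),
    p = CStarSeminorm.ofHom π}
  have hne : S.Nonempty := ⟨_, PUnit, inferInstance, inferInstance, inferInstance, 0, rfl⟩
  have hb : ∀ x, ∃ M, ∀ p ∈ S, p x ≤ M := fun x => ⟨‖x‖, by
    rintro p ⟨H, _, _, _, π, rfl⟩
    exact NonUnitalStarAlgHom.norm_apply_le π x⟩
  let p := CStarSeminorm.sup S hne hb
  -- Once the representations separate points, the map into the completion for their supremum is an
  -- injective `*`-homomorphism of C*-algebras, hence isometric, and the supremum is the norm.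
  have hinj : Function.Injective p.ι := by
    refine (injective_iff_map_eq_zero p.ι).mpr fun x hx => eq_zero_of_forall_rep ?_
    intro H _ _ _ π
    have h1 : p x = 0 := by rw [← p.norm_ι, hx, norm_zero]
    have h2 : CStarSeminorm.ofHom π x ≤ p x := 
      CStarSeminorm.le_sup (S := S) ⟨H, _, _, _, π, rfl⟩ x
    rw [h1, CStarSeminorm.ofHom_apply] at h2
    exact norm_le_zero_iff.mp h2
  rw [← NonUnitalStarAlgHom.norm_map p.ι hinj, p.norm_ι]
  refine CStarSeminorm.sup_le ?_
  rintro _ ⟨H, _, _, _, π, rfl⟩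
  exact h H _ _ _ π

end Representations

/-! ### Slice maps on the spatial tensor product -/

section Slice

variable {A C : Type u} [NonUnitalCStarAlgebra A] [NonUnitalCStarAlgebra C]
  {K : Type u} [NormedAddCommGroup K] [InnerProductSpace ℂ K] [CompleteSpace K]
  (ρ : C →⋆ₙₐ[ℂ] (K →L[ℂ] K)) (ξ η : K)

/-- The map `a ⊗ c ↦ ⟨ξ, ρ(c) η⟩ a` on the algebraic tensor product. -/
def algSlice : A ⊗[ℂ] C →ₗ[ℂ] A :=
  TensorProduct.lift (LinearMap.mk₂ ℂ (fun a c => (inner ℂ ξ (ρ c η) : ℂ) • a)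
    (by intros; rw [smul_add]) (by intros; rw [smul_comm])
    (by intros; rw [map_add, add_apply, inner_add_right, add_smul])
    (by intros; rw [map_smul, smul_apply, inner_smul_right, mul_smul]))

theorem algSlice_tmul (a : A) (c : C) :
    algSlice ρ ξ η (a ⊗ₜ c) = (inner ℂ ξ (ρ c η) : ℂ) • a := rfl

/-- A slice is a compression of `π ⊗ ρ`. This turns bounds for slices into bounds for operators on
the tensor product. -/
theorem inner_rep_algSlice {H : Type u} [NormedAddCommGroup H] [InnerProductSpace ℂ H]
    [CompleteSpace H] (π : A →⋆ₙₐ[ℂ] (H →L[ℂ] H)) (x : A ⊗[ℂ] C) (h k : H) :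
    inner ℂ h (π (algSlice ρ ξ η x) k)
      = inner ℂ (h ⊗ₜ[ℂ] ξ) (repTensor π ρ x (k ⊗ₜ[ℂ] η)) := by
  induction x with
  | zero => simp
  | add x y hx hy => simp only [map_add, add_apply, inner_add_right, hx, hy]
  | tmul a c =>
    rw [algSlice_tmul, repTensor_tmul, TensorProduct.mapL_tmul, TensorProduct.inner_tmul,
      map_smul, smul_apply, inner_smul_right, mul_comm]

/-- The norm of `A` is seen by its representations, and in each of them the matrix coefficients of
the slice are matrix coefficients of `(π ⊗ ρ)(x)` at vectors `h ⊗ ξ` and `k ⊗ η`. The seminorm of `π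
⊗ ρ` is one of those whose supremum is the spatial norm. -/
theorem norm_algSlice_le (x : A ⊗[ℂ] C) :
    ‖algSlice ρ ξ η x‖ ≤ ‖ξ‖ * ‖η‖ * spatialNorm A C x := by
  refine norm_le_of_forall_rep fun H _ _ _ π => ?_
  have hp : repSeminorm π ρ x ≤ spatialNorm A C x :=
    CStarSeminorm.le_sup (S := spatialSeminorms A C) ⟨H, K, _, _, _, _, _, _, π, ρ, rfl⟩ x
  have hnn := (spatialNorm A C).nonneg x
  refine ContinuousLinearMap.opNorm_le_of_re_inner_le (by positivity) fun k h hk hh => ?_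
  refine (Complex.re_le_norm _).trans ?_
  rw [← inner_conj_symm, RCLike.norm_conj, inner_rep_algSlice]
  refine le_trans (norm_inner_le_norm (𝕜 := ℂ) (h ⊗ₜ[ℂ] ξ) (repTensor π ρ x (k ⊗ₜ[ℂ] η))) ?_
  have h1 := (repTensor π ρ x).le_opNorm (k ⊗ₜ[ℂ] η)
  rw [TensorProduct.norm_tmul, hk, one_mul] at h1
  rw [TensorProduct.norm_tmul, hh, one_mul, mul_assoc]
  refine mul_le_mul_of_nonneg_left ?_ (norm_nonneg _)
  rw [mul_comm ‖η‖]
  exact h1.trans (mul_le_mul_of_nonneg_right hp (norm_nonneg _))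

/-- The slice map `a ⊗ c ↦ ⟨ξ, ρ(c) η⟩ a`. -/
def slice : SpatialTensor A C →L[ℂ] A :=
  (LinearMap.mkContinuous (show (spatialNorm A C).Pre →ₗ[ℂ] A from algSlice ρ ξ η) (‖ξ‖ * ‖η‖)
    (norm_algSlice_le ρ ξ η)).extend (spatialNorm A C).preι

theorem slice_tmul (a : A) (c : C) :
    slice ρ ξ η (SpatialTensor.tmul a c) = (inner ℂ ξ (ρ c η) : ℂ) • a :=
  ContinuousLinearMap.extend_eq _ (spatialNorm A C).preι_dense (spatialNorm A C).preι_uniform _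

end Slice

/-! ### The GNS construction for bounded positive functionals on `*`-algebras -/

section GNS

variable {R : Type u} [NonUnitalRing R] [StarRing R] [Module ℂ R] [IsScalarTower ℂ R R]
  [SMulCommClass ℂ R R] [StarModule ℂ R]

/-- A positive functional on a `*`-algebra, for which the left multiplications are bounded in the
associated seminorm. -/
structure IsBoundedPositive (Φ : R →ₗ[ℂ] ℂ) : Prop where
  map_star : ∀ x, Φ (star x) = star (Φ x)
  nonneg : ∀ x, 0 ≤ Φ (star x * x)
  bounded : ∀ a, ∃ C : ℝ, 0 ≤ C ∧
    ∀ x, (Φ (star (a * x) * (a * x))).re ≤ C ^ 2 * (Φ (star x * x)).re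

namespace IsBoundedPositive

variable {Φ : R →ₗ[ℂ] ℂ} (hΦ : IsBoundedPositive Φ)

/-- The algebra `R` with the semi-inner product `⟨x, y⟩ = Φ(x* y)`. -/
@[nolint unusedArguments]
def PreGNS (_ : IsBoundedPositive Φ) : Type u := R

instance : AddCommGroup hΦ.PreGNS := inferInstanceAs (AddCommGroup R)
instance : Module ℂ hΦ.PreGNS := inferInstanceAs (Module ℂ R)

/-- The identity map of `R` onto the pre-Hilbert space. -/
def toPre : R ≃ₗ[ℂ] hΦ.PreGNS := LinearEquiv.refl ℂ R

/-- The semi-inner product `⟨x, y⟩ = Φ(x* y)`. -/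
abbrev core : PreInnerProductSpace.Core ℂ hΦ.PreGNS where
  inner x y := Φ (star (hΦ.toPre.symm x) * hΦ.toPre.symm y)
  conj_inner_symm x y := by
    rw [← Complex.star_def, ← hΦ.map_star, star_mul, star_star]
  re_inner_nonneg x := (RCLike.nonneg_iff.mp (hΦ.nonneg _)).1
  add_left _ _ _ := by rw [map_add, star_add, add_mul, map_add]
  smul_left _ _ _ := by simp [smul_mul_assoc]

instance : SeminormedAddCommGroup hΦ.PreGNS :=
  InnerProductSpace.Core.toSeminormedAddCommGroup (c := hΦ.core)
instance : InnerProductSpace ℂ hΦ.PreGNS := InnerProductSpace.ofCore hΦ.core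

theorem inner_toPre (x y : R) : inner ℂ (hΦ.toPre x) (hΦ.toPre y) = Φ (star x * y) := rfl

theorem norm_toPre_sq (x : R) : ‖hΦ.toPre x‖ ^ 2 = (Φ (star x * x)).re := by
  rw [← inner_toPre]
  exact (inner_self_eq_norm_sq (𝕜 := ℂ) (hΦ.toPre x)).symm

/-- The Hilbert space of the GNS construction. -/
abbrev Space : Type u := UniformSpace.Completion hΦ.PreGNS

/-- Left multiplication by `a` on the pre-Hilbert space. -/
def leftMul (a : R) : hΦ.PreGNS →L[ℂ] hΦ.PreGNS :=
  LinearMap.mkContinuousOfExistsBound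
    (hΦ.toPre.toLinearMap ∘ₗ LinearMap.mulLeft ℂ a ∘ₗ hΦ.toPre.symm.toLinearMap) (by
      obtain ⟨C, hC, h⟩ := hΦ.bounded a
      refine ⟨C, fun x => ?_⟩
      refine le_of_sq_le_sq ?_ (mul_nonneg hC (norm_nonneg x))
      rw [mul_pow]
      exact (hΦ.norm_toPre_sq _).trans_le ((h x).trans_eq
        (congrArg (C ^ 2 * ·) (hΦ.norm_toPre_sq (hΦ.toPre.symm x)).symm)))

/-- The GNS representation. -/
def rep : R →⋆ₙₐ[ℂ] (hΦ.Space →L[ℂ] hΦ.Space) where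
  toFun a := (hΦ.leftMul a).completion
  map_smul' z a := by
    ext x
    induction x using UniformSpace.Completion.induction_on with
    | hp => exact isClosed_eq (ContinuousLinearMap.continuous _) (ContinuousLinearMap.continuous _)
    | ih x =>
      have : hΦ.leftMul (z • a) x = z • hΦ.leftMul a x := smul_mul_assoc z a (hΦ.toPre.symm x)
      simp [this]
  map_zero' := by
    ext x
    induction x using UniformSpace.Completion.induction_on with
    | hp => exact isClosed_eq (ContinuousLinearMap.continuous _) (ContinuousLinearMap.continuous _)
    | ih x =>
      have : hΦ.leftMul 0 x = 0 := zero_mul (hΦ.toPre.symm x)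
      simp [this, UniformSpace.Completion.coe_zero]
  map_add' a b := by
    ext x
    induction x using UniformSpace.Completion.induction_on with
    | hp => exact isClosed_eq (ContinuousLinearMap.continuous _) (ContinuousLinearMap.continuous _)
    | ih x =>
      have : hΦ.leftMul (a + b) x = hΦ.leftMul a x + hΦ.leftMul b x :=
        add_mul a b (hΦ.toPre.symm x)
      simp [this, UniformSpace.Completion.coe_add]
  map_mul' a b := by
    ext x
    induction x using UniformSpace.Completion.induction_on with
    | hp => exact isClosed_eq (ContinuousLinearMap.continuous _) (ContinuousLinearMap.continuous _)
    | ih x =>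
      have : hΦ.leftMul (a * b) x = hΦ.leftMul a (hΦ.leftMul b x) :=
        mul_assoc a b (hΦ.toPre.symm x)
      simp [this]
  map_star' a := by
    refine (ContinuousLinearMap.eq_adjoint_iff _ _).mpr fun x y => ?_
    induction x, y using UniformSpace.Completion.induction_on₂ with
    | hp => apply isClosed_eq <;> fun_prop
    | ih x y =>
      have : inner ℂ (hΦ.leftMul (star a) x) y = inner ℂ x (hΦ.leftMul a y) := by
        refine congrArg Φ (?_ : star (star a * hΦ.toPre.symm x) * hΦ.toPre.symm y
          = star (hΦ.toPre.symm x) * (a * hΦ.toPre.symm y))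
        rw [star_mul, star_star, mul_assoc]
      simpa using this

/-- The image of an element of `R` in the Hilbert space. -/
def vec (x : R) : hΦ.Space := ((hΦ.toPre x : hΦ.PreGNS) : hΦ.Space)

theorem rep_vec (a x : R) : hΦ.rep a (hΦ.vec x) = hΦ.vec (a * x) :=
  ContinuousLinearMap.completion_apply_coe _ _

theorem inner_vec (x y : R) : inner ℂ (hΦ.vec x) (hΦ.vec y) = Φ (star x * y) :=
  UniformSpace.Completion.inner_coe _ _

end IsBoundedPositive

end GNS

/-! ### The regular representations of a Fell bundle -/

namespace FellBundle

variable {G : Type u} [Group G] (𝒜 : FellBundle.{u, v} G)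

theorem exists_eq_sum_single (x : 𝒜.Sec) :
    ∃ (S : Finset G) (a : ∀ s, 𝒜.fiber s), x = ∑ s ∈ S, 𝒜.single s (a s) := by
  let _ := Classical.decEq G
  let _ : ∀ (s : G) (a : 𝒜.fiber s), Decidable (a ≠ 0) := fun _ _ => Classical.dec _
  exact ⟨_, _, (DirectSum.sum_support_of (β := 𝒜.fiber) x).symm⟩

/-- The value of a section at `s`. -/
def coeff (s : G) : 𝒜.Sec →ₗ[ℂ] 𝒜.fiber s := DirectSum.component ℂ G 𝒜.fiber s

theorem coeff_single (s : G) (a : 𝒜.fiber s) : 𝒜.coeff s (𝒜.single s a) = a :=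
  let _ := Classical.decEq G
  DirectSum.component.lof_self ℂ s a

theorem coeff_single_of_ne {s t : G} (h : s ≠ t) (a : 𝒜.fiber s) :
    𝒜.coeff t (𝒜.single s a) = 0 :=
  let _ := Classical.decEq G
  (DirectSum.component.of ℂ t s a).trans (dif_neg h)

/-- For a positive contraction `h`, the element `k = 1 - (1 - h)^(1/2)` is selfadjoint and
satisfies `(1 - k)² = 1 - h`. -/
theorem exists_one_sub_sq {A : Type u} [NonUnitalCStarAlgebra A] (h : A)
    (hh : ∃ c, h = star c * c) (h1 : ‖h‖ ≤ 1) :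
    ∃ k : A, star k = k ∧ k + k - k * k = h := by
  let _ := CStarAlgebra.spectralOrder A
  let _ := CStarAlgebra.spectralOrderedRing A
  have h0 : 0 ≤ h := by
    obtain ⟨c, rfl⟩ := hh
    exact star_mul_self_nonneg c
  have hs : IsSelfAdjoint h := .of_nonneg h0
  -- Since `f` vanishes at `0`, the nonunital functional calculus applies, and `2f - f²` is the
  -- identity on `t ≤ 1`.
  let f : ℝ → ℝ := fun t => 1 - √(1 - t)
  have hf : Continuous f := by fun_prop
  have hf0 : f 0 = 0 := by simp [f]
  refine ⟨cfcₙ f h, (cfcₙ_predicate f h : IsSelfAdjoint _).star_eq, ?_⟩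
  rw [← cfcₙ_add (a := h) f f (by fun_prop) hf0 (by fun_prop) hf0,
    ← cfcₙ_mul f f h (by fun_prop) hf0 (by fun_prop) hf0,
    ← cfcₙ_sub _ _ (a := h) (by fun_prop) (by simp [hf0]) (by fun_prop) (by simp [hf0])]
  conv_rhs => rw [← cfcₙ_id' ℝ h]
  refine cfcₙ_congr fun t ht => ?_
  -- This is where `‖h‖ ≤ 1` enters: for `t > 1` the root would be the default value `0` and the
  -- identity would fail.
  have ht1 : t ≤ 1 := (le_abs_self t).trans
    ((NonUnitalIsometricContinuousFunctionalCalculus.norm_quasispectrum_le h ht hs).trans h1)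
  have := Real.mul_self_sqrt (show 0 ≤ 1 - t by linarith)
  simp only [f]
  linarith

/-- A positive functional on the unit fibre. -/
structure IsPositive (φ : 𝒜.fiber 1 →ₗ[ℂ] ℂ) : Prop where
  map_adj : ∀ a, φ (𝒜.adj inv_one a) = star (φ a)
  nonneg : ∀ a, 0 ≤ φ (𝒜.mul (one_mul 1) (𝒜.adj inv_one a) a)

variable {𝒜} {φ : 𝒜.fiber 1 →ₗ[ℂ] ℂ} (hφ : 𝒜.IsPositive φ)

/-- The functional `x ↦ φ(x(1))` on `Γ_c(𝒜)`. -/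
def secFunctional (φ : 𝒜.fiber 1 →ₗ[ℂ] ℂ) : 𝒜.Sec →ₗ[ℂ] ℂ := φ ∘ₗ 𝒜.coeff 1

theorem secFunctional_single_one (a : 𝒜.fiber 1) : secFunctional φ (𝒜.single 1 a) = φ a := by
  rw [secFunctional, LinearMap.comp_apply, coeff_single]

theorem secFunctional_single_of_ne {s : G} (h : s ≠ 1) (a : 𝒜.fiber s) :
    secFunctional φ (𝒜.single s a) = 0 := by
  rw [secFunctional, LinearMap.comp_apply, coeff_single_of_ne _ h, map_zero]

/-- The product lies over `s⁻¹t ≠ 1`, where the functional vanishes: distinct fibres are orthogonal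
for the GNS form. -/
theorem secFunctional_star_mul_of_ne {s t : G} (h : s ≠ t) (a : 𝒜.fiber s) (b : 𝒜.fiber t) :
    secFunctional φ (star (𝒜.single s a) * 𝒜.single t b) = 0 := by
  rw [𝒜.star_single rfl, 𝒜.single_mul_single rfl, secFunctional_single_of_ne]
  exact fun h' => h (inv_mul_eq_one.mp h')

/-- This is Pythagoras for the orthogonal fibres. The injective reindexing `f` lets it apply to a
section translated by a group element, as in `bounded_single`. -/
theorem secFunctional_star_mul_sum (S : Finset G) (f : G → G) (hf : Function.Injective f)
    (a : ∀ s, 𝒜.fiber (f s)) :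
    secFunctional φ (star (∑ s ∈ S, 𝒜.single (f s) (a s)) * ∑ s ∈ S, 𝒜.single (f s) (a s))
      = ∑ s ∈ S, secFunctional φ (star (𝒜.single (f s) (a s)) * 𝒜.single (f s) (a s)) := by
  rw [star_sum, Finset.sum_mul, map_sum]
  refine Finset.sum_congr rfl fun s hs => ?_
  rw [Finset.mul_sum, map_sum, Finset.sum_eq_single s]
  · intro t _ ht
    exact secFunctional_star_mul_of_ne (fun h => ht (hf h).symm) _ _
  · exact fun h => (h hs).elim

theorem secFunctional_star_mul_self (S : Finset G) (a : ∀ s, 𝒜.fiber s) :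
    secFunctional φ (star (∑ s ∈ S, 𝒜.single s (a s)) * ∑ s ∈ S, 𝒜.single s (a s))
      = ∑ s ∈ S, secFunctional φ (star (𝒜.single s (a s)) * 𝒜.single s (a s)) :=
  secFunctional_star_mul_sum S id Function.injective_id a

namespace IsPositive

/-- The positivity axiom of a Fell bundle enters here: `a* a = c* c` for some `c` in the unit fibre,
where `φ` is known to be positive. -/
theorem nonneg_single (hφ : 𝒜.IsPositive φ) {s : G} (a : 𝒜.fiber s) :
    0 ≤ secFunctional φ (star (𝒜.single s a) * 𝒜.single s a) := by
  obtain ⟨c, hc⟩ := 𝒜.adj_mul_self_nonneg rfl (inv_mul_cancel s) a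
  rw [𝒜.star_single rfl, 𝒜.single_mul_single (inv_mul_cancel s), secFunctional_single_one, hc]
  exact hφ.nonneg c

/-- For the positive contraction `h = b* b`, choose `k` in the unit fibre with `1 - h = (1 - k)²`.
Then `y* y - (by)*(by) = z* z` with `z = y - ky`, which still lies in the fibre over `s`, so
`nonneg_single` applies and no unit has to be adjoined. -/
theorem contractive_single (hφ : 𝒜.IsPositive φ) {r s : G} (b : 𝒜.fiber r) (hb : ‖b‖ ≤ 1)
    (y : 𝒜.fiber s) :
    secFunctional φ (star (𝒜.single r b * 𝒜.single s y) * (𝒜.single r b * 𝒜.single s y))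
      ≤ secFunctional φ (star (𝒜.single s y) * 𝒜.single s y) := by
  let h : 𝒜.UnitFiber := 𝒜.mul (inv_mul_cancel r) (𝒜.adj rfl b) b
  have hh : ∃ c : 𝒜.UnitFiber, h = star c * c :=
    𝒜.adj_mul_self_nonneg rfl (inv_mul_cancel r) b
  have h1 : ‖h‖ ≤ 1 :=
    (𝒜.norm_adj_mul_self rfl (inv_mul_cancel r) b).trans_le (pow_le_one₀ (norm_nonneg b) hb)
  obtain ⟨k, hk, hkh⟩ := exists_one_sub_sq h hh h1
  let ks : 𝒜.fiber 1 := k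
  set K := 𝒜.single 1 ks with hK
  set Y := 𝒜.single s y with hY
  have hKs : star K = K := (𝒜.star_single inv_one ks).trans (congrArg (𝒜.single 1) hk)
  have hBB : star (𝒜.single r b) * 𝒜.single r b = K + K - K * K := by
    rw [𝒜.star_single rfl, 𝒜.single_mul_single (inv_mul_cancel r), hK,
      𝒜.single_mul_single (one_mul 1), ← map_add, ← map_sub]
    exact congrArg (𝒜.single 1) hkh.symm
  have key := hφ.nonneg_single (y - 𝒜.mul (one_mul s) ks y)
  rw [map_sub, ← 𝒜.single_mul_single (one_mul s), ← hK, ← hY] at key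
  have e : star (Y - K * Y) * (Y - K * Y) = star Y * Y
      - star (𝒜.single r b * Y) * (𝒜.single r b * Y) := by
    rw [star_mul (𝒜.single r b), ← _root_.mul_assoc, _root_.mul_assoc (star Y), hBB, star_sub,
      star_mul, hKs]
    noncomm_ring
  rw [e, map_sub] at key
  exact sub_nonneg.mp key

/-- Left multiplication by an element over `r` moves the fibre over `s` to the one over `rs`.
Distinct components stay orthogonal, and the estimate reduces to `contractive_single` on each of
them. -/
theorem bounded_single (hφ : 𝒜.IsPositive φ) {r : G} (b : 𝒜.fiber r) (x : 𝒜.Sec) :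
    (secFunctional φ (star (𝒜.single r b * x) * (𝒜.single r b * x))).re
      ≤ (‖b‖ + 1) ^ 2 * (secFunctional φ (star x * x)).re := by
  have hpos : 0 < ‖b‖ + 1 := by positivity
  -- Scaling by `‖b‖ + 1` instead of `‖b‖` avoids a separate case `b = 0`; the exact constant is
  -- irrelevant.
  obtain ⟨b', hb', hb'1⟩ : ∃ b' : 𝒜.fiber r, b = ((‖b‖ + 1 : ℝ) : ℂ) • b' ∧ ‖b'‖ ≤ 1 := by
    refine ⟨((‖b‖ + 1 : ℝ) : ℂ)⁻¹ • b, ?_, ?_⟩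
    · rw [smul_smul, mul_inv_cancel₀ (by exact_mod_cast hpos.ne'), one_smul]
    · rw [norm_smul, norm_inv, Complex.norm_real, Real.norm_of_nonneg hpos.le,
        inv_mul_le_iff₀ hpos]
      linarith
  set C := ‖b‖ + 1 with hC
  obtain ⟨S, a, rfl⟩ := 𝒜.exists_eq_sum_single x
  rw [hb', map_smul, smul_mul_assoc, star_smul, smul_mul_smul_comm, map_smul]
  have e : (star (C : ℂ) * (C : ℂ)) = ((C ^ 2 : ℝ) : ℂ) := by
    rw [Complex.star_def, Complex.conj_ofReal, ← Complex.ofReal_mul, sq]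
  rw [e, smul_eq_mul, Complex.re_ofReal_mul]
  refine mul_le_mul_of_nonneg_left ?_ (sq_nonneg C)
  have e1 : 𝒜.single r b' * ∑ s ∈ S, 𝒜.single s (a s)
      = ∑ s ∈ S, 𝒜.single (r * s) (𝒜.mul rfl b' (a s)) := by
    rw [Finset.mul_sum]
    exact Finset.sum_congr rfl fun s _ => 𝒜.single_mul_single rfl _ _
  rw [e1, secFunctional_star_mul_sum S (r * ·) (mul_right_injective r),
    secFunctional_star_mul_self, Complex.re_sum, Complex.re_sum]
  refine Finset.sum_le_sum fun s _ => ?_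
  have := hφ.contractive_single b' hb'1 (a s)
  rw [𝒜.single_mul_single rfl] at this
  exact (Complex.le_def.mp this).1

/-- A positive functional on the unit fibre gives a bounded positive functional on `Γ_c(𝒜)`. -/
theorem isBoundedPositive (hφ : 𝒜.IsPositive φ) : IsBoundedPositive (secFunctional φ) where
  map_star x := by
    induction x using 𝒜.sec_induction with
    | h0 => simp
    | h2 x y hx hy => rw [star_add, map_add, hx, hy, map_add, star_add]
    | h1 s a =>
      rcases eq_or_ne s 1 with rfl | hs
      · rw [𝒜.star_single inv_one, secFunctional_single_one, secFunctional_single_one,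
          hφ.map_adj]
      · rw [𝒜.star_single rfl, secFunctional_single_of_ne hs,
          secFunctional_single_of_ne (inv_ne_one.mpr hs), star_zero]
  nonneg x := by
    obtain ⟨S, a, rfl⟩ := 𝒜.exists_eq_sum_single x
    rw [secFunctional_star_mul_self]
    exact Finset.sum_nonneg fun s _ => hφ.nonneg_single (a s)
  bounded b := by
    have hnn : ∀ x : 𝒜.Sec, 0 ≤ (secFunctional φ (star x * x)).re := fun x => by
      obtain ⟨S, a, rfl⟩ := 𝒜.exists_eq_sum_single x
      rw [secFunctional_star_mul_self, Complex.re_sum]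
      exact Finset.sum_nonneg fun s _ => (Complex.le_def.mp (hφ.nonneg_single (a s))).1
    induction b using 𝒜.sec_induction with
    | h0 => exact ⟨0, le_rfl, fun x => by simp⟩
    | h1 r b => exact ⟨‖b‖ + 1, by positivity, hφ.bounded_single b⟩
    | h2 b c hb hc =>
      obtain ⟨C, hC, hb⟩ := hb
      obtain ⟨D, hD, hc⟩ := hc
      refine ⟨2 * C + 2 * D, by positivity, fun x => ?_⟩
      -- The parallelogram law, with the difference term dropped by positivity, gives the bound `2C²
      -- + 2D² ≤ (2C + 2D)²`.
      have h1 := hnn (b * x - c * x)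
      have h2 : star ((b + c) * x) * ((b + c) * x)
          = (2 : ℂ) • (star (b * x) * (b * x)) + (2 : ℂ) • (star (c * x) * (c * x))
            - star (b * x - c * x) * (b * x - c * x) := by
        simp only [two_smul, _root_.add_mul, star_add, star_sub, _root_.mul_add, sub_mul, mul_sub]
        abel
      rw [h2, map_sub, map_add, map_smul, map_smul]
      have h3 := hb x
      have h4 := hc x
      have h5 := hnn x
      simp only [smul_eq_mul, Complex.sub_re, Complex.add_re, Complex.mul_re, Complex.re_ofNat,
        Complex.im_ofNat, MulZeroClass.zero_mul, sub_zero]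
      have h6 : (2 * C ^ 2 + 2 * D ^ 2) * (secFunctional φ (star x * x)).re
          ≤ (2 * C + 2 * D) ^ 2 * (secFunctional φ (star x * x)).re :=
        mul_le_mul_of_nonneg_right (by nlinarith [mul_nonneg hC hD]) h5
      linarith

end IsPositive

/-! #### The fibres of a Fell bundle are isometrically contained in its C*-algebra -/

theorem norm_env_le (K : Set 𝒜.Sec) (s : G) (a : 𝒜.fiber s) : ‖𝒜.env K s a‖ ≤ ‖a‖ := by
  rw [env_apply, CStarSeminorm.norm_ι]
  exact 𝒜.seminorm_single_le _ s a

/-- The unit fibre as a C*-subalgebra of the enveloping C*-algebra. -/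
def envUnit (K : Set 𝒜.Sec) : 𝒜.UnitFiber →⋆ₙₐ[ℂ] 𝒜.Env K where
  toFun a := 𝒜.env K 1 a
  map_smul' := (𝒜.env K 1).map_smul
  map_zero' := (𝒜.env K 1).map_zero
  map_add' := (𝒜.env K 1).map_add
  map_mul' := 𝒜.env_mul K (one_mul 1)
  map_star' := 𝒜.env_adj K inv_one

/-- The C*-identity replaces `a` by `a* a` in the unit fibre, a C*-algebra, on which an injective
`*`-homomorphism is isometric. -/
theorem norm_env_of_injective (K : Set 𝒜.Sec) (h : ∀ a, 𝒜.env K 1 a = 0 → a = 0) (s : G)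
    (a : 𝒜.fiber s) : ‖𝒜.env K s a‖ = ‖a‖ := by
  refine (sq_eq_sq₀ (norm_nonneg _) (norm_nonneg _)).mp ?_
  rw [sq, ← CStarRing.norm_star_mul_self, ← 𝒜.env_adj K rfl, ← 𝒜.env_mul K (inv_mul_cancel s),
    ← 𝒜.norm_adj_mul_self rfl (inv_mul_cancel s)]
  exact NonUnitalStarAlgHom.norm_map (envUnit K)
    ((injective_iff_map_eq_zero (envUnit K)).mpr h) _

/-- Only injectivity on the unit fibre is at stake. If `ab ≠ 0` there, some positive functional is
nonzero at `(ab)*(ab)`; extended by zero to the other fibres it has a GNS representation, which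
factors through the full C*-algebra and in which `a` moves the vector of `b` to one of nonzero norm.
-/
theorem norm_env (s : G) (a : 𝒜.fiber s) : ‖𝒜.env ∅ s a‖ = ‖a‖ := by
  refine norm_env_of_injective ∅ (fun a ha => ?_) s a
  let _ := CStarAlgebra.spectralOrder 𝒜.UnitFiber
  let _ := CStarAlgebra.spectralOrderedRing 𝒜.UnitFiber
  refine eq_zero_of_forall_mul_eq_zero (A := 𝒜.UnitFiber) fun b => ?_
  by_contra hne
  let a' : 𝒜.UnitFiber := a
  let b' : 𝒜.fiber 1 := b
  obtain ⟨f, hf⟩ := exists_positive_functional (star_mul_self_nonneg (a' * b))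
    (fun h => hne ((CStarRing.star_mul_self_eq_zero_iff _).mp h))
  apply hf
  let φ : 𝒜.fiber 1 →ₗ[ℂ] ℂ := f.toLinearMap
  have hφ : 𝒜.IsPositive φ :=
    { map_adj := fun c => map_star f (show 𝒜.UnitFiber from c)
      nonneg := fun c => f.map_nonneg (star_mul_self_nonneg (show 𝒜.UnitFiber from c)) }
  let hΦ := hφ.isBoundedPositive
  have h1 : 𝒜.envLift hΦ.rep (fun _ hk => hk.elim) (𝒜.env ∅ 1 a) = 0 := by rw [ha, map_zero]
  rw [env_apply, envLift_ι] at h1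
  have h2 := hΦ.inner_vec (𝒜.single 1 a * 𝒜.single 1 b') (𝒜.single 1 a * 𝒜.single 1 b')
  rw [← hΦ.rep_vec, h1, zero_apply, inner_zero_left, 𝒜.single_mul_single (one_mul 1),
    𝒜.star_single inv_one, 𝒜.single_mul_single (one_mul 1), secFunctional_single_one] at h2
  exact h2.symm

end FellBundle

/-! ### Representations of the group C*-algebra -/

section GroupAlgebra

variable (Q : Type u) [Group Q]

/-- The identity functional on the unit fibre of the trivial bundle. -/
def trivialFunctional : (FellBundle.trivial Q).fiber 1 →ₗ[ℂ] ℂ := (LinearMap.id : ℂ →ₗ[ℂ] ℂ)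

theorem isPositive_trivial : (FellBundle.trivial Q).IsPositive (trivialFunctional Q) where
  map_adj _ := rfl
  nonneg a := star_mul_self_nonneg (show ℂ from a)

/-- The regular representation of `C*(Q)`. -/
def regularRep : GroupCStar Q →⋆ₙₐ[ℂ]
    ((isPositive_trivial Q).isBoundedPositive.Space →L[ℂ]
      (isPositive_trivial Q).isBoundedPositive.Space) :=
  (FellBundle.trivial Q).envLift (isPositive_trivial Q).isBoundedPositive.rep
    (fun _ hk => hk.elim)

variable {Q}

/-- The group element `x` in the group algebra. -/
def groupSingle (x : Q) : (FellBundle.trivial Q).Sec := (FellBundle.trivial Q).single x (1 : ℂ)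

theorem groupSingle_mul_single (x y : Q) (a : (FellBundle.trivial Q).fiber y) :
    groupSingle x * (FellBundle.trivial Q).single y a
      = (FellBundle.trivial Q).single (x * y) (show ℂ from a) :=
  ((FellBundle.trivial Q).single_mul_single rfl _ _).trans
    (congrArg ((FellBundle.trivial Q).single (x * y)) (one_mul (show ℂ from a)))

/-- The canonical basis vectors of the space of the regular representation. -/
def regularVec (x : Q) : (isPositive_trivial Q).isBoundedPositive.Space :=
  (isPositive_trivial Q).isBoundedPositive.vec (groupSingle x)

theorem regularRep_groupElt (x : Q) : regularRep Q (groupElt x)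
    = (isPositive_trivial Q).isBoundedPositive.rep (groupSingle x) :=
  (FellBundle.trivial Q).envLift_ι _ _ _

theorem regularRep_regularVec (y : Q) :
    regularRep Q (groupElt y) (regularVec 1) = regularVec y := by
  rw [regularRep_groupElt, regularVec, regularVec, IsBoundedPositive.rep_vec]
  refine congrArg _ ((groupSingle_mul_single y 1 _).trans ?_)
  rw [mul_one]
  rfl

theorem star_groupSingle_mul_self (x : Q) :
    star (groupSingle x) * groupSingle x = groupSingle 1 := by
  have h : star (groupSingle x) = groupSingle x⁻¹ :=
    ((FellBundle.trivial Q).star_single rfl _).trans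
      (congrArg ((FellBundle.trivial Q).single x⁻¹) (star_one ℂ))
  rw [h]
  refine (groupSingle_mul_single x⁻¹ x _).trans ?_
  rw [inv_mul_cancel]
  rfl

theorem inner_regularVec_self (x : Q) : inner ℂ (regularVec x) (regularVec x) = (1 : ℂ) := by
  rw [regularVec, IsBoundedPositive.inner_vec, star_groupSingle_mul_self]
  exact FellBundle.secFunctional_single_one _

theorem inner_regularVec_of_ne {x y : Q} (h : x ≠ y) :
    inner ℂ (regularVec x) (regularVec y) = (0 : ℂ) := by
  rw [regularVec, regularVec, IsBoundedPositive.inner_vec]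
  exact FellBundle.secFunctional_star_mul_of_ne h _ _

/-- The representation of `ℂ` by scalar operators. -/
def scalarRep (K : Type w) [NormedAddCommGroup K] [InnerProductSpace ℂ K] [CompleteSpace K] :
    ℂ →⋆ₙₐ[ℂ] (K →L[ℂ] K) where
  toFun z := z • 1
  map_smul' z w := by rw [smul_eq_mul, mul_smul]; rfl
  map_zero' := zero_smul _ _
  map_add' z w := add_smul _ _ _
  map_mul' z w := by rw [smul_mul_smul_comm, one_mul]
  map_star' z := by rw [star_smul, star_one]

/-- The trivial character of `C*(Q)`. -/
def augmentation (Q : Type u) [Group Q] : GroupCStar Q →⋆ₙₐ[ℂ] ℂ :=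
  (FellBundle.trivial Q).envLift
    ((FellBundle.trivial Q).secHom (fun _ => LinearMap.id) (fun _ _ _ _ => rfl) (fun _ _ => rfl))
    (fun _ hk => hk.elim)

theorem augmentation_groupElt (x : Q) : augmentation Q (groupElt x) = 1 :=
  ((FellBundle.trivial Q).envLift_ι _ _ _).trans ((FellBundle.trivial Q).secHom_single _ _ _ x _)

/-- `C*(Q)` is built as a nonunital algebra, so its left unit is identified by density;
nondegeneracy of coactions uses it. -/
theorem groupElt_one_mul (c : GroupCStar Q) : groupElt 1 * c = c := by
  have h : ∀ x : (FellBundle.trivial Q).Sec, groupSingle 1 * x = x := fun x => by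
    induction x using (FellBundle.trivial Q).sec_induction with
    | h0 => rw [mul_zero]
    | h2 x y hx hy => rw [mul_add, hx, hy]
    | h1 s a =>
      rw [groupSingle_mul_single, one_mul]
  refine CStarSeminorm.ind _ (isClosed_eq (continuous_const.mul continuous_id) continuous_id)
    (fun x => ?_) c
  exact (CStarSeminorm.compl_mul _ _ _).trans (congrArg _ (h x))

end GroupAlgebra

/-! ### Fourier coefficients on `A ⊗ C*(Q)` -/

section SliceGroup

variable {A : Type u} [NonUnitalCStarAlgebra A] {Q : Type u} [Group Q]

/-- The Fourier coefficient `a ⊗ y ↦ δ_{x,y} a` of an element of `A ⊗ C*(Q)`. -/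
def fourierCoeff (x : Q) : SpatialTensor A (GroupCStar Q) →L[ℂ] A :=
  slice (regularRep Q) (regularVec x) (regularVec 1)

theorem fourierCoeff_tmul_self (x : Q) (a : A) :
    fourierCoeff x (SpatialTensor.tmul a (groupElt x)) = a := by
  rw [fourierCoeff, slice_tmul, regularRep_regularVec, inner_regularVec_self, one_smul]

theorem fourierCoeff_tmul_of_ne {x y : Q} (h : x ≠ y) (a : A) :
    fourierCoeff x (SpatialTensor.tmul a (groupElt y)) = 0 := by
  rw [fourierCoeff, slice_tmul, regularRep_regularVec, inner_regularVec_of_ne h, zero_smul]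

/-- The slice map `a ⊗ y ↦ a` given by the trivial character of `Q`. -/
def trivialSlice : SpatialTensor A (GroupCStar Q) →L[ℂ] A :=
  -- The one-dimensional Hilbert space is taken in the universe of `A`, as `slice` requires.
  slice ((scalarRep (EuclideanSpace ℂ PUnit.{u + 1})).comp (augmentation Q))
    (EuclideanSpace.single PUnit.unit 1) (EuclideanSpace.single PUnit.unit 1)

theorem trivialSlice_tmul (y : Q) (a : A) :
    trivialSlice (SpatialTensor.tmul a (groupElt y)) = a := by
  rw [trivialSlice, slice_tmul, NonUnitalStarAlgHom.comp_apply, augmentation_groupElt]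
  show (inner ℂ (EuclideanSpace.single PUnit.unit (1 : ℂ))
    ((1 : ℂ) • (1 : EuclideanSpace ℂ PUnit.{u + 1} →L[ℂ] EuclideanSpace ℂ PUnit.{u + 1})
      (EuclideanSpace.single PUnit.unit (1 : ℂ))) : ℂ) • a = a
  simp

end SliceGroup

/-! ### Continuity and density -/

section Density

/-- A `*`-homomorphism of C*-algebras as a continuous linear map. -/
def homL {A : Type u} {E : Type w} [NonUnitalCStarAlgebra A] [NonUnitalCStarAlgebra E]
    (f : A →⋆ₙₐ[ℂ] E) : A →L[ℂ] E :=
  LinearMap.mkContinuous (f : A →ₗ[ℂ] E) 1 fun a => by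
    rw [one_mul]; exact NonUnitalStarAlgHom.norm_apply_le f a

variable {A C : Type u} [NonUnitalCStarAlgebra A] [NonUnitalCStarAlgebra C]

/-- `a ↦ a ⊗ c` as a continuous linear map. -/
def tmulRightL (c : C) : A →L[ℂ] SpatialTensor A C :=
  LinearMap.mkContinuous (SpatialTensor.tmulRight c) ‖c‖ fun a => by
    rw [mul_comm]; exact SpatialTensor.norm_tmul_le a c

theorem SpatialTensor.mem_of_isClosed {M : Submodule ℂ (SpatialTensor A C)}
    (hM : IsClosed (M : Set (SpatialTensor A C))) (h : ∀ a c, SpatialTensor.tmul a c ∈ M)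
    (x : SpatialTensor A C) : x ∈ M := by
  refine (spatialNorm A C).ι_dense.induction_on x hM fun y => ?_
  induction y with
  | zero => rw [map_zero]; exact M.zero_mem
  | add y z hy hz => rw [map_add]; exact M.add_mem hy hz
  | tmul a c => exact h a c

theorem SpatialTensor.clm_ext {E : Type w} [NormedAddCommGroup E] [NormedSpace ℂ E]
    {f g : SpatialTensor A C →L[ℂ] E}
    (h : ∀ a c, f (SpatialTensor.tmul a c) = g (SpatialTensor.tmul a c)) : f = g := by
  ext x
  exact SpatialTensor.mem_of_isClosed (M := LinearMap.eqLocus f.toLinearMap g.toLinearMap)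
    (isClosed_eq f.continuous g.continuous) h x

namespace FellBundle

variable {G : Type u} [Group G] (𝒜 : FellBundle.{u, v} G)

theorem env_mem_of_isClosed {K : Set 𝒜.Sec} {M : Submodule ℂ (𝒜.Env K)}
    (hM : IsClosed (M : Set (𝒜.Env K))) (h : ∀ s a, 𝒜.env K s a ∈ M) (x : 𝒜.Env K) : x ∈ M := by
  refine (𝒜.maxSeminorm K).ι_dense.induction_on x hM fun y => ?_
  induction y using 𝒜.sec_induction with
  | h0 => rw [map_zero]; exact M.zero_mem
  | h2 y z hy hz => rw [map_add]; exact M.add_mem hy hz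
  | h1 s a => exact h s a

theorem env_clm_ext {K : Set 𝒜.Sec} {E : Type w} [NormedAddCommGroup E] [NormedSpace ℂ E]
    {f g : 𝒜.Env K →L[ℂ] E} (h : ∀ s a, f (𝒜.env K s a) = g (𝒜.env K s a)) : f = g := by
  ext x
  exact 𝒜.env_mem_of_isClosed (M := LinearMap.eqLocus f.toLinearMap g.toLinearMap)
    (isClosed_eq f.continuous g.continuous) h x

end FellBundle

end Density

/-! ### Spectral subspaces -/

section Spectral

variable {Q : Type u} [Group Q] {D : Type u} [NonUnitalCStarAlgebra D]
  (δ : D →⋆ₙₐ[ℂ] SpatialTensor D (GroupCStar Q))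

/-- Closed subspaces of the spectral subspaces that together span a dense subspace are equal to
the spectral subspaces. -/
theorem spectralSubspace_eq (F : Q → Submodule ℂ D) (hc : ∀ x, IsClosed (F x : Set D))
    (hd : ∀ M : Submodule ℂ D, IsClosed (M : Set D) → (∀ x, F x ≤ M) → ∀ d, d ∈ M)
    (hF : ∀ x, F x ≤ spectralSubspace δ x) (x : Q) : spectralSubspace δ x = F x := by
  -- `E` fixes the spectral subspace at `x` and kills those at other points. Hence it maps every `F
  -- y` into `F x`, and by density all of `D`; a spectral element at `x` is its own image.
  let E : D →L[ℂ] D := (fourierCoeff x).comp (homL δ)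
  have hE : ∀ y, ∀ d ∈ spectralSubspace δ y,
      E d = fourierCoeff x (SpatialTensor.tmul d (groupElt y)) := fun y d hd =>
    congrArg (fourierCoeff x) hd
  refine le_antisymm (fun d hdx => ?_) (hF x)
  have h : d ∈ (F x).comap E.toLinearMap := by
    refine hd _ ((hc x).preimage E.continuous) (fun y a ha => ?_) d
    show E a ∈ F x
    rw [hE y a (hF y ha)]
    rcases eq_or_ne x y with rfl | hxy
    · rwa [fourierCoeff_tmul_self]
    · rw [fourierCoeff_tmul_of_ne hxy]
      exact (F x).zero_mem
  have h' : E d ∈ F x := h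
  rwa [hE x d hdx, fourierCoeff_tmul_self] at h'

variable {δ}

/-- A Fell bundle that is isometrically and densely embedded in `D`, with its fibres contained in
the spectral subspaces, is isomorphic to the Fell bundle associated to the coaction. -/
def isoAssociatedBundle (ℬ : FellBundle.{u, v} Q) (j : ∀ x, ℬ.fiber x →ₗᵢ[ℂ] D)
    (hmul : ∀ {x y z : Q} (h : x * y = z) (a : ℬ.fiber x) (b : ℬ.fiber y),
      j z (ℬ.mul h a b) = j x a * j y b)
    (hadj : ∀ {x y : Q} (h : x⁻¹ = y) (a : ℬ.fiber x), j y (ℬ.adj h a) = star (j x a))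
    (hd : ∀ M : Submodule ℂ D, IsClosed (M : Set D) → (∀ x a, j x a ∈ M) → ∀ d, d ∈ M)
    (hδ : ∀ x a, δ (j x a) = SpatialTensor.tmul (j x a) (groupElt x)) :
    FellBundle.Iso ℬ (associatedBundle δ) :=
  -- The isometric images of the complete fibres are closed, as `spectralSubspace_eq` demands.
  have key : ∀ x, LinearMap.range (j x).toLinearMap = spectralSubspace δ x := fun x =>
    (spectralSubspace_eq δ (fun x => LinearMap.range (j x).toLinearMap)
      (fun x => (j x).isometry.isClosedEmbedding.isClosed_range)
      (fun M hM h d => hd M hM (fun x a => h x ⟨a, rfl⟩) d)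
      (fun x => by rintro _ ⟨a, rfl⟩; exact hδ x a) x).symm
  { equiv := fun x => (j x).equivRange.trans (LinearIsometryEquiv.ofEq _ _ (key x))
    map_mul := fun h a b => Subtype.ext (hmul h a b)
    map_adj := fun h a => Subtype.ext (hadj h a) }

/-- A Fell bundle over a discrete group is isomorphic to the bundle of spectral subspaces of its
dual coaction. -/
def isoSpectral (𝒜 : FellBundle.{u, u} Q) :
    FellBundle.Iso 𝒜 (associatedBundle (dualCoaction 𝒜)) :=
  isoAssociatedBundle 𝒜 (fun x => ⟨𝒜.env ∅ x, 𝒜.norm_env x⟩) (𝒜.env_mul ∅) (𝒜.env_adj ∅)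
    (fun _ hM h d => 𝒜.env_mem_of_isClosed hM h d) (dualCoaction_env 𝒜)

end Spectral

/-! ### Isomorphisms of Fell bundles and of coactions -/

section Isomorphisms

variable {G : Type u} [Group G]

namespace FellBundle.Iso

variable {𝒜 : FellBundle.{u, u} G} {ℬ : FellBundle.{u, u} G} {𝒞 : FellBundle.{u, u} G}

/-- The inverse of an isomorphism of Fell bundles. -/
def symm (θ : Iso 𝒜 ℬ) : Iso ℬ 𝒜 where
  equiv s := (θ.equiv s).symm
  map_mul {r s t} h a b := (θ.equiv t).injective (by
    rw [θ.map_mul, LinearIsometryEquiv.apply_symm_apply, LinearIsometryEquiv.apply_symm_apply,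
      LinearIsometryEquiv.apply_symm_apply])
  map_adj {s t} h a := (θ.equiv t).injective (by
    rw [θ.map_adj, LinearIsometryEquiv.apply_symm_apply, LinearIsometryEquiv.apply_symm_apply])

/-- The composition of isomorphisms of Fell bundles. -/
def trans (θ : Iso 𝒜 ℬ) (η : Iso ℬ 𝒞) : Iso 𝒜 𝒞 where
  equiv s := (θ.equiv s).trans (η.equiv s)
  map_mul h a b := (congrArg _ (θ.map_mul h a b)).trans (η.map_mul h _ _)
  map_adj h a := (congrArg _ (θ.map_adj h a)).trans (η.map_adj h _)

/-- The pull-back of an isomorphism of Fell bundles. -/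
def pullback (N : Subgroup G) [N.Normal] {𝒟 ℰ : FellBundle.{u, u} (G ⧸ N)} (θ : Iso 𝒟 ℰ) :
    Iso (𝒟.pullback N) (ℰ.pullback N) where
  equiv s := θ.equiv (s : G ⧸ N)
  map_mul _ := θ.map_mul _
  map_adj _ := θ.map_adj _

/-- The homomorphism of full cross sectional algebras given by an isomorphism of bundles. -/
def hom (θ : Iso 𝒜 ℬ) : 𝒜.FullCStar →⋆ₙₐ[ℂ] ℬ.FullCStar :=
  𝒜.envLift (𝒜.secHom (fun s => ℬ.env ∅ s ∘ₗ (θ.equiv s).toLinearEquiv.toLinearMap)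
    (fun r s a b => by
      show ℬ.env ∅ (r * s) (θ.equiv (r * s) (𝒜.mul rfl a b)) = _
      rw [θ.map_mul, ℬ.env_mul]
      rfl)
    (fun s a => by
      show ℬ.env ∅ s⁻¹ (θ.equiv s⁻¹ (𝒜.adj rfl a)) = _
      rw [θ.map_adj, ℬ.env_adj]
      rfl)) (fun _ hk => hk.elim)

theorem hom_env (θ : Iso 𝒜 ℬ) (s : G) (a : 𝒜.fiber s) :
    θ.hom (𝒜.env ∅ s a) = ℬ.env ∅ s (θ.equiv s a) :=
  (𝒜.envLift_ι _ _ _).trans (𝒜.secHom_single _ _ _ s a)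

theorem hom_symm_hom (θ : Iso 𝒜 ℬ) (x : 𝒜.FullCStar) : θ.symm.hom (θ.hom x) = x := by
  refine congrArg (fun f => f x) (𝒜.env_clm_ext (f := (homL θ.symm.hom).comp (homL θ.hom))
    (g := ContinuousLinearMap.id ℂ _) fun s a => ?_)
  show θ.symm.hom (θ.hom (𝒜.env ∅ s a)) = 𝒜.env ∅ s a
  rw [hom_env, hom_env]
  exact congrArg _ ((θ.equiv s).symm_apply_apply a)

/-- The isomorphism of full cross sectional algebras given by an isomorphism of bundles. -/
def starAlgEquiv (θ : Iso 𝒜 ℬ) : 𝒜.FullCStar ≃⋆ₐ[ℂ] ℬ.FullCStar where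
  toFun := θ.hom
  invFun := θ.symm.hom
  left_inv := θ.hom_symm_hom
  right_inv := θ.symm.hom_symm_hom
  map_mul' := _root_.map_mul θ.hom
  map_add' := map_add θ.hom
  map_smul' := map_smul θ.hom
  map_star' := map_star θ.hom

/-- Isomorphic Fell bundles have isomorphic dual coactions. -/
theorem coactionsIsomorphic (θ : Iso 𝒜 ℬ) :
    CoactionsIsomorphic (dualCoaction 𝒜) (dualCoaction ℬ) := by
  have h : (homL (dualCoaction ℬ)).comp (homL θ.hom)
      = (homL (SpatialTensor.map θ.hom (NonUnitalStarAlgHom.id ℂ (GroupCStar G)))).comp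
        (homL (dualCoaction 𝒜)) := 𝒜.env_clm_ext fun s a => by
    show dualCoaction ℬ (θ.hom (𝒜.env ∅ s a)) = SpatialTensor.map _ _ (dualCoaction 𝒜 _)
    rw [dualCoaction_env, SpatialTensor.map_tmul, hom_env, dualCoaction_env]
    rfl
  exact ⟨θ.starAlgEquiv, fun x => congrArg (fun f => f x) h⟩

end FellBundle.Iso

theorem SpatialTensor.map_symm_map {A A' C : Type u} [NonUnitalCStarAlgebra A]
    [NonUnitalCStarAlgebra A'] [NonUnitalCStarAlgebra C] (φ : A ≃⋆ₐ[ℂ] A')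
    (x : SpatialTensor A C) :
    SpatialTensor.map (φ.symm : A' →⋆ₙₐ[ℂ] A) (NonUnitalStarAlgHom.id ℂ C)
      (SpatialTensor.map (φ : A →⋆ₙₐ[ℂ] A') (NonUnitalStarAlgHom.id ℂ C) x) = x := by
  refine congrArg (fun f => f x) (SpatialTensor.clm_ext
    (f := (homL (SpatialTensor.map (φ.symm : A' →⋆ₙₐ[ℂ] A) (NonUnitalStarAlgHom.id ℂ C))).comp
      (homL (SpatialTensor.map (φ : A →⋆ₙₐ[ℂ] A') (NonUnitalStarAlgHom.id ℂ C))))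
    (g := ContinuousLinearMap.id ℂ _) fun a c => ?_)
  show SpatialTensor.map _ _ (SpatialTensor.map _ _ (SpatialTensor.tmul a c)) = _
  rw [SpatialTensor.map_tmul, SpatialTensor.map_tmul]
  exact congrArg (fun z => SpatialTensor.tmul z c) (φ.symm_apply_apply a)

variable {A A' : Type u} [NonUnitalCStarAlgebra A] [NonUnitalCStarAlgebra A']

theorem norm_starAlgEquiv_apply (φ : A ≃⋆ₐ[ℂ] A') (a : A) : ‖φ a‖ = ‖a‖ :=
  NonUnitalStarAlgHom.norm_map φ φ.injective a

/-- Isomorphic coactions have isomorphic associated bundles. -/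
theorem CoactionsIsomorphic.nonempty_iso {δ : A →⋆ₙₐ[ℂ] SpatialTensor A (GroupCStar G)}
    {δ' : A' →⋆ₙₐ[ℂ] SpatialTensor A' (GroupCStar G)} (h : CoactionsIsomorphic δ δ') :
    Nonempty (FellBundle.Iso (associatedBundle δ) (associatedBundle δ')) := by
  obtain ⟨φ, hφ⟩ := h
  have h1 : ∀ s, ∀ a ∈ spectralSubspace δ s, φ a ∈ spectralSubspace δ' s := fun s a ha => by
    rw [mem_spectralSubspace] at ha ⊢
    rw [hφ, ha, SpatialTensor.map_tmul]
    rfl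
  -- Equivariance is given for `φ` only; applying `φ⁻¹ ⊗ id` to it yields the inclusion for `φ⁻¹`.
  have h2 : ∀ s, ∀ a ∈ spectralSubspace δ' s, φ.symm a ∈ spectralSubspace δ s := fun s a ha => by
    rw [mem_spectralSubspace] at ha ⊢
    have h3 := hφ (φ.symm a)
    rw [φ.apply_symm_apply, ha] at h3
    rw [← SpatialTensor.map_symm_map φ (δ (φ.symm a)), ← h3, SpatialTensor.map_tmul]
    rfl
  exact ⟨
    { equiv := fun s =>
        { toFun := fun a => ⟨φ a.1, h1 s a.1 a.2⟩
          invFun := fun a => ⟨φ.symm a.1, h2 s a.1 a.2⟩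
          left_inv := fun a => Subtype.ext (φ.symm_apply_apply a.1)
          right_inv := fun a => Subtype.ext (φ.apply_symm_apply a.1)
          map_add' := fun a b => Subtype.ext (map_add φ a.1 b.1)
          map_smul' := fun z a => Subtype.ext (map_smul φ z a.1)
          norm_map' := fun a => norm_starAlgEquiv_apply φ a.1 }
      map_mul := fun _ a b => Subtype.ext (map_mul φ a.1 b.1)
      map_adj := fun _ a => Subtype.ext (map_star φ a.1) }⟩

end Isomorphisms

/-! ### Quotients of crossed products carry coactions -/

section Graded

variable {ι : Type v} {Q : Type u} [Group Q] {D : Type u} [NonUnitalCStarAlgebra D]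

/-- A family of elements of `D` whose closed linear span is `D`. -/
def IsTotal (j : ι → D) : Prop :=
  ∀ M : Submodule ℂ D, IsClosed (M : Set D) → (∀ i, j i ∈ M) → ∀ d, d ∈ M

variable {j : ι → D} {g : ι → Q}
  {δ : D →⋆ₙₐ[ℂ] SpatialTensor D (GroupCStar Q)}

theorem IsTotal.clm_ext (hj : IsTotal j) {E : Type w} [NormedAddCommGroup E] [NormedSpace ℂ E]
    {f f' : D →L[ℂ] E} (h : ∀ i, f (j i) = f' (j i)) (d : D) : f d = f' d :=
  hj (LinearMap.eqLocus f.toLinearMap f'.toLinearMap) (isClosed_eq f.continuous f'.continuous) h d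

/-- Applying the trivial character of `Q` to the second leg is a left inverse of `δ`, as one sees on
the homogeneous elements. -/
theorem IsTotal.injective (hj : IsTotal j)
    (hδ : ∀ i, δ (j i) = SpatialTensor.tmul (j i) (groupElt (g i))) : Function.Injective δ :=
  Function.LeftInverse.injective (g := trivialSlice) fun d =>
    hj.clm_ext (f := trivialSlice.comp (homL δ)) (f' := ContinuousLinearMap.id ℂ D) (fun i => by
      show trivialSlice (δ _) = _
      rw [hδ, trivialSlice_tmul]
      rfl) d

/-- If `e` has degree `1`, then `δ(e)(j_i ⊗ c) = e j_i ⊗ c`. When the products `e j_i` approximate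
`j_i`, the elementary tensors `j_i ⊗ c` lie in the closed span, and totality gives the rest. -/
theorem IsTotal.nondegenerate (hj : IsTotal j)
    (h : ∀ i, j i ∈ closure {x : D | ∃ e, δ e = SpatialTensor.tmul e (groupElt 1) ∧
      x = e * j i}) :
    (Submodule.span ℂ {x : SpatialTensor D (GroupCStar Q) |
      ∃ (a : D) (y : SpatialTensor D (GroupCStar Q)), x = δ a * y}).topologicalClosure = ⊤ := by
  set M := (Submodule.span ℂ {x : SpatialTensor D (GroupCStar Q) |
    ∃ (a : D) (y : SpatialTensor D (GroupCStar Q)), x = δ a * y}).topologicalClosure with hM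
  have hc : IsClosed (M : Set (SpatialTensor D (GroupCStar Q))) :=
    Submodule.isClosed_topologicalClosure _
  refine eq_top_iff.mpr fun z _ => SpatialTensor.mem_of_isClosed hc (fun a c => ?_) z
  have hc' : IsClosed (M.comap (tmulRightL (A := D) c).toLinearMap : Set D) :=
    hc.preimage (tmulRightL (A := D) c).continuous
  refine hj _ hc' (fun i => closure_minimal ?_ hc' (h i)) a
  rintro _ ⟨e, he, rfl⟩
  refine Submodule.le_topologicalClosure _ (Submodule.subset_span
    ⟨e, SpatialTensor.tmul (j i) c, ?_⟩)
  rw [he, SpatialTensor.tmul_mul, groupElt_one_mul]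
  rfl

/-- `AssocEq` is membership in the closed span of a set of pairs; by continuity and linearity such a
statement need only be checked on a total family. -/
theorem IsTotal.prod_mem_closure_span (hj : IsTotal j) {E₁ E₂ : Type w}
    [NonUnitalCStarAlgebra E₁] [NonUnitalCStarAlgebra E₂] (L₁ : D →⋆ₙₐ[ℂ] E₁)
    (L₂ : D →⋆ₙₐ[ℂ] E₂) {S : Set (E₁ × E₂)} (hS : ∀ i, (L₁ (j i), L₂ (j i)) ∈ S) (d : D) :
    (L₁ d, L₂ d) ∈ (Submodule.span ℂ S).topologicalClosure :=
  hj ((Submodule.span ℂ S).topologicalClosure.comap ((homL L₁).prod (homL L₂)).toLinearMap)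
    ((Submodule.span ℂ S).isClosed_topologicalClosure.preimage
      ((homL L₁).prod (homL L₂)).continuous)
    (fun i => Submodule.le_topologicalClosure _ (Submodule.subset_span (hS i))) d

/-- For `d` homogeneous of degree `x` the two sides are `(d ⊗ x) ⊗ x` and `d ⊗ (x ⊗ x)`, one of the
pairs generating the graph of the associativity isomorphism. -/
theorem IsTotal.coassoc (hj : IsTotal j)
    (hδ : ∀ i, δ (j i) = SpatialTensor.tmul (j i) (groupElt (g i))) (d : D) :
    SpatialTensor.AssocEq
      (SpatialTensor.map δ (NonUnitalStarAlgHom.id ℂ (GroupCStar Q)) (δ d))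
      (SpatialTensor.map (NonUnitalStarAlgHom.id ℂ D) (comult Q) (δ d)) := by
  refine hj.prod_mem_closure_span
    (E₁ := SpatialTensor (SpatialTensor D (GroupCStar Q)) (GroupCStar Q))
    (E₂ := SpatialTensor D (SpatialTensor (GroupCStar Q) (GroupCStar Q)))
    ((SpatialTensor.map δ (NonUnitalStarAlgHom.id ℂ (GroupCStar Q))).comp δ)
    ((SpatialTensor.map (NonUnitalStarAlgHom.id ℂ D) (comult Q)).comp δ) (fun i => ?_) d
  refine ⟨j i, groupElt (g i), groupElt (g i), ?_⟩
  rw [NonUnitalStarAlgHom.comp_apply, NonUnitalStarAlgHom.comp_apply, hδ,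
    SpatialTensor.map_tmul, SpatialTensor.map_tmul, hδ, comult_groupElt]
  rfl

end Graded

/-! ### Graded coactions on quotients of a crossed product -/

section CrossedProductCoaction

variable {G Q : Type u} [Group G] [Group Q] {B : Type u} [NonUnitalCStarAlgebra B]
  {α : G →* (B ≃⋆ₐ[ℂ] B)} {K : Set (semidirect α).Sec}

/-- The element `(b, s)` of a quotient of the crossed product. -/
def crossedElt (K : Set (semidirect α).Sec) (s : G) : B →ₗ[ℂ] (semidirect α).Env K :=
  (semidirect α).env K s

theorem crossedElt_mul (s t : G) (b c : B) :
    crossedElt K s b * crossedElt K t c = crossedElt K (s * t) (b * α s c) :=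
  ((semidirect α).env_mul K rfl b c).symm

theorem crossedElt_one_mul (s : G) (e b : B) :
    crossedElt K 1 e * crossedElt K s b = crossedElt K s (e * b) := by
  rw [crossedElt_mul, one_mul, map_one, StarAlgEquiv.one_apply]

theorem continuous_crossedElt (s : G) : Continuous (crossedElt K s) :=
  AddMonoidHomClass.continuous_of_bound _ 1 fun a => by
    rw [one_mul]; exact FellBundle.norm_env_le K s a

theorem isTotal_crossedElt :
    IsTotal (fun p : G × B => crossedElt K p.1 p.2) := fun _ hM h d =>
  (semidirect α).env_mem_of_isClosed hM (fun s b => h (s, b)) d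

/-- An approximate unit of `B`, placed in the unit fibre, acts as one on every fibre because `(e,
1)(b, s) = (eb, s)`. -/
theorem crossedElt_mem_closure (s : G) (b : B) :
    crossedElt K s b ∈ closure {x | ∃ e, x = crossedElt K 1 e * crossedElt K s b} := by
  let _ := CStarAlgebra.spectralOrder B
  let _ := CStarAlgebra.spectralOrderedRing B
  have ht : Filter.Tendsto (fun e : B => e * b) (CStarAlgebra.approximateUnit B) (nhds b) :=
    (CStarAlgebra.increasingApproximateUnit B).tendsto_mul_right b
  have : (CStarAlgebra.approximateUnit B).NeBot :=
    (CStarAlgebra.increasingApproximateUnit B).neBot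
  exact mem_closure_of_tendsto (((continuous_crossedElt s).tendsto b).comp ht)
    (Filter.Eventually.of_forall fun e => ⟨e, (crossedElt_one_mul s e b).symm⟩)

/-- One argument serves both dual coactions: that of `G` on the crossed product, with no relations
and `f` the identity, and that of `G/N` on the twisted crossed product, with `f` the quotient map.
-/
theorem isCoaction_of_graded (f : G →* Q)
    {δ : (semidirect α).Env K →⋆ₙₐ[ℂ] SpatialTensor ((semidirect α).Env K) (GroupCStar Q)}
    (hδ : ∀ s b, δ (crossedElt K s b)
      = SpatialTensor.tmul (crossedElt K s b) (groupElt (f s))) : IsCoaction δ := by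
  have h1 : ∀ e, δ (crossedElt K 1 e) = SpatialTensor.tmul (crossedElt K 1 e) (groupElt 1) :=
    fun e => (hδ 1 e).trans (congrArg _ (congrArg groupElt (map_one f)))
  have h : ∀ p : G × B, crossedElt K p.1 p.2 ∈ closure {x : (semidirect α).Env K | ∃ e,
      δ e = SpatialTensor.tmul e (groupElt 1) ∧ x = e * crossedElt K p.1 p.2} := fun p =>
    closure_mono (by rintro _ ⟨e, rfl⟩; exact ⟨crossedElt K 1 e, h1 e, rfl⟩)
      (crossedElt_mem_closure p.1 p.2)
  have h0 : IsTotal (fun p : G × B => crossedElt K p.1 p.2) := isTotal_crossedElt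
  have h2 : ∀ p : G × B, δ ((fun p : G × B => crossedElt K p.1 p.2) p)
      = SpatialTensor.tmul ((fun p : G × B => crossedElt K p.1 p.2) p)
        (groupElt ((fun p : G × B => f p.1) p)) := fun p => hδ p.1 p.2
  exact ⟨h0.injective h2, h0.nondegenerate h, h0.coassoc h2⟩

theorem isCoaction_dualCoactionOfAction (α : G →* (B ≃⋆ₐ[ℂ] B)) :
    IsCoaction (dualCoactionOfAction α) :=
  isCoaction_of_graded (MonoidHom.id G) (dualCoaction_env (semidirect α))

end CrossedProductCoaction

/-! ### Twisted actions -/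

namespace GreenTwist

variable {G : Type u} [Group G] {B : Type u} [NonUnitalCStarAlgebra B]
  {α : G →* (B ≃⋆ₐ[ℂ] B)} {N : Subgroup G} [hN : N.Normal] (T : GreenTwist α N)

/-- The isometry `b ↦ [b, s]` of `B` onto the fibre over `sN`. -/
def orbitIsometry (s : G) : B ≃ₗᵢ[ℂ] T.Fiber (s : G ⧸ N) where
  toFun b := T.orbit b s rfl
  invFun := (T.fiberEquiv s rfl).symm
  left_inv := (T.fiberEquiv s rfl).left_inv
  right_inv := (T.fiberEquiv s rfl).right_inv
  map_add' b c := T.orbit_add b c s rfl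
  map_smul' z b := T.orbit_smul z b s rfl
  norm_map' b := T.norm_orbit b s rfl

/-- The semidirect product bundle of a twisted action is a pull-back. -/
def isoPullback : FellBundle.Iso (semidirect α) (FellBundle.pullback N T.bundle) where
  equiv s := T.orbitIsometry s
  map_mul h _ _ := T.orbit_congr rfl h.symm
  map_adj h _ := T.orbit_congr rfl h.symm

theorem env_orbit_mul (s t : G) (b c : B) :
    T.bundle.env ∅ ((s * t : G) : G ⧸ N) (T.orbit (b * α s c) (s * t) rfl)
      = T.bundle.env ∅ (s : G ⧸ N) (T.orbit b s rfl)
        * T.bundle.env ∅ (t : G ⧸ N) (T.orbit c t rfl) :=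
  T.bundle.env_mul ∅ (r := (s : G ⧸ N)) rfl (T.orbit b s rfl) (T.orbit c t rfl)

theorem env_orbit_adj (s : G) (b : B) :
    T.bundle.env ∅ ((s⁻¹ : G) : G ⧸ N) (T.orbit (star (α s⁻¹ b)) s⁻¹ rfl)
      = star (T.bundle.env ∅ (s : G ⧸ N) (T.orbit b s rfl)) :=
  T.bundle.env_adj ∅ (s := (s : G ⧸ N)) rfl (T.orbit b s rfl)

theorem env_orbit_rmul (s : G) (b : B) (n : N) :
    T.bundle.env ∅ (s : G ⧸ N) (T.orbit (T.rmul b n) s rfl)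
      = T.bundle.env ∅ (((n : G) * s : G) : G ⧸ N) (T.orbit b ((n : G) * s) rfl) := by
  -- The cosets of `s` and `ns` are equal but not definitionally so; with the coset as a variable
  -- both orbits live in one fibre and are the same orbit.
  have key : ∀ (x : G ⧸ N) (h : (((n : G) * s : G) : G ⧸ N) = x) (h' : (s : G ⧸ N) = x),
      T.bundle.env ∅ x (T.orbit (T.rmul b n) s h')
        = T.bundle.env ∅ (((n : G) * s : G) : G ⧸ N) (T.orbit b ((n : G) * s) rfl) := by
    rintro x rfl h'
    refine congrArg _ (Eq.symm (T.orbit_eq_orbit.mpr ⟨n, rfl, ?_⟩))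
    rw [inv_mul_cancel_left]
  refine key _ ?_ rfl
  rw [QuotientGroup.mk_mul, (QuotientGroup.eq_one_iff (n : G)).mpr n.2, one_mul]

/-- The homomorphism `(b, s) ↦ [b, s]` on finitely supported sections. -/
def secToBundle : (semidirect α).Sec →⋆ₙₐ[ℂ] T.bundle.FullCStar :=
  (semidirect α).secHom
    (fun s => T.bundle.env ∅ (s : G ⧸ N) ∘ₗ (T.orbitIsometry s).toLinearEquiv.toLinearMap)
    (fun r s b c => T.env_orbit_mul r s b c) (fun s b => T.env_orbit_adj s b)

theorem secToBundle_single (s : G) (b : B) : T.secToBundle ((semidirect α).single s b)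
    = T.bundle.env ∅ (s : G ⧸ N) (T.orbit b s rfl) :=
  (semidirect α).secHom_single _ _ _ s b

/-- The canonical map of the twisted crossed product into the cross sectional algebra of the
twisted semidirect product bundle, `(b, s) ↦ [b, s]`. -/
def toBundleCStar : T.TwistedCrossedProduct →⋆ₙₐ[ℂ] T.bundle.FullCStar :=
  (semidirect α).envLift T.secToBundle (by
    rintro _ ⟨b, s, n, rfl⟩
    rw [map_sub, sub_eq_zero]
    exact (T.secToBundle_single _ _).trans
      ((T.env_orbit_rmul s b n).trans (T.secToBundle_single _ _).symm))

theorem toBundleCStar_crossedElt (s : G) (b : B) :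
    T.toBundleCStar (crossedElt T.relations s b)
      = T.bundle.env ∅ (s : G ⧸ N) (T.orbit b s rfl) :=
  ((semidirect α).envLift_ι _ _ _).trans (T.secToBundle_single s b)

/-- The quotient by the twist relations cannot shrink `(b, s)`, since it still maps to `C*(B ×_N
G)`, where `[b, s]` has norm `‖b‖` by `norm_env`. -/
theorem norm_crossedElt (s : G) (b : B) : ‖crossedElt T.relations s b‖ = ‖b‖ := by
  refine le_antisymm (FellBundle.norm_env_le (𝒜 := semidirect α) T.relations s b) ?_
  have h := NonUnitalStarAlgHom.norm_apply_le T.toBundleCStar (crossedElt T.relations s b)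
  have h1 : ‖T.bundle.env ∅ (s : G ⧸ N) (T.orbit b s rfl)‖ = ‖b‖ :=
    (T.bundle.norm_env _ _).trans (T.norm_orbit b s rfl)
  rwa [toBundleCStar_crossedElt, h1] at h

theorem crossedElt_rmul (s : G) (b : B) (n : N) :
    crossedElt T.relations s (T.rmul b n) = crossedElt T.relations ((n : G) * s) b := by
  have h := (semidirect α).ι_eq_zero (K := T.relations) ⟨b, s, n, rfl⟩
  rw [map_sub, sub_eq_zero] at h
  exact h

/-- The isometric embedding `[b, s] ↦ (b, s)` of the fibres of the twisted semidirect product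
bundle into the twisted crossed product. -/
def fiberEmbedding (x : G ⧸ N) : T.Fiber x →ₗᵢ[ℂ] T.TwistedCrossedProduct where
  toLinearMap := crossedElt T.relations (rep x) ∘ₗ (T.repEquiv x).toLinearMap
  norm_map' a := (T.norm_crossedElt _ _).trans (T.norm_repEquiv a)

/-- The twist relations absorb the chosen representative, so that the embedding can be computed on
any orbit representative. -/
theorem fiberEmbedding_orbit {x : G ⧸ N} (b : B) (s : G) (h : (s : G ⧸ N) = x) :
    T.fiberEmbedding x (T.orbit b s h) = crossedElt T.relations s b := by
  show crossedElt T.relations (rep x) (T.repEquiv x (T.orbit b s h)) = _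
  rw [repEquiv_orbit, crossedElt_rmul, inv_mul_cancel_right]

theorem dualCoaction_crossedElt (s : G) (b : B) : T.dualCoaction (crossedElt T.relations s b)
    = SpatialTensor.tmul (crossedElt T.relations s b) (groupElt (s : G ⧸ N)) :=
  ((semidirect α).envLift_ι _ _ _).trans (gradedHom_single _ _ _ _ _ _ _)

theorem isCoaction_dualCoaction : IsCoaction T.dualCoaction :=
  isCoaction_of_graded (QuotientGroup.mk' N) T.dualCoaction_crossedElt

theorem crossedElt_adj (s : G) (b : B) :
    crossedElt T.relations s⁻¹ (star (α s⁻¹ b)) = star (crossedElt T.relations s b) :=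
  (semidirect α).env_adj T.relations rfl b

theorem fiberEmbedding_mul {x y z : G ⧸ N} (h : x * y = z) (a : T.Fiber x) (b : T.Fiber y) :
    T.fiberEmbedding z (T.orbitMul h a b) = T.fiberEmbedding x a * T.fiberEmbedding y b := by
  obtain ⟨a, rfl⟩ := T.exists_orbit a _ (rep_spec x)
  obtain ⟨b, rfl⟩ := T.exists_orbit b _ (rep_spec y)
  rw [orbitMul_orbit, fiberEmbedding_orbit, fiberEmbedding_orbit, fiberEmbedding_orbit,
    crossedElt_mul]

theorem fiberEmbedding_adj {x y : G ⧸ N} (h : x⁻¹ = y) (a : T.Fiber x) :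
    T.fiberEmbedding y (T.orbitAdj h a) = star (T.fiberEmbedding x a) := by
  obtain ⟨a, rfl⟩ := T.exists_orbit a _ (rep_spec x)
  rw [orbitAdj_orbit, fiberEmbedding_orbit, fiberEmbedding_orbit, crossedElt_adj]

theorem dualCoaction_fiberEmbedding {x : G ⧸ N} (a : T.Fiber x) :
    T.dualCoaction (T.fiberEmbedding x a)
      = SpatialTensor.tmul (T.fiberEmbedding x a) (groupElt x) := by
  obtain ⟨a, rfl⟩ := T.exists_orbit a _ (rep_spec x)
  rw [fiberEmbedding_orbit, dualCoaction_crossedElt, rep_spec]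

/-- The twisted semidirect product bundle is the bundle of spectral subspaces of the dual
coaction on the twisted crossed product. -/
def isoAssociated : FellBundle.Iso T.bundle (associatedBundle T.dualCoaction) :=
  isoAssociatedBundle T.bundle T.fiberEmbedding T.fiberEmbedding_mul T.fiberEmbedding_adj
    (fun M hM h => isTotal_crossedElt M hM fun p =>
      Eq.mp (congrArg (· ∈ M) (T.fiberEmbedding_orbit p.2 p.1 rfl))
        (h (p.1 : G ⧸ N) (T.orbit p.2 p.1 rfl)))
    (fun _ => T.dualCoaction_fiberEmbedding)

/-- The orbit bundle links the two sides: it pulls back to `B × G`, and it is the spectral bundle of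
the coaction of `G/N`. The composite bundle isomorphism induces an equivariant one of the full
C*-algebras. -/
theorem isInducedFrom : IsInducedFrom N (dualCoactionOfAction α) T.dualCoaction :=
  ⟨isCoaction_dualCoactionOfAction α, T.isCoaction_dualCoaction,
    (T.isoPullback.trans (T.isoAssociated.pullback N)).coactionsIsomorphic⟩

end GreenTwist

/-! ### The twist of a semidirect product bundle that is a pull-back -/

section

open scoped MultiplierAlgebra

/-- The identity `(xm)b = x(mb)` lets the right action of a multiplier determine its left action.
The twist axioms can therefore be verified on right multiplications alone. -/
theorem multiplier_ext {B : Type u} [NonUnitalCStarAlgebra B] {m m' : 𝓜(ℂ, B)}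
    (h : ∀ b, m.snd b = m'.snd b) : m = m' := by
  refine DoubleCentralizer.ext ℂ B _ _ (Prod.ext ?_ (ContinuousLinearMap.ext h))
  refine ContinuousLinearMap.ext fun b => eq_of_forall_mul_left_eq fun x => ?_
  rw [← m.central, ← m'.central, h]

end

namespace FellBundle.Iso

variable {G : Type u} [Group G] {B : Type u} [NonUnitalCStarAlgebra B]
  {α : G →* (B ≃⋆ₐ[ℂ] B)} {N : Subgroup G} [hN : N.Normal] {𝒟 : FellBundle.{u, u} (G ⧸ N)}
  (θ : Iso (semidirect α) (𝒟.pullback N))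

/-- The isometry of `B` onto the fibre `D_x` given by a representative `s` of the coset `x`. -/
def fib (s : G) {x : G ⧸ N} (h : (s : G ⧸ N) = x) : B ≃ₗᵢ[ℂ] 𝒟.fiber x := by
  subst h
  exact θ.equiv s

theorem fib_mul {s t r : G} {x y z : G ⧸ N} (hs : (s : G ⧸ N) = x) (ht : (t : G ⧸ N) = y)
    (hr : (r : G ⧸ N) = z) (h : x * y = z) (e : s * t = r) (b c : B) :
    𝒟.mul h (θ.fib s hs b) (θ.fib t ht c) = θ.fib r hr (b * α s c) := by
  subst hs ht hr
  exact (θ.map_mul e b c).symm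

theorem fib_adj {s t : G} {x y : G ⧸ N} (hs : (s : G ⧸ N) = x) (ht : (t : G ⧸ N) = y)
    (h : x⁻¹ = y) (e : s⁻¹ = t) (b : B) :
    𝒟.adj h (θ.fib s hs b) = θ.fib t ht (star (α t b)) := by
  subst hs ht
  refine (θ.map_adj e b).symm.trans (congrArg _ ?_)
  show star (α s⁻¹ b) = _
  rw [e]

theorem fib_congr {s t : G} {x : G ⧸ N} (hs : (s : G ⧸ N) = x) (ht : (t : G ⧸ N) = x)
    (e : s = t) (b : B) : θ.fib s hs b = θ.fib t ht b := by
  subst e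
  rfl

theorem mk_coe (n : N) : ((n : G) : G ⧸ N) = 1 := (QuotientGroup.eq_one_iff _).mpr n.2

theorem mk_mul_right {n : G} (hn : n ∈ N) {s : G} {x : G ⧸ N} (h : (s : G ⧸ N) = x) :
    ((n * s : G) : G ⧸ N) = x := by
  rw [QuotientGroup.mk_mul, (QuotientGroup.eq_one_iff _).mpr hn, one_mul, h]

/-- Right multiplication by the unitary multiplier `τ_n`. -/
def rightTwist (n : N) : B ≃ₗᵢ[ℂ] B :=
  (θ.fib (n : G) (mk_coe n)).trans (θ.fib 1 (QuotientGroup.mk_one N)).symm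

theorem fib_one_rightTwist (n : N) (b : B) :
    θ.fib 1 (QuotientGroup.mk_one N) (θ.rightTwist n b) = θ.fib (n : G) (mk_coe n) b :=
  (θ.fib 1 (QuotientGroup.mk_one N)).apply_symm_apply _

/-- On a fibre identified with `B` through `s`, right multiplication by `(d, 1)` is right
multiplication by `α_s(d)`, which runs over all of `B` and so separates points. -/
theorem fib_cancel {s : G} {x : G ⧸ N} (hs : (s : G ⧸ N) = x) {y : 𝒟.fiber x}
    {y' : 𝒟.fiber x}
    (h : ∀ d, 𝒟.mul (mul_one x) y (θ.fib 1 (QuotientGroup.mk_one N) d)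
      = 𝒟.mul (mul_one x) y' (θ.fib 1 (QuotientGroup.mk_one N) d)) : y = y' := by
  obtain ⟨b, rfl⟩ := (θ.fib s hs).surjective y
  obtain ⟨b', rfl⟩ := (θ.fib s hs).surjective y'
  refine congrArg _ (eq_of_forall_mul_right_eq fun d => ?_)
  have h1 := h (α s⁻¹ d)
  rw [θ.fib_mul hs _ hs _ (_root_.mul_one s), θ.fib_mul hs _ hs _ (_root_.mul_one s),
    ← StarAlgEquiv.mul_apply, ← _root_.map_mul α, mul_inv_cancel, map_one,
    StarAlgEquiv.one_apply] at h1
  exact (θ.fib s hs).injective h1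

/-- The twist is defined by comparing `n` with `1` but governs every pair `ns`, `s`. After
multiplying by `(d, 1)`, the left side factors as `(b, n)(α_s(d), s)`, and `(b, n)` may be rewritten
over `1`. -/
theorem fib_left_mul (n : N) {s : G} {x : G ⧸ N} (hs : (s : G ⧸ N) = x) (b : B) :
    θ.fib ((n : G) * s) (mk_mul_right n.2 hs) b = θ.fib s hs (θ.rightTwist n b) := by
  refine θ.fib_cancel hs fun d => ?_
  rw [θ.fib_mul _ _ (mk_mul_right n.2 hs) _ (_root_.mul_one _),
    θ.fib_mul hs _ hs _ (_root_.mul_one s), _root_.map_mul α (n : G) s, StarAlgEquiv.mul_apply,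
    ← θ.fib_mul (mk_coe n) hs (mk_mul_right n.2 hs) (_root_.one_mul x) rfl,
    ← fib_one_rightTwist, θ.fib_mul _ _ hs _ (_root_.one_mul s), map_one, StarAlgEquiv.one_apply]

/-- This is `α_n(c) τ_n = τ_n c`, obtained by multiplying the element `(b, n)` of the unit fibre of
`𝒟` on the right by `(c, 1)`. -/
theorem rightTwist_mul_action (n : N) (b c : B) :
    θ.rightTwist n (b * α (n : G) c) = θ.rightTwist n b * c := by
  apply (θ.fib 1 (QuotientGroup.mk_one N)).injective
  rw [fib_one_rightTwist,
    ← θ.fib_mul (mk_coe n) (QuotientGroup.mk_one N) (mk_coe n) (_root_.mul_one 1) (_root_.mul_one _),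
    ← fib_one_rightTwist, θ.fib_mul _ _ (QuotientGroup.mk_one N) _ (_root_.mul_one 1), map_one,
    StarAlgEquiv.one_apply]

/-- Left multiplication by `(b, 1)` looks the same over `n` and over `1`; so the twist commutes with
left multiplications, as the right action of a multiplier must. -/
theorem rightTwist_mul (n : N) (b c : B) :
    θ.rightTwist n (b * c) = b * θ.rightTwist n c := by
  apply (θ.fib 1 (QuotientGroup.mk_one N)).injective
  have h : b * θ.rightTwist n c = b * α 1 (θ.rightTwist n c) := by
    rw [map_one, StarAlgEquiv.one_apply]
  rw [fib_one_rightTwist, h,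
    ← θ.fib_mul (QuotientGroup.mk_one N) (QuotientGroup.mk_one N) _ (_root_.one_mul 1) (_root_.one_mul 1),
    fib_one_rightTwist, θ.fib_mul _ _ (mk_coe n) _ (_root_.one_mul _), map_one,
    StarAlgEquiv.one_apply]

theorem rightTwist_one (b : B) : θ.rightTwist 1 b = b :=
  (θ.fib 1 (QuotientGroup.mk_one N)).injective (θ.fib_one_rightTwist 1 b)

/-- Both sides describe the element of the unit fibre of `𝒟` given by `(b, mn)`. Right
multiplications compose in the order that makes `τ` a homomorphism. -/
theorem rightTwist_rightTwist (m n : N) (b : B) :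
    θ.rightTwist n (θ.rightTwist m b) = θ.rightTwist (m * n) b := by
  apply (θ.fib 1 (QuotientGroup.mk_one N)).injective
  rw [fib_one_rightTwist, ← fib_left_mul, fib_one_rightTwist]
  rfl

/-- The element `(α_n(b*), n)` has adjoint `(b, n⁻¹)`; computing the same adjoint from its
description over `1` gives the left side. In multiplier terms this is `τ_n* = τ_{n⁻¹}`. -/
theorem star_rightTwist_action (n : N) (b : B) :
    star (θ.rightTwist n (α (n : G) (star b))) = θ.rightTwist n⁻¹ b := by
  apply (θ.fib 1 (QuotientGroup.mk_one N)).injective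
  rw [fib_one_rightTwist]
  have h := θ.fib_adj (QuotientGroup.mk_one N) (QuotientGroup.mk_one N) inv_one inv_one
    (θ.rightTwist n (α (n : G) (star b)))
  rw [map_one, StarAlgEquiv.one_apply, fib_one_rightTwist,
    θ.fib_adj (mk_coe n) (mk_coe n⁻¹) inv_one rfl] at h
  have e : α ((n : G)⁻¹) (α (n : G) (star b)) = star b := by
    rw [← StarAlgEquiv.mul_apply, ← _root_.map_mul α, inv_mul_cancel, map_one,
      StarAlgEquiv.one_apply]
  rw [← h]
  refine congrArg _ ?_
  exact (congrArg star e).trans (star_star b)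

/-- The product `(c, s)(b, n)` lies over `sn = (sns⁻¹)s`. Rewriting `(b, n)` over `1` produces
`α_s(b τ_n)`, while `fib_left_mul` for `sns⁻¹` produces the other side. The auxiliary factor `c` is
cancelled at the outset. -/
theorem action_rightTwist (s : G) (n : N) (b : B) : α s (θ.rightTwist n b)
    = θ.rightTwist ⟨s * n * s⁻¹, hN.conj_mem n n.2 s⟩ (α s b) := by
  set n' : N := ⟨s * n * s⁻¹, hN.conj_mem n n.2 s⟩ with hn'
  refine eq_of_forall_mul_left_eq fun c => ?_
  rw [← rightTwist_mul]
  apply (θ.fib s rfl).injective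
  have e : (n' : G) * s = s * n := by simp [hn']
  have h : ((s * n : G) : G ⧸ N) = (s : G ⧸ N) := e ▸ mk_mul_right n'.2 rfl
  rw [← fib_left_mul, θ.fib_congr _ h e,
    ← θ.fib_mul (s := s) (t := n) rfl (mk_coe n) h (mul_one _) rfl, ← fib_one_rightTwist,
    θ.fib_mul _ _ rfl _ (_root_.mul_one s)]

open scoped MultiplierAlgebra

/-- The multiplier `τ_n`. -/
def twistMultiplier (n : N) : 𝓜(ℂ, B) where
  -- The left action is forced by the right one: `τ_n b = α_n(b) τ_n`.
  fst := LinearMap.mkContinuous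
    ((θ.rightTwist n).toLinearEquiv.toLinearMap ∘ₗ
      (⟨⟨α (n : G), map_add _⟩, map_smul _⟩ : B →ₗ[ℂ] B)) 1 fun b => by
        rw [_root_.one_mul]
        exact ((θ.rightTwist n).norm_map _).trans_le (norm_starAlgEquiv _ b).le
  snd := (θ.rightTwist n : B →L[ℂ] B)
  central b c := by
    show θ.rightTwist n b * c = b * θ.rightTwist n (α (n : G) c)
    rw [← rightTwist_mul_action, rightTwist_mul]

theorem twistMultiplier_one : θ.twistMultiplier 1 = 1 :=
  multiplier_ext θ.rightTwist_one

theorem twistMultiplier_mul (m n : N) :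
    θ.twistMultiplier (m * n) = θ.twistMultiplier m * θ.twistMultiplier n :=
  multiplier_ext fun b => (θ.rightTwist_rightTwist m n b).symm

theorem star_twistMultiplier (n : N) : star (θ.twistMultiplier n) = θ.twistMultiplier n⁻¹ :=
  multiplier_ext fun b => θ.star_rightTwist_action n b

/-- If the semidirect product bundle is a pull-back from `G/N`, then the action is twisted
over `N`. -/
def greenTwist : GreenTwist α N where
  τ :=
    { toFun := fun n => ⟨θ.twistMultiplier n, by
        rw [Unitary.mem_iff, star_twistMultiplier, ← twistMultiplier_mul, ← twistMultiplier_mul,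
          inv_mul_cancel, mul_inv_cancel, twistMultiplier_one]
        exact ⟨rfl, rfl⟩⟩
      map_one' := Subtype.ext θ.twistMultiplier_one
      map_mul' := fun m n => Subtype.ext (θ.twistMultiplier_mul m n) }
  equivariant s n := multiplier_ext fun b => by
    rw [multiplierExt_snd]
    show α s (θ.rightTwist n ((α s).symm b)) = θ.rightTwist _ b
    rw [action_rightTwist, StarAlgEquiv.apply_symm_apply]
  implements n b := multiplier_ext fun x => by
    -- Read from the right, this is `x α_n(b) = ((x τ_n) b) τ_{n⁻¹}`.
    show x * α (n : G) b = θ.rightTwist n⁻¹ (θ.rightTwist n x * b)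
    rw [← rightTwist_mul_action, rightTwist_rightTwist, mul_inv_cancel, rightTwist_one]

end FellBundle.Iso

end FellCoaction

end

/-! ### The theorem -/

theorem theorem5p3 {G : Type u} [Group G] (N : Subgroup G) [N.Normal]
    {B : Type u} [NonUnitalCStarAlgebra B] (α : G →* (B ≃⋆ₐ[ℂ] B)) :
    -- the bundle of a twisted action pulls back to the semidirect product bundle, and the dual
    -- coaction of `G` is induced from the dual coaction of `G/N` on the twisted crossed product
    (∀ T : GreenTwist α N,
      Nonempty (FellBundle.Iso (semidirect α) (FellBundle.pullback N T.bundle)) ∧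
      IsInducedFrom N (dualCoactionOfAction α) T.dualCoaction) ∧
    -- `B × G` is a pull-back from `G/N` iff the dual coaction is induced from `G/N`
    ((∃ 𝒟 : FellBundle.{u, u} (G ⧸ N),
        Nonempty (FellBundle.Iso (semidirect α) (FellBundle.pullback N 𝒟))) ↔
      ∃ (D : Type u) (_ : NonUnitalCStarAlgebra D)
        (δ : D →⋆ₙₐ[ℂ] SpatialTensor D (GroupCStar (G ⧸ N))),
        IsInducedFrom N (dualCoactionOfAction α) δ) ∧
    -- and in this case the action is twisted over `N`
    ((∃ 𝒟 : FellBundle.{u, u} (G ⧸ N),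
        Nonempty (FellBundle.Iso (semidirect α) (FellBundle.pullback N 𝒟))) →
      Nonempty (GreenTwist α N)) := by
  refine ⟨fun T => ⟨⟨T.isoPullback⟩, T.isInducedFrom⟩, ⟨?_, ?_⟩, ?_⟩
  · rintro ⟨𝒟, ⟨θ⟩⟩
    -- The witness is the dual coaction on the twisted crossed product of the twist extracted from
    -- `θ`, so the coaction axioms need not be checked on `C*(𝒟)` for an arbitrary `𝒟`.
    exact ⟨_, _, _, θ.greenTwist.isInducedFrom⟩
  · rintro ⟨D, _, δ, -, -, h⟩
    -- Both coactions are dual coactions of Fell bundles, and `isoSpectral` recovers each bundle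
    -- from its spectral subspaces, which the equivariant isomorphism matches.
    obtain ⟨η⟩ := h.nonempty_iso
    exact ⟨associatedBundle δ,
      ⟨((isoSpectral (semidirect α)).trans η).trans (isoSpectral _).symm⟩⟩
  · rintro ⟨𝒟, ⟨θ⟩⟩
    exact ⟨θ.greenTwist⟩
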